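/- Let $q\in C^\infty[0,\infty)$ be real-valued. In $\mathcal H=L_2(0,\infty)$ (complex-valued functions) let $L_0y=-y''+qy$ with $$\mathrm{Dom}\,L_0=\{y\in\mathcal H\cap H^2_{\rm loc}[0,\infty):\ y(0)=y'(0)=0,\ -y''+qy\in\mathcal H\}.$$ Assume that the limit point case takes place at infinity and that $L_0$ is positive definite: for some $\varkappa>0$, $(L_0y,y)\ge\varkappa\|y\|^2$ for all $y\in\mathrm{Dom}\,L_0$. Let $L$ be the Friedrichs extension of $L_0$, $\mathcal K=\mathrm{Ker}\,L_0^*$ and $\Gamma_1=L^{-1}L_0^*-\mathbb I$. *Reachable subspaces.* For $T\ge0$ let $\mathcal U^T$ be the set of the states $u(T)$, where $u\in C^\infty([0,\infty);\mathcal H)$ solves $u_{tt}+L_0^*u=0$ $(t>0)$, $u(0)=u_t(0)=0$, $\Gamma_1u=h$ $(t\ge0)$, and $h\in C^\infty([0,\infty);\mathcal K)$ vanishes near $t=0$. *Wave isotony.* For a closed subspace $\mathcal G\subseteq\mathcal H$ let $I^0\mathcal G=\mathcal G$ and, for $t>0$, let $I^t\mathcal G$ be the closure of $$\Big\{\int_0^tL^{-1/2}\sin\big[(t-s)L^{1/2}\big]g(s)\,ds:\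 g\in L_2^{\rm loc}([0,\infty);\mathcal G)\Big\}.$$ *Wave spectrum.* Let $\mathfrak L$ be the smallest family of closed subspaces of $\mathcal H$ that contains all $\overline{\mathcal U^T}$, $T\ge0$, together with $\{0\}$ and $\mathcal H$, is closed under $\mathcal A\vee\mathcal B=\overline{\mathcal A+\mathcal B}$, $\mathcal A\cap\mathcal B$ and $\mathcal A^\perp$, and is invariant under all $I^t$. Let $\overline{\mathcal F}$ be the set of all functions $f$ on $[0,\infty)$ with closed subspaces of $\mathcal H$ as values for which there are $\mathcal L_n\in\mathfrak L$ such that, for every $t\ge0$, the orthogonal projections on $I^t\mathcal L_n$ converge strongly to the projection on $f(t)$. Order $\overline{\mathcal F}$ by pointwise inclusion. The wave spectrum $\Omega$ is the set of atoms of $\overline{\mathcal F}$, that is, of its minimal elements other than the function identically equal to $\{0\}$. *Eikonals.* For $\omega\in\Omega$ let $P_{\omega(t)}$ be the orthogonal projection on $\omega(t)$, and let $\tau_\omega=\int_{[0,\infty)}t\,dP_{\omega(t)}$, an unbounded operator in $\mathcal H$ (a strong Riemann–Stieltjes integral, defined on the $y$ for which $\int_0^Tt\,dP_{\omega(t)}y$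 converges as $T\to\infty$). For $\omega,\omega'\in\Omega$ let $\tau(\omega,\omega')=\|\tau_\omega-\tau_{\omega'}\|\in[0,\infty]$ be the norm of the difference on $\mathrm{Dom}\,\tau_\omega\cap\mathrm{Dom}\,\tau_{\omega'}$. Then: 1. For all $\omega,\omega'\in\Omega$ the operator $\tau_\omega-\tau_{\omega'}$ is densely defined, and $\tau$ is a (finite) metric on $\Omega$. 2. The map $x\mapsto\omega_x$, where $\omega_x(t)=\{y\in L_2(0,\infty):\ y=0\text{ a.e. outside }\{s:|s-x|<t\}\}$, is a bijection of $[0,\infty)$ onto $\Omega$, and, if $x_\omega$ denotes the preimage of $\omega$, $$\tau(\omega,\omega')=|x_\omega-x_{\omega'}|\qquad\text{for all }\omega,\omega'\in\Omega.$$ In particular, $x\mapsto\omega_x$ is an isometry of $[0,\infty)$ with its standard distance onto $(\Omega,\tau)$. -/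

import Mathlib

open Set Filter Topology MeasureTheory
open scoped NNReal ENNReal ContDiff InnerProductSpace

noncomputable section

namespace WaveSpectrum

/-! ## Operators in an abstract Hilbert space -/

section Abstract

variable {H : Type*} [NormedAddCommGroup H] [InnerProductSpace ℂ H]

/-- `A` is positive definite: for some `κ > 0`, `(A y, y)` is real and `(A y, y) ≥ κ ‖y‖²`
for every `y ∈ Dom A`. -/
def IsPositiveDefinite (A : H →ₗ.[ℂ] H) : Prop :=
  ∃ κ : ℝ, 0 < κ ∧ ∀ y : A.domain,
    (⟪(y : H), A y⟫_ℂ).im = 0 ∧ κ * ‖(y : H)‖ ^ 2 ≤ (⟪(y : H), A y⟫_ℂ).re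

theorem IsPositiveDefinite.re_nonneg {A : H →ₗ.[ℂ] H} (hA : IsPositiveDefinite A)
    (y : A.domain) : 0 ≤ (⟪(y : H), A y⟫_ℂ).re := by
  obtain ⟨κ, hκ, h⟩ := hA
  exact le_trans (by positivity) (h y).2

/-- The domain of the closure of the quadratic form `(A y, y)`: limits in `H` of sequences in
`Dom A` that are Cauchy for the form. -/
def formDomain (A : H →ₗ.[ℂ] H) (hA : IsPositiveDefinite A) : Submodule ℂ H where
  carrier := {y | ∃ u : ℕ → A.domain, Tendsto (fun n => (u n : H)) atTop (𝓝 y) ∧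
    Tendsto (fun p : ℕ × ℕ =>
      (⟪((u p.1 - u p.2 : A.domain) : H), A (u p.1 - u p.2)⟫_ℂ).re) atTop (𝓝 0)}
  zero_mem' := ⟨fun _ => 0, by simp, by simp⟩
  add_mem' := by
    rintro a b ⟨u, hu, hu'⟩ ⟨v, hv, hv'⟩
    refine ⟨fun n => u n + v n, by simpa using hu.add hv, ?_⟩
    have hlim := (hu'.const_mul 2).add (hv'.const_mul 2)
    simp only [mul_zero, add_zero] at hlim
    refine squeeze_zero (fun p => hA.re_nonneg _) (fun p => ?_) hlim
    have hs : (u p.1 + v p.1) - (u p.2 + v p.2) = (u p.1 - u p.2) + (v p.1 - v p.2) := by abel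
    rw [hs]
    generalize u p.1 - u p.2 = x
    generalize v p.1 - v p.2 = z
    have h0 := hA.re_nonneg (x - z)
    rw [A.map_sub] at h0
    rw [A.map_add]
    simp only [Submodule.coe_add, Submodule.coe_sub, inner_add_left, inner_add_right,
      inner_sub_left, inner_sub_right, Complex.add_re, Complex.sub_re] at h0 ⊢
    linarith
  smul_mem' := by
    rintro c a ⟨u, hu, hu'⟩
    refine ⟨fun n => c • u n, by simpa using hu.const_smul c, ?_⟩
    have hlim := hu'.const_mul (‖c‖ ^ 2)
    simp only [mul_zero] at hlim
    refine hlim.congr fun p => ?_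
    rw [← smul_sub, A.map_smul, Submodule.coe_smul, inner_smul_left, inner_smul_right, ← mul_assoc,
      Complex.conj_mul', ← Complex.ofReal_pow, Complex.re_ofReal_mul]

variable [CompleteSpace H]

/-- The Friedrichs extension: the restriction of the adjoint `A*` to the vectors of `Dom A*` that
lie in the domain of the closed form. -/
def friedrichs (A : H →ₗ.[ℂ] H) (hA : IsPositiveDefinite A) : H →ₗ.[ℂ] H :=
  A.adjoint.domRestrict (formDomain A hA)

open Classical in
/-- The bounded everywhere defined inverse of `L`: the bounded operator `B` with
`L x = y ↔ B y = x` (and `0` if there is none). -/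
def boundedInverse (L : H →ₗ.[ℂ] H) : H →L[ℂ] H :=
  if h : ∃ B : H →L[ℂ] H, ∀ x y : H, (x, y) ∈ L.graph ↔ B y = x then h.choose else 0

/-- `L⁻¹` for the Friedrichs extension `L` of `A`. -/
def friedrichsInv (A : H →ₗ.[ℂ] H) (hA : IsPositiveDefinite A) : H →L[ℂ] H :=
  boundedInverse (friedrichs A hA)

/-- `L^{-1/2} sin (t L^{1/2})` for the Friedrichs extension `L` of `A`, by the continuous functional
calculus of the bounded self-adjoint operator `L⁻¹`: a spectral value `r` of `L⁻¹` corresponds to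
the spectral value `1 / r` of `L`. The function `r ↦ √r sin (t / √r)` is continuous on `ℝ`, with
the value `0` for `r ≤ 0`. -/
def sineOp (A : H →ₗ.[ℂ] H) (hA : IsPositiveDefinite A) (t : ℝ) : H →L[ℂ] H :=
  cfc (fun r : ℝ => √r * Real.sin (t / √r)) (friedrichsInv A hA)

/-! ### The system with boundary control and its reachable subspaces -/

/-- The boundary operator `Γ₁ = L⁻¹ A* - 1` on `Dom A*`. -/
def boundaryOp (A : H →ₗ.[ℂ] H) (hA : IsPositiveDefinite A) : A.adjoint.domain →ₗ[ℂ] H :=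
  (friedrichsInv A hA).toLinearMap ∘ₗ A.adjoint.toFun - A.adjoint.domain.subtype

/-- The smooth controls: smooth functions on `[0, ∞)` with values in `Ker A*` that vanish
near `t = 0`. -/
structure IsControl (A : H →ₗ.[ℂ] H) (h : ℝ → H) : Prop where
  smooth : ContDiffOn ℝ ∞ h (Ici 0)
  mem_ker : ∀ t, 0 ≤ t → (h t, (0 : H)) ∈ A.adjoint.graph
  vanish : ∃ ε : ℝ, 0 < ε ∧ ∀ t, 0 ≤ t → t ≤ ε → h t = 0

/-- `u` is a (smooth) classical solution of
`u_tt + A* u = 0` for `t > 0`, `u(0) = u_t(0) = 0`, `Γ₁ u = h` for `t ≥ 0`. -/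
structure IsSmoothWave (A : H →ₗ.[ℂ] H) (hA : IsPositiveDefinite A) (h u : ℝ → H) : Prop where
  smooth : ContDiffOn ℝ ∞ u (Ici 0)
  mem_domain : ∀ t, 0 ≤ t → u t ∈ A.adjoint.domain
  equation : ∀ t (ht : 0 < t),
    iteratedDerivWithin 2 u (Ici 0) t + A.adjoint ⟨u t, mem_domain t ht.le⟩ = 0
  initial : u 0 = 0
  initial_deriv : derivWithin u (Ici 0) 0 = 0
  boundary : ∀ t (ht : 0 ≤ t), boundaryOp A hA ⟨u t, mem_domain t ht⟩ = h t

/-- The set of states reachable at the time `T`. -/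
def reachableSet (A : H →ₗ.[ℂ] H) (hA : IsPositiveDefinite A) (T : ℝ≥0) : Set H :=
  {y | ∃ h u : ℝ → H, IsControl A h ∧ IsSmoothWave A hA h u ∧ u T = y}

/-- The reachable subspace: the closure of the reachable set (which is a linear subspace). -/
def reachableSubspace (A : H →ₗ.[ℂ] H) (hA : IsPositiveDefinite A) (T : ℝ≥0) :
    ClosedSubmodule ℂ H :=
  (Submodule.span ℂ (reachableSet A hA T)).closure

/-! ### The wave isotony -/

/-- The states `v(t) = ∫₀ᵗ L^{-1/2} sin ((t - s) L^{1/2}) g(s) ds` with `G`-valued `g` that are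
locally square integrable on `[0, ∞)`. -/
def sourceSet (A : H →ₗ.[ℂ] H) (hA : IsPositiveDefinite A) (t : ℝ≥0) (G : ClosedSubmodule ℂ H) :
    Set H :=
  {y | ∃ g : ℝ → H, (∀ R : ℝ, MemLp g 2 (volume.restrict (Ioc 0 R))) ∧ (∀ s, g s ∈ G) ∧
    y = ∫ s in (0 : ℝ)..t, sineOp A hA (t - s) (g s)}

open Classical in
/-- The wave isotony: `I⁰ = id`, and `Iᵗ G` is the closure of the set of states
(which is a linear subspace) for `t > 0`. -/
def waveIsotony (A : H →ₗ.[ℂ] H) (hA : IsPositiveDefinite A) (t : ℝ≥0) (G : ClosedSubmodule ℂ H) :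
    ClosedSubmodule ℂ H :=
  if t = 0 then G else (Submodule.span ℂ (sourceSet A hA t G)).closure

/-! ### The lattice, the lattice-valued functions and their atoms -/

/-- The smallest family of closed subspaces that contains the reachable subspaces, is closed under
the lattice operations and orthogonal complements, and is invariant under the wave isotony. -/
inductive WaveLattice (A : H →ₗ.[ℂ] H) (hA : IsPositiveDefinite A) : ClosedSubmodule ℂ H → Prop
  | reachable (T : ℝ≥0) : WaveLattice A hA (reachableSubspace A hA T)
  | bot : WaveLattice A hA ⊥
  | top : WaveLattice A hA ⊤
  | sup {M N : ClosedSubmodule ℂ H} :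
      WaveLattice A hA M → WaveLattice A hA N → WaveLattice A hA (M ⊔ N)
  | inf {M N : ClosedSubmodule ℂ H} :
      WaveLattice A hA M → WaveLattice A hA N → WaveLattice A hA (M ⊓ N)
  | orthogonal {M : ClosedSubmodule ℂ H} : WaveLattice A hA M → WaveLattice A hA Mᗮ
  | isotony (t : ℝ≥0) {M : ClosedSubmodule ℂ H} :
      WaveLattice A hA M → WaveLattice A hA (waveIsotony A hA t M)

/-- The orthogonal projection on a closed subspace. -/
def proj (M : ClosedSubmodule ℂ H) : H →L[ℂ] H := M.toSubmodule.starProjection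

/-- The completed set of functions: the pointwise limits, in the sense of strong convergence of
projections, of sequences of functions `t ↦ Iᵗ M` with `M` in the lattice. -/
def completedFunctions (A : H →ₗ.[ℂ] H) (hA : IsPositiveDefinite A) :
    Set (ℝ≥0 → ClosedSubmodule ℂ H) :=
  {f | ∃ M : ℕ → ClosedSubmodule ℂ H, (∀ n, WaveLattice A hA (M n)) ∧
    ∀ (t : ℝ≥0) (y : H),
      Tendsto (fun n => proj (waveIsotony A hA t (M n)) y) atTop (𝓝 (proj (f t) y))}

/-- The wave spectrum: the atoms (minimal non-zero elements) of the completed set of functions with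
its pointwise order. -/
def waveSpectrum (A : H →ₗ.[ℂ] H) (hA : IsPositiveDefinite A) :
    Set (ℝ≥0 → ClosedSubmodule ℂ H) :=
  {α | α ∈ completedFunctions A hA ∧ α ≠ (fun _ => ⊥) ∧
    ∀ α' ∈ completedFunctions A hA, α' ≠ (fun _ => ⊥) → α' ≤ α → α' = α}

/-! ### Eikonals -/

/-- A partition `0 = t₀ ≤ t₁ ≤ … ≤ tₙ = T` with tags `sᵢ ∈ [tᵢ, tᵢ₊₁]`. -/
structure TaggedPartition (T : ℝ≥0) where
  n : ℕ
  t : ℕ → ℝ≥0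
  s : ℕ → ℝ≥0
  mono : Monotone t
  left : t 0 = 0
  right : t n = T
  tag : ∀ i < n, s i ∈ Icc (t i) (t (i + 1))

/-- The filter on tagged partitions that expresses that the mesh tends to `0`. -/
def meshFilter (T : ℝ≥0) : Filter (TaggedPartition T) :=
  ⨅ δ ∈ Ioi (0 : ℝ), 𝓟 {π | ∀ i < π.n, (π.t (i + 1) : ℝ) - π.t i < δ}

/-- The Riemann–Stieltjes sum of `∫_{[0,T]} t dP_{α(t)} y`. -/
def riemannSum (α : ℝ≥0 → ClosedSubmodule ℂ H) {T : ℝ≥0} (π : TaggedPartition T) (y : H) : H :=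
  ∑ i ∈ Finset.range π.n,
    ((π.s i : ℝ) : ℂ) • (proj (α (π.t (i + 1))) y - proj (α (π.t i)) y)

/-- The graph of the operator `∫_{[0,∞)} t dP_{α(t)}`: the Riemann–Stieltjes integrals over `[0,T]`
exist as limits in norm, and they converge in norm as `T → ∞`. -/
def eikonalGraph (α : ℝ≥0 → ClosedSubmodule ℂ H) : Submodule ℂ (H × H) where
  carrier := {p | ∃ J : ℝ≥0 → H,
    (∀ T, Tendsto (fun π : TaggedPartition T => riemannSum α π p.1) (meshFilter T) (𝓝 (J T))) ∧
    Tendsto J atTop (𝓝 p.2)}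
  zero_mem' := ⟨fun _ => 0, fun T => by simpa [riemannSum] using tendsto_const_nhds, by simp⟩
  add_mem' := by
    rintro a b ⟨J, hJ, hJ'⟩ ⟨K, hK, hK'⟩
    refine ⟨fun T => J T + K T, fun T => ((hJ T).add (hK T)).congr fun π => ?_, hJ'.add hK'⟩
    simp only [riemannSum, ← Finset.sum_add_distrib, Prod.fst_add, map_add]
    refine Finset.sum_congr rfl fun i _ => ?_
    rw [← smul_add]
    congr 1
    abel
  smul_mem' := by
    rintro c a ⟨J, hJ, hJ'⟩
    refine ⟨fun T => c • J T, fun T => ((hJ T).const_smul c).congr fun π => ?_, hJ'.const_smul c⟩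
    simp only [riemannSum, Finset.smul_sum, Prod.smul_fst, map_smul]
    refine Finset.sum_congr rfl fun i _ => ?_
    rw [← smul_sub, smul_comm]

/-- The eikonal `τ_α = ∫_{[0,∞)} t dP_{α(t)}`, an in general unbounded operator. -/
def eikonal (α : ℝ≥0 → ClosedSubmodule ℂ H) : H →ₗ.[ℂ] H := (eikonalGraph α).toLinearPMap

/-- The norm of an operator on its domain, `∞` if the operator is unbounded. -/
def opNorm (T : H →ₗ.[ℂ] H) : ℝ≥0∞ := ⨆ y : T.domain, ⨆ _ : ‖(y : H)‖ ≤ 1, ‖T y‖ₑ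

/-- `τ(α, α') = ‖τ_α - τ_α'‖`, the norm of the operator `τ_α - τ_α'` on
`Dom τ_α ∩ Dom τ_α'`. -/
def eikonalDist (α α' : ℝ≥0 → ClosedSubmodule ℂ H) : ℝ≥0∞ := opNorm (eikonal α - eikonal α')

end Abstract

/-! ## The Sturm–Liouville operator on the half-line -/

/-- The space `L₂(0, ∞)` of complex-valued functions. -/
abbrev L2Half : Type := Lp ℂ 2 (volume.restrict (Ioi (0 : ℝ)))

/-- `f` is a function of the class `H²_loc([0, ∞))` with the derivatives `f₁ = f'` (continuous) and
`f₂ = f''` (locally square integrable on `[0, ∞)`). -/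
structure IsH2Loc (f f₁ f₂ : ℝ → ℂ) : Prop where
  memLp : ∀ R : ℝ, MemLp f₂ 2 (volume.restrict (Ioc 0 R))
  integral_deriv : ∀ x, 0 ≤ x → f x = f 0 + ∫ t in (0 : ℝ)..x, f₁ t
  integral_deriv₂ : ∀ x, 0 ≤ x → f₁ x = f₁ 0 + ∫ t in (0 : ℝ)..x, f₂ t

theorem IsH2Loc.intervalIntegrable₂ {f f₁ f₂ : ℝ → ℂ} (h : IsH2Loc f f₁ f₂) {x : ℝ}
    (hx : 0 ≤ x) : IntervalIntegrable f₂ volume 0 x := by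
  rw [intervalIntegrable_iff_integrableOn_Ioc_of_le hx]
  exact (h.memLp x).integrable (by norm_num)

theorem IsH2Loc.intervalIntegrable₁ {f f₁ f₂ : ℝ → ℂ} (h : IsH2Loc f f₁ f₂) {x : ℝ}
    (hx : 0 ≤ x) : IntervalIntegrable f₁ volume 0 x := by
  have hc : ContinuousOn (fun y => f₁ 0 + ∫ t in (0 : ℝ)..y, f₂ t) (uIcc 0 x) :=
    continuousOn_const.add (intervalIntegral.continuousOn_primitive_interval
      (by simpa [uIcc_of_le hx, integrableOn_Icc_iff_integrableOn_Ioc,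
        intervalIntegrable_iff_integrableOn_Ioc_of_le hx] using h.intervalIntegrable₂ hx))
  refine (hc.congr fun y hy => ?_).intervalIntegrable
  rw [uIcc_of_le hx] at hy
  exact h.integral_deriv₂ y hy.1

theorem IsH2Loc.add {f f₁ f₂ g g₁ g₂ : ℝ → ℂ} (hf : IsH2Loc f f₁ f₂) (hg : IsH2Loc g g₁ g₂) :
    IsH2Loc (f + g) (f₁ + g₁) (f₂ + g₂) where
  memLp R := (hf.memLp R).add (hg.memLp R)
  integral_deriv x hx := by
    simp only [Pi.add_apply]
    rw [intervalIntegral.integral_add (hf.intervalIntegrable₁ hx) (hg.intervalIntegrable₁ hx),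
      hf.integral_deriv x hx, hg.integral_deriv x hx]
    ring
  integral_deriv₂ x hx := by
    simp only [Pi.add_apply]
    rw [intervalIntegral.integral_add (hf.intervalIntegrable₂ hx) (hg.intervalIntegrable₂ hx),
      hf.integral_deriv₂ x hx, hg.integral_deriv₂ x hx]
    ring

theorem IsH2Loc.const_smul {f f₁ f₂ : ℝ → ℂ} (hf : IsH2Loc f f₁ f₂) (c : ℂ) :
    IsH2Loc (c • f) (c • f₁) (c • f₂) where
  memLp R := (hf.memLp R).const_smul c
  integral_deriv x hx := by
    simp only [Pi.smul_apply]
    rw [intervalIntegral.integral_smul, hf.integral_deriv x hx, smul_add]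
  integral_deriv₂ x hx := by
    simp only [Pi.smul_apply]
    rw [intervalIntegral.integral_smul, hf.integral_deriv₂ x hx, smul_add]

/-- The graph of `L₀`: pairs `(y, -y'' + q y)` with `y ∈ L₂(0, ∞) ∩ H²_loc([0, ∞))`,
`y(0) = y'(0) = 0` and `-y'' + q y ∈ L₂(0, ∞)`. -/
def slGraph (q : ℝ → ℝ) : Submodule ℂ (L2Half × L2Half) where
  carrier := {p | ∃ f f₁ f₂ : ℝ → ℂ, IsH2Loc f f₁ f₂ ∧ f 0 = 0 ∧ f₁ 0 = 0 ∧
    p.1 =ᵐ[volume.restrict (Ioi 0)] f ∧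
    p.2 =ᵐ[volume.restrict (Ioi 0)] fun x => -f₂ x + q x * f x}
  zero_mem' := by
    refine ⟨0, 0, 0, ⟨fun R => MemLp.zero, by simp, by simp⟩, rfl, rfl, Lp.coeFn_zero _ _ _, ?_⟩
    filter_upwards [Lp.coeFn_zero ℂ 2 (volume.restrict (Ioi (0 : ℝ)))] with x hx
    simpa using hx
  add_mem' := by
    rintro a b ⟨f, f₁, f₂, hf, hf0, hf1, hfa, hfb⟩ ⟨g, g₁, g₂, hg, hg0, hg1, hga, hgb⟩
    refine ⟨f + g, f₁ + g₁, f₂ + g₂, hf.add hg, by simp [hf0, hg0], by simp [hf1, hg1], ?_, ?_⟩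
    · filter_upwards [Lp.coeFn_add a.1 b.1, hfa, hga] with x h1 h2 h3
      rw [Prod.fst_add, h1, Pi.add_apply, Pi.add_apply, h2, h3]
    · filter_upwards [Lp.coeFn_add a.2 b.2, hfb, hgb] with x h1 h2 h3
      rw [Prod.snd_add, h1, Pi.add_apply, Pi.add_apply, Pi.add_apply, h2, h3]
      ring
  smul_mem' := by
    rintro c a ⟨f, f₁, f₂, hf, hf0, hf1, hfa, hfb⟩
    refine ⟨c • f, c • f₁, c • f₂, hf.const_smul c, by simp [hf0], by simp [hf1], ?_, ?_⟩
    · filter_upwards [Lp.coeFn_smul c a.1, hfa] with x h1 h2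
      rw [Prod.smul_fst, h1, Pi.smul_apply, Pi.smul_apply, h2]
    · filter_upwards [Lp.coeFn_smul c a.2, hfb] with x h1 h2
      rw [Prod.smul_snd, h1, Pi.smul_apply, Pi.smul_apply, Pi.smul_apply, h2]
      simp only [smul_eq_mul]
      ring

/-- The operator `L₀ y = -y'' + q y` in `L₂(0, ∞)`. -/
def slOp (q : ℝ → ℝ) : L2Half →ₗ.[ℂ] L2Half := (slGraph q).toLinearPMap

/-- The limit point case at infinity: for some (equivalently, every) complex `l`, the equation
`-y'' + q y = l y` on `[0, ∞)` has a solution which is not in `L₂(0, ∞)`. -/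
def IsLimitPoint (q : ℝ → ℝ) : Prop :=
  ∃ (l : ℂ) (y : ℝ → ℂ), ContDiffOn ℝ 2 y (Ici 0) ∧
    (∀ x, 0 ≤ x → -iteratedDerivWithin 2 y (Ici 0) x + q x * y x = l * y x) ∧
    ¬ MemLp y 2 (volume.restrict (Ioi (0 : ℝ)))

/-- `L₂(E)`: the functions of `L₂(0, ∞)` that vanish (almost everywhere) outside `E`. -/
def L2On (E : Set ℝ) : ClosedSubmodule ℂ L2Half where
  carrier := {y | ∀ᵐ s ∂(volume.restrict (Ioi (0 : ℝ))), s ∉ E → y s = 0}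
  zero_mem' := by
    filter_upwards [Lp.coeFn_zero ℂ 2 (volume.restrict (Ioi (0 : ℝ)))] with s hs _
    simpa using hs
  add_mem' := by
    intro a b ha hb
    change ∀ᵐ s ∂(volume.restrict (Ioi (0 : ℝ))), s ∉ E → (a + b : L2Half) s = 0
    filter_upwards [Lp.coeFn_add a b, ha, hb] with s h1 h2 h3 hs
    rw [h1, Pi.add_apply, h2 hs, h3 hs, add_zero]
  smul_mem' := by
    intro c a ha
    change ∀ᵐ s ∂(volume.restrict (Ioi (0 : ℝ))), s ∉ E → (c • a : L2Half) s = 0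
    filter_upwards [Lp.coeFn_smul c a, ha] with s h1 h2 hs
    rw [h1, Pi.smul_apply, h2 hs, smul_zero]
  isClosed' := by
    refine IsSeqClosed.isClosed fun u y hu hy => ?_
    obtain ⟨k, -, hk⟩ := (tendstoInMeasure_of_tendsto_Lp hy).exists_seq_tendsto_ae
    have hu' := ae_all_iff.2 fun n => (hu (k n) : ∀ᵐ s ∂(volume.restrict (Ioi (0 : ℝ))), _)
    change ∀ᵐ s ∂(volume.restrict (Ioi (0 : ℝ))), s ∉ E → y s = 0
    filter_upwards [hk, hu'] with s h1 h2 hs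
    refine tendsto_nhds_unique h1 ?_
    simp only [fun n => h2 n hs]
    exact tendsto_const_nhds

/-- The function `α_x(t) = L₂({x}ᵗ)`, where `{x}ᵗ` is the set of the points at distance less
than `t` from `x`. -/
def atomAt (x : ℝ≥0) (t : ℝ≥0) : ClosedSubmodule ℂ L2Half := L2On {s | |s - x| < t}

end WaveSpectrum

end

/-! Waves governed by `-y'' + q y` on the half-line travel with speed exactly one, so every subspace
in sight is an `L2On E` and the statement becomes one about neighbourhoods of subsets of `[0, ∞)`.

Operator side. Minimising the energy gives a bounded positive injective inverse `B = L⁻¹`, and the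
propagator `S(s) = L^{-1/2} sin (s L^{1/2})` is a continuous function of `B`. Elements of `Ran B`
vanish at `0` (`exists_rep_friedrichsInv`). By the limit point assumption `Ker L₀*` is spanned by
one vector `φ`, and the slope at `0` of `B g` is the scalar product of `φ` and `g`
(`exists_isKernelVector`).

Wave side. Evaluation of `B² g` at `x` is the scalar product with a vector `greenVec₂ x`. It is
extended oddly, and `q` evenly, to the whole line; this turns the Dirichlet problem into a Cauchy
problem on the line. A smooth curve `G` with `B G'' = -G` then gives a classical solution
(`isWave_inner`). Classical solutions are unique for initial data and, since time and space can be
exchanged in one dimension, for lateral data. After mollification in time the first gives finite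
speed (`sinOp_mem_thickening`), the second unique continuation (`mem_compl_thickening_of_sinOp`,
`mem_compl_ball_of_inner_sinOp`).

Consequences. Together these give `I^t L₂(E) = L₂(E^t)` for open `E` (`waveIsotony_L2On`), and by
duality with boundary controls the closure of the reachable set at time `T` is `L₂(0, T)`
(`reachableSubspace_eq`). Hence the lattice consists of spaces `L₂(E)` with `E` open and of null
frontier, and contains all `L₂(a, b)`.

Atoms. Let `I^t L₂(E_n)` converge to a nonzero function. The `E_n` cannot escape to infinity, so a
subsequence of points of `E_n` converges to some `x`, and the limit dominates `atomAt x`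
(`exists_atomAt_le`). Intervals shrinking to `x` realise `atomAt x`, and distinct ones are
incomparable, so these are exactly the atoms.

Metric. The eikonal of `atomAt x` is multiplication by `|s - x|`. The difference of two is
multiplication by `|s - x| - |s - x'|`, bounded by `|x - x'|`, with equality to the right of both
points (`eikonalDist_atomAt`). -/

noncomputable section

namespace WaveSpectrum

/-! ### The Friedrichs extension and its bounded inverse. -/

section Friedrichs

variable {H : Type*} [NormedAddCommGroup H] [InnerProductSpace ℂ H]

/-- A form `(x, A y)` with real diagonal values is Hermitian. -/
theorem inner_symm_of_im_eq_zero {D : Type*} [AddCommGroup D] [Module ℂ D] (i A : D →ₗ[ℂ] H)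
    (h : ∀ y, (⟪i y, A y⟫_ℂ).im = 0) (x y : D) : ⟪A x, i y⟫_ℂ = ⟪i x, A y⟫_ℂ := by
  have h1 := h (x + y)
  have h2 := h (x + Complex.I • y)
  have hx := h x
  have hy := h y
  simp only [map_add, map_smul, inner_add_left, inner_add_right, inner_smul_left,
    inner_smul_right, Complex.add_im, Complex.mul_im, Complex.mul_re, Complex.conj_I,
    Complex.neg_re, Complex.neg_im, Complex.I_re, Complex.I_im, Complex.add_re, hx, hy] at h1 h2
  rw [← inner_conj_symm]
  apply Complex.ext
  · simp only [Complex.conj_re]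
    linarith
  · simp only [Complex.conj_im]
    linarith

theorem IsPositiveDefinite.inner_symm {A : H →ₗ.[ℂ] H} (hA : IsPositiveDefinite A)
    (x y : A.domain) : ⟪A x, (y : H)⟫_ℂ = ⟪(x : H), A y⟫_ℂ :=
  inner_symm_of_im_eq_zero A.domain.subtype A.toFun (fun y => (hA.choose_spec.2 y).1) x y

theorem mem_formDomain_of_mem {A : H →ₗ.[ℂ] H} (hA : IsPositiveDefinite A) (y : A.domain) :
    (y : H) ∈ formDomain A hA :=
  ⟨fun _ => y, tendsto_const_nhds, by simp⟩

theorem IsPositiveDefinite.form_sub {A : H →ₗ.[ℂ] H} (hA : IsPositiveDefinite A)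
    (x y : A.domain) : (⟪((x - y : A.domain) : H), A (x - y)⟫_ℂ).re =
      (⟪(x : H), A x⟫_ℂ).re + (⟪(y : H), A y⟫_ℂ).re - 2 * (⟪(x : H), A y⟫_ℂ).re := by
  have h : (⟪(y : H), A x⟫_ℂ).re = (⟪(x : H), A y⟫_ℂ).re := by
    rw [← hA.inner_symm x y, ← inner_conj_symm (y : H), Complex.conj_re]
  simp only [A.map_sub, Submodule.coe_sub, inner_sub_left, inner_sub_right, Complex.sub_re, h]
  ring

theorem IsPositiveDefinite.form_add_smul {A : H →ₗ.[ℂ] H} (hA : IsPositiveDefinite A)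
    (x y : A.domain) (t : ℝ) :
    (⟪((x + (t : ℂ) • y : A.domain) : H), A (x + (t : ℂ) • y)⟫_ℂ).re =
      (⟪(x : H), A x⟫_ℂ).re + t ^ 2 * (⟪(y : H), A y⟫_ℂ).re +
        2 * t * (⟪(x : H), A y⟫_ℂ).re := by
  have h : (⟪(y : H), A x⟫_ℂ).re = (⟪(x : H), A y⟫_ℂ).re := by
    rw [← hA.inner_symm x y, ← inner_conj_symm (y : H), Complex.conj_re]
  simp only [A.map_add, A.map_smul, Submodule.coe_add, Submodule.coe_smul, inner_add_left,
    inner_add_right, inner_smul_left, inner_smul_right, Complex.add_re, Complex.conj_ofReal,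
    Complex.re_ofReal_mul, h]
  ring

variable [CompleteSpace H]

theorem mem_adjoint_graph_iff {A : H →ₗ.[ℂ] H} (hd : Dense (A.domain : Set H)) {y f : H} :
    (y, f) ∈ A.adjoint.graph ↔ ∀ x : A.domain, ⟪f, (x : H)⟫_ℂ = ⟪y, A x⟫_ℂ := by
  constructor
  · intro h x
    obtain ⟨z, hz, hz'⟩ := (LinearPMap.mem_graph_iff _).1 h
    simp only at hz hz'
    rw [← hz, ← hz']
    exact LinearPMap.adjoint_isFormalAdjoint hd z x
  · intro h
    refine (LinearPMap.mem_graph_iff _).2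
      ⟨⟨y, LinearPMap.mem_adjoint_domain_of_exists y ⟨f, h⟩⟩, rfl, ?_⟩
    exact LinearPMap.adjoint_apply_eq hd _ h

theorem mem_friedrichs_graph_iff {A : H →ₗ.[ℂ] H} (hA : IsPositiveDefinite A) {y f : H} :
    (y, f) ∈ (friedrichs A hA).graph ↔ y ∈ formDomain A hA ∧ (y, f) ∈ A.adjoint.graph := by
  constructor
  · intro h
    obtain ⟨⟨z, hz⟩, rfl, hz'⟩ := (LinearPMap.mem_graph_iff _).1 h
    refine ⟨hz.1, (LinearPMap.mem_graph_iff _).2 ⟨⟨z, hz.2⟩, rfl, ?_⟩⟩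
    exact hz'
  · rintro ⟨h1, h2⟩
    obtain ⟨⟨z, hz⟩, rfl, hz'⟩ := (LinearPMap.mem_graph_iff _).1 h2
    exact (LinearPMap.mem_graph_iff _).2 ⟨⟨z, h1, hz⟩, rfl, hz'⟩

/-- Minimisation of the energy functional yields a weak solution in the form domain. -/
theorem exists_mem_formDomain_weak {A : H →ₗ.[ℂ] H} (hA : IsPositiveDefinite A) (f : H) :
    ∃ y ∈ formDomain A hA, ∀ x : A.domain, ⟪f, (x : H)⟫_ℂ = ⟪y, A x⟫_ℂ := by
  obtain ⟨κ, hκ, hpos⟩ := id hA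
  set J : A.domain → ℝ := fun u => (⟪(u : H), A u⟫_ℂ).re - 2 * (⟪f, (u : H)⟫_ℂ).re with hJ
  have hbdd : BddBelow (range J) := by
    -- The minimum of `κ r² - 2 ‖f‖ r` over real `r`.
    refine ⟨-(‖f‖ ^ 2 / κ), ?_⟩
    rintro _ ⟨u, rfl⟩
    have h1 := (hpos u).2
    have h2 : (⟪f, (u : H)⟫_ℂ).re ≤ ‖f‖ * ‖(u : H)‖ :=
      (Complex.re_le_norm _).trans (norm_inner_le_norm _ _)
    have h3 : 0 ≤ (κ * ‖(u : H)‖ - ‖f‖) ^ 2 / κ := by positivity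
    have h4 : (κ * ‖(u : H)‖ - ‖f‖) ^ 2 / κ =
        κ * ‖(u : H)‖ ^ 2 - 2 * (‖f‖ * ‖(u : H)‖) + ‖f‖ ^ 2 / κ := by
      field_simp
      ring
    simp only [hJ]
    linarith
  set d := sInf (range J) with hd
  have hdle : ∀ u, d ≤ J u := fun u => csInf_le hbdd ⟨u, rfl⟩
  have hex : ∀ n : ℕ, ∃ u, J u < d + 1 / ((n : ℝ) + 1) := by
    intro n
    obtain ⟨_, ⟨u, rfl⟩, hu⟩ := exists_lt_of_csInf_lt (range_nonempty J)
      (show sInf (range J) < d + 1 / ((n : ℝ) + 1) by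
        have : 0 < 1 / ((n : ℝ) + 1) := by positivity
        linarith)
    exact ⟨u, hu⟩
  choose u hu using hex
  have hlim0 : Tendsto (fun n : ℕ => 1 / ((n : ℝ) + 1)) atTop (𝓝 0) :=
    tendsto_one_div_add_atTop_nhds_zero_nat
  have hcauchy : Tendsto (fun p : ℕ × ℕ =>
      (⟪((u p.1 - u p.2 : A.domain) : H), A (u p.1 - u p.2)⟫_ℂ).re) atTop (𝓝 0) := by
    have hl : Tendsto (fun p : ℕ × ℕ => 2 * (1 / ((p.1 : ℝ) + 1)) + 2 * (1 / ((p.2 : ℝ) + 1)))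
        atTop (𝓝 0) := by
      rw [← prod_atTop_atTop_eq]
      have := ((hlim0.comp (tendsto_fst (f := atTop) (g := (atTop : Filter ℕ)))).const_mul 2).add
        ((hlim0.comp (tendsto_snd (g := atTop) (f := (atTop : Filter ℕ)))).const_mul 2)
      simpa using this
    refine squeeze_zero (fun p => hA.re_nonneg _) (fun p => ?_) hl
    have h1 := (hu p.1).le
    have h2 := (hu p.2).le
    -- Parallelogram law: the form at `a - b` equals `2 J a + 2 J b - 4 J ((a + b) / 2)`, and the
    -- midpoint value is at least the infimum `d`.
    have h3 := hdle ((1 / 2 : ℂ) • (u p.1 + u p.2))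
    generalize u p.1 = a at *
    generalize u p.2 = b at *
    simp only [hJ] at h1 h2 h3
    rw [hA.form_sub]
    have h4 := hA.form_add_smul a b 1
    simp only [Complex.ofReal_one, one_smul] at h4
    simp only [A.map_smul, Submodule.coe_smul, inner_smul_left, inner_smul_right] at h3
    rw [show (1 / 2 : ℂ) = ((1 / 2 : ℝ) : ℂ) by simp] at h3
    simp only [Complex.conj_ofReal, Complex.re_ofReal_mul, h4] at h3
    rw [Submodule.coe_add, inner_add_right, Complex.add_re] at h3
    linarith
  have hcs : CauchySeq (fun n => (u n : H)) := by
    rw [Metric.cauchySeq_iff']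
    intro ε hε
    have := hcauchy.eventually (gt_mem_nhds (show 0 < κ * ε ^ 2 by positivity))
    obtain ⟨⟨N, M⟩, hN⟩ := eventually_atTop.1 this
    refine ⟨max N M, fun n hn => ?_⟩
    have h1 := hN (n, max N M) ⟨le_trans (le_max_left _ _) hn, le_max_right _ _⟩
    have h2 := (hpos (u n - u (max N M))).2
    simp only at h1
    rw [dist_eq_norm, ← Submodule.coe_sub]
    refine lt_of_pow_lt_pow_left₀ 2 hε.le ?_
    exact lt_of_mul_lt_mul_left (h2.trans_lt h1) hκ.le
  obtain ⟨y, hy⟩ := cauchySeq_tendsto_of_complete hcs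
  refine ⟨y, ⟨u, hy, hcauchy⟩, ?_⟩
  have key : ∀ x : A.domain, (⟪y, A x⟫_ℂ - ⟪f, (x : H)⟫_ℂ).re = 0 := by
    intro x
    -- Near-minimality of `u n` in the direction `x`. The energy of `u n` cancels in the difference,
    -- so only norm convergence of `u n` is needed in the limit.
    have hq : ∀ t : ℝ, 0 ≤ t ^ 2 * (⟪(x : H), A x⟫_ℂ).re +
        2 * t * (⟪y, A x⟫_ℂ - ⟪f, (x : H)⟫_ℂ).re := by
      intro t
      have hl : Tendsto (fun n => t ^ 2 * (⟪(x : H), A x⟫_ℂ).re +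
          2 * t * (⟪(u n : H), A x⟫_ℂ - ⟪f, (x : H)⟫_ℂ).re + 1 / ((n : ℝ) + 1)) atTop
          (𝓝 (t ^ 2 * (⟪(x : H), A x⟫_ℂ).re +
            2 * t * (⟪y, A x⟫_ℂ - ⟪f, (x : H)⟫_ℂ).re + 0)) := by
        refine Tendsto.add (Tendsto.add tendsto_const_nhds (Tendsto.const_mul _ ?_)) hlim0
        exact (Complex.continuous_re.tendsto _).comp
          ((hy.inner tendsto_const_nhds).sub tendsto_const_nhds)
      rw [add_zero] at hl
      refine ge_of_tendsto' hl fun n => ?_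
      have h1 := (hu n).le
      have h2 := hdle (u n + (t : ℂ) • x)
      simp only [hJ] at h1 h2
      rw [hA.form_add_smul, Submodule.coe_add, Submodule.coe_smul, inner_add_right,
        inner_smul_right, Complex.add_re, Complex.re_ofReal_mul] at h2
      rw [Complex.sub_re]
      linarith
    set a := (⟪(x : H), A x⟫_ℂ).re
    set b := (⟪y, A x⟫_ℂ - ⟪f, (x : H)⟫_ℂ).re
    have ha : 0 ≤ a := hA.re_nonneg x
    -- The minimiser would be `-b / a`; using `a + 1` avoids the case `a = 0` and still forces `b =
    -- 0`.
    have h1 := hq (-b / (a + 1))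
    have h2 : (-b / (a + 1)) ^ 2 * a + 2 * (-b / (a + 1)) * b = -(b ^ 2 * (a + 2)) / (a + 1) ^ 2 := by
      field_simp
      ring
    rw [h2, div_nonneg_iff] at h1
    have h3 : 0 < (a + 1) ^ 2 := by positivity
    have h4 : b ^ 2 * (a + 2) ≤ 0 := by
      rcases h1 with h | h
      · linarith [h.1]
      · linarith [h.2]
    have h5 : b ^ 2 ≤ 0 := by
      by_contra hb
      push Not at hb
      nlinarith
    exact pow_eq_zero_iff (two_ne_zero) |>.1 (le_antisymm h5 (sq_nonneg b))
  intro x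
  rw [← sub_eq_zero, ← neg_eq_zero, neg_sub]
  apply Complex.ext
  · simpa using key x
  -- The real part at `i x` is the imaginary part at `x`, up to sign.
  · have := key (Complex.I • x)
    rw [A.map_smul, Submodule.coe_smul, inner_smul_right, inner_smul_right, ← mul_sub,
      Complex.I_mul_re, neg_eq_zero] at this
    simpa using this

variable {A : H →ₗ.[ℂ] H} (hd : Dense (A.domain : Set H)) (hA : IsPositiveDefinite A)
include hd

/-- The Friedrichs extension has real quadratic form with the same lower bound. -/
theorem friedrichs_form {κ : ℝ} (_hκ : 0 < κ)
    (h : ∀ y : A.domain, κ * ‖(y : H)‖ ^ 2 ≤ (⟪(y : H), A y⟫_ℂ).re) {y f : H}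
    (hy : (y, f) ∈ (friedrichs A hA).graph) :
    (⟪y, f⟫_ℂ).im = 0 ∧ κ * ‖y‖ ^ 2 ≤ (⟪y, f⟫_ℂ).re := by
  obtain ⟨⟨u, hu, hc⟩, hadj⟩ := (mem_friedrichs_graph_iff hA).1 hy
  have hw := (mem_adjoint_graph_iff hd).1 hadj
  have hlim : ∀ x : A.domain, Tendsto (fun m => ⟪(u m : H), A x⟫_ℂ) atTop (𝓝 ⟪f, (x : H)⟫_ℂ) := by
    intro x
    rw [hw x]
    exact hu.inner tendsto_const_nhds
  have hflip : ∀ z : ℂ, (starRingEnd ℂ z).im = 0 ↔ z.im = 0 := fun z => by simp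
  have hnorm : Tendsto (fun m => κ * ‖(u m : H)‖ ^ 2) atTop (𝓝 (κ * ‖y‖ ^ 2)) :=
    (hu.norm.pow 2).const_mul κ
  have hfu : Tendsto (fun n => ⟪f, (u n : H)⟫_ℂ) atTop (𝓝 ⟪f, y⟫_ℂ) :=
    tendsto_const_nhds.inner hu
  have hev : ∀ ε : ℝ, 0 < ε → ∃ N, ∀ n ≥ N, ∀ m ≥ N,
      (⟪((u m - u n : A.domain) : H), A (u m - u n)⟫_ℂ).re < ε := by
    intro ε hε
    obtain ⟨⟨N, M⟩, hN⟩ := eventually_atTop.1 (hc.eventually (gt_mem_nhds hε))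
    exact ⟨max N M, fun n hn m hm =>
      hN (m, n) ⟨(le_max_left _ _).trans hm, (le_max_right _ _).trans hn⟩⟩
  rw [← inner_conj_symm]
  constructor
  · rw [hflip]
    obtain ⟨N₀, hN₀⟩ := hev 1 one_pos
    set C := 2 * (⟪(u N₀ : H), A (u N₀)⟫_ℂ).re + 2 with hC
    have hCpos : 0 < C := by
      have := hA.re_nonneg (u N₀)
      linarith
    have hbd : ∀ n ≥ N₀, (⟪(u n : H), A (u n)⟫_ℂ).re ≤ C := by
      intro n hn
      have h1 := hN₀ N₀ le_rfl n hn
      rw [hA.form_sub] at h1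
      -- Positivity at `u n - 2 u N₀` bounds the cross term by half the energy of `u n`, which is
      -- then absorbed.
      have h2 := hA.re_nonneg (u n + ((-2 : ℝ) : ℂ) • u N₀)
      rw [hA.form_add_smul] at h2
      linarith
    have him : ∀ x w : A.domain, ∀ δ : ℝ, 0 < δ → |(⟪(w : H), A x⟫_ℂ).im| ≤
        δ⁻¹ * (⟪(w : H), A w⟫_ℂ).re + δ * (⟪(x : H), A x⟫_ℂ).re := by
      intro x w δ hδ
      have aux : ∀ σ : ℝ, 0 ≤ (⟪(w : H), A w⟫_ℂ).re + σ ^ 2 * (⟪(x : H), A x⟫_ℂ).re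
          + 2 * σ * (⟪(w : H), A x⟫_ℂ).im := by
        intro σ
        -- The factor `-i` converts the real cross term of the form into the imaginary part to be
        -- estimated.
        have h2 := hA.re_nonneg (w + (σ : ℂ) • ((-Complex.I) • x))
        rw [hA.form_add_smul] at h2
        simp only [A.map_smul, Submodule.coe_smul, inner_smul_left, inner_smul_right] at h2
        simp only [map_neg, Complex.conj_I, neg_neg, neg_mul, Complex.neg_re,
          Complex.I_mul_re, Complex.I_mul_im] at h2
        linarith
      have hx := hA.re_nonneg x
      have hw := hA.re_nonneg w
      have h1 := aux δ
      have h2 := aux (-δ)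
      have h3 : 0 ≤ δ⁻¹ := by positivity
      have h4 := mul_nonneg h3 h1
      have h5 := mul_nonneg h3 h2
      have h6 : δ⁻¹ * δ = 1 := inv_mul_cancel₀ hδ.ne'
      have e1 : δ⁻¹ * ((⟪(w : H), A w⟫_ℂ).re + δ ^ 2 * (⟪(x : H), A x⟫_ℂ).re
          + 2 * δ * (⟪(w : H), A x⟫_ℂ).im) = δ⁻¹ * (⟪(w : H), A w⟫_ℂ).re
          + δ * (⟪(x : H), A x⟫_ℂ).re + 2 * (⟪(w : H), A x⟫_ℂ).im := by
        linear_combination (δ * (⟪(x : H), A x⟫_ℂ).re + 2 * (⟪(w : H), A x⟫_ℂ).im) * h6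
      have e2 : δ⁻¹ * ((⟪(w : H), A w⟫_ℂ).re + (-δ) ^ 2 * (⟪(x : H), A x⟫_ℂ).re
          + 2 * (-δ) * (⟪(w : H), A x⟫_ℂ).im) = δ⁻¹ * (⟪(w : H), A w⟫_ℂ).re
          + δ * (⟪(x : H), A x⟫_ℂ).re - 2 * (⟪(w : H), A x⟫_ℂ).im := by
        linear_combination (δ * (⟪(x : H), A x⟫_ℂ).re - 2 * (⟪(w : H), A x⟫_ℂ).im) * h6
      rw [e1] at h4
      rw [e2] at h5
      have h7 : 0 ≤ δ⁻¹ * (⟪(w : H), A w⟫_ℂ).re + δ * (⟪(x : H), A x⟫_ℂ).re := by positivity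
      rw [abs_le]
      constructor <;> linarith
    have hself : ∀ x : A.domain, (⟪(x : H), A x⟫_ℂ).im = 0 := fun x => (hA.choose_spec.2 x).1
    have hle : ∀ ε : ℝ, 0 < ε → |(⟪f, y⟫_ℂ).im| ≤ ε := by
      intro ε hε
      -- In the weighted Cauchy–Schwarz inequality `him`, `δ C = ε / 2` controls the bounded energy
      -- of `u n`, and an energy of `u m - u n` below `δ ε / 2` gives the other half.
      set δ := ε / (2 * C) with hδ
      have hδpos : 0 < δ := by positivity
      obtain ⟨N, hN⟩ := hev (δ * (ε / 2)) (by positivity)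
      have hfin : ∀ n ≥ max N N₀, |(⟪f, (u n : H)⟫_ℂ).im| ≤ ε := by
        intro n hn
        refine le_of_tendsto ((continuous_abs.comp Complex.continuous_im).tendsto _ |>.comp
          (hlim (u n))) ?_
        filter_upwards [eventually_ge_atTop (max N N₀)] with m hm
        simp only [Function.comp_apply]
        have h1 := him (u n) (u m - u n) δ hδpos
        rw [Submodule.coe_sub, inner_sub_left, Complex.sub_im, hself (u n), sub_zero] at h1
        refine h1.trans ?_
        have h2 := (hN n ((le_max_left _ _).trans hn) m ((le_max_left _ _).trans hm)).le
        rw [Submodule.coe_sub] at h2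
        have h3 := hbd n ((le_max_right _ _).trans hn)
        have h4 : δ⁻¹ * (δ * (ε / 2)) = ε / 2 := by rw [inv_mul_cancel_left₀ hδpos.ne']
        have h5 : δ * C = ε / 2 := by rw [hδ]; field_simp
        have h6 := mul_le_mul_of_nonneg_left h2 (inv_pos.2 hδpos).le
        have h7 := mul_le_mul_of_nonneg_left h3 hδpos.le
        linarith
      refine le_of_tendsto ((continuous_abs.comp Complex.continuous_im).tendsto _ |>.comp hfu) ?_
      filter_upwards [eventually_ge_atTop (max N N₀)] with n hn using hfin n hn
    exact abs_eq_zero.1 (le_antisymm (le_of_forall_pos_le_add (by simpa using hle)) (abs_nonneg _))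
  · rw [Complex.conj_re]
    refine le_of_forall_pos_le_add fun ε hε => ?_
    obtain ⟨N, hN⟩ := hev (2 * ε) (by positivity)
    -- The energies of `u n` and `u m` add up to twice the mixed form plus the small energy of `u m
    -- - u n`; as `m → ∞` the mixed form tends to the pairing with `f`.
    have hn : ∀ n ≥ N, κ * ‖(u n : H)‖ ^ 2 + κ * ‖y‖ ^ 2 ≤ 2 * (⟪f, (u n : H)⟫_ℂ).re + 2 * ε := by
      intro n hn
      have hl2 : Tendsto (fun m => 2 * (⟪(u m : H), A (u n)⟫_ℂ).re + 2 * ε) atTop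
          (𝓝 (2 * (⟪f, (u n : H)⟫_ℂ).re + 2 * ε)) :=
        (((Complex.continuous_re.tendsto _).comp (hlim (u n))).const_mul 2).add_const _
      refine le_of_tendsto_of_tendsto (hnorm.const_add _) hl2 ?_
      filter_upwards [eventually_ge_atTop N] with m hm
      have h1 := hN n hn m hm
      rw [hA.form_sub] at h1
      have := h (u n)
      have := h (u m)
      linarith
    have hl3 : Tendsto (fun n => 2 * (⟪f, (u n : H)⟫_ℂ).re + 2 * ε) atTop
        (𝓝 (2 * (⟪f, y⟫_ℂ).re + 2 * ε)) :=
      (((Complex.continuous_re.tendsto _).comp hfu).const_mul 2).add_const _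
    have := le_of_tendsto_of_tendsto (hnorm.add_const (κ * ‖y‖ ^ 2)) hl3
      (by filter_upwards [eventually_ge_atTop N] with n h using hn n h)
    linarith

theorem friedrichs_graph_unique {y z f : H} (hy : (y, f) ∈ (friedrichs A hA).graph)
    (hz : (z, f) ∈ (friedrichs A hA).graph) : y = z := by
  obtain ⟨κ, hκ, hpos⟩ := id hA
  have h := (friedrichs_form hd hA hκ (fun y => (hpos y).2)
    ((friedrichs A hA).graph.sub_mem hy hz)).2
  simp only [sub_self, inner_zero_right, Complex.zero_re] at h
  have : ‖y - z‖ ^ 2 ≤ 0 := by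
    by_contra hc
    push Not at hc
    have := mul_pos hκ hc
    linarith
  exact sub_eq_zero.1 (norm_eq_zero.1 (pow_eq_zero_iff two_ne_zero |>.1
    (le_antisymm this (sq_nonneg _))))

/-- Solvability comes from the energy minimisation; uniqueness and the bound `κ⁻¹` come from `κ ‖y‖²
≤ Re (y, f) ≤ ‖y‖ ‖f‖`. This also rules out the default value `0` of `boundedInverse`. -/
theorem exists_friedrichs_inverse :
    ∃ B : H →L[ℂ] H, ∀ x y : H, (x, y) ∈ (friedrichs A hA).graph ↔ B y = x := by
  obtain ⟨κ, hκ, hpos⟩ := id hA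
  have hex : ∀ f : H, ∃ y, (y, f) ∈ (friedrichs A hA).graph := by
    intro f
    obtain ⟨y, hy, hw⟩ := exists_mem_formDomain_weak hA f
    exact ⟨y, (mem_friedrichs_graph_iff hA).2 ⟨hy, (mem_adjoint_graph_iff hd).2 hw⟩⟩
  choose b hb using hex
  have huniq : ∀ {y f}, (y, f) ∈ (friedrichs A hA).graph → b f = y := fun h =>
    friedrichs_graph_unique hd hA (hb _) h
  let B₀ : H →ₗ[ℂ] H :=
    { toFun := b
      map_add' := fun f g => huniq ((friedrichs A hA).graph.add_mem (hb f) (hb g))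
      map_smul' := fun c f => huniq ((friedrichs A hA).graph.smul_mem c (hb f)) }
  refine ⟨B₀.mkContinuous κ⁻¹ fun f => ?_, fun x y => ⟨fun h => huniq h, fun h => ?_⟩⟩
  · change ‖b f‖ ≤ κ⁻¹ * ‖f‖
    have h1 := (friedrichs_form hd hA hκ (fun y => (hpos y).2) (hb f)).2
    have h2 : (⟪b f, f⟫_ℂ).re ≤ ‖b f‖ * ‖f‖ :=
      (Complex.re_le_norm _).trans (norm_inner_le_norm _ _)
    rw [inv_mul_eq_div, le_div_iff₀ hκ]
    rcases eq_or_lt_of_le (norm_nonneg (b f)) with h0 | h0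
    · rw [← h0, zero_mul]
      exact norm_nonneg _
    · refine le_of_mul_le_mul_left ?_ h0
      nlinarith
  · rw [← h]
    exact hb y

theorem friedrichsInv_eq_iff {x y : H} :
    friedrichsInv A hA y = x ↔ (x, y) ∈ (friedrichs A hA).graph := by
  have h := exists_friedrichs_inverse hd hA
  rw [friedrichsInv, boundedInverse, dif_pos h]
  exact (h.choose_spec x y).symm

theorem friedrichsInv_mem_graph (f : H) :
    (friedrichsInv A hA f, f) ∈ (friedrichs A hA).graph :=
  (friedrichsInv_eq_iff hd hA).1 rfl

theorem friedrichsInv_mem_adjoint_graph (f : H) :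
    (friedrichsInv A hA f, f) ∈ A.adjoint.graph :=
  ((mem_friedrichs_graph_iff hA).1 (friedrichsInv_mem_graph hd hA f)).2

theorem friedrichsInv_symm (f g : H) :
    ⟪friedrichsInv A hA f, g⟫_ℂ = ⟪f, friedrichsInv A hA g⟫_ℂ := by
  obtain ⟨κ, hκ, hpos⟩ := id hA
  refine (inner_symm_of_im_eq_zero LinearMap.id (friedrichsInv A hA).toLinearMap
    (fun f => ?_) f g)
  have h := (friedrichs_form hd hA hκ (fun y => (hpos y).2) (friedrichsInv_mem_graph hd hA f)).1
  simp only [LinearMap.id_apply, ContinuousLinearMap.coe_coe]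
  rw [← inner_conj_symm, Complex.conj_im, h, neg_zero]

theorem friedrichsInv_isPositive : (friedrichsInv A hA).IsPositive := by
  obtain ⟨κ, hκ, hpos⟩ := id hA
  refine ⟨fun f g => friedrichsInv_symm hd hA f g, fun f => ?_⟩
  have h := (friedrichs_form hd hA hκ (fun y => (hpos y).2) (friedrichsInv_mem_graph hd hA f)).2
  rw [ContinuousLinearMap.reApplyInnerSelf_apply]
  exact le_trans (by positivity) h

theorem friedrichsInv_injective : Function.Injective (friedrichsInv A hA) := by
  refine (injective_iff_map_eq_zero _).2 fun f hf => ?_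
  have h := (friedrichsInv_eq_iff hd hA).1 hf
  exact (friedrichs A hA).graph_fst_eq_zero_snd h rfl

/-- The orthogonal complement of the range of a symmetric operator is its kernel, which is trivial
here. -/
theorem friedrichsInv_denseRange : DenseRange (friedrichsInv A hA) := by
  have h : (friedrichsInv A hA).toLinearMap.range.topologicalClosure = ⊤ := by
    rw [Submodule.topologicalClosure_eq_top_iff, Submodule.eq_bot_iff]
    intro y hy
    apply friedrichsInv_injective hd hA
    rw [map_zero]
    refine ext_inner_left ℂ fun f => ?_
    rw [← friedrichsInv_symm hd hA, inner_zero_right]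
    exact (Submodule.mem_orthogonal _ _).1 hy _ ⟨f, rfl⟩
  exact Submodule.dense_iff_topologicalClosure_eq_top.2 h

/-- `Dom A ⊆ Dom L` and `L` extends `A`. -/
theorem friedrichsInv_apply_of_mem_graph {y f : H} (h : (y, f) ∈ A.graph) :
    friedrichsInv A hA f = y := by
  rw [friedrichsInv_eq_iff hd hA, mem_friedrichs_graph_iff, mem_adjoint_graph_iff hd]
  obtain ⟨z, rfl, rfl⟩ := (LinearPMap.mem_graph_iff _).1 h
  exact ⟨mem_formDomain_of_mem hA z, fun x => hA.inner_symm z x⟩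

end Friedrichs

/-! ### Sine and cosine propagators by the functional calculus of `L⁻¹`. -/

section Propagators

/-- `cfc` returns a default value unless the function is continuous on the spectrum. At `u = 0` the
factor `u` kills the bounded sine. -/
theorem continuous_mul_sin_div (t : ℝ) : Continuous fun u : ℝ => u * Real.sin (t / u) := by
  refine continuous_iff_continuousAt.2 fun u => ?_
  rcases eq_or_ne u 0 with rfl | hu
  · rw [ContinuousAt, zero_mul]
    refine squeeze_zero_norm (fun v => ?_) (continuous_abs.tendsto' (0 : ℝ) 0 abs_zero)
    rw [norm_mul, Real.norm_eq_abs]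
    exact mul_le_of_le_one_right (abs_nonneg _) (Real.abs_sin_le_one _)
  · fun_prop (disch := exact hu)

theorem continuous_sq_mul_cos_div (t : ℝ) : Continuous fun u : ℝ => u ^ 2 * Real.cos (t / u) := by
  refine continuous_iff_continuousAt.2 fun u => ?_
  rcases eq_or_ne u 0 with rfl | hu
  · rw [ContinuousAt, zero_pow two_ne_zero, zero_mul]
    refine squeeze_zero_norm (a := fun v : ℝ => v ^ 2) (fun v => ?_)
      ((continuous_pow 2).tendsto' (0 : ℝ) 0 (by simp))
    rw [norm_mul, Real.norm_eq_abs, abs_of_nonneg (sq_nonneg v)]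
    exact mul_le_of_le_one_right (sq_nonneg _) (Real.abs_cos_le_one _)
  · fun_prop (disch := exact hu)

theorem abs_sin_sub_sin_le (a b : ℝ) : |Real.sin a - Real.sin b| ≤ |a - b| := by
  have := (Convex.norm_image_sub_le_of_norm_hasDerivWithin_le (f := Real.sin) (f' := Real.cos)
    (C := 1) (s := univ) (fun x _ => (Real.hasDerivAt_sin x).hasDerivWithinAt)
    (fun x _ => Real.abs_cos_le_one x) convex_univ (mem_univ b) (mem_univ a))
  simpa using this

/-- The remainder is uniform in `u`; it becomes an operator norm estimate through `norm_cfc_le`. -/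
theorem abs_cos_taylor_le (u h : ℝ) :
    |Real.cos (u + h) - Real.cos u + h * Real.sin u| ≤ h ^ 2 := by
  have hd : ∀ x ∈ uIcc 0 h, HasDerivWithinAt (fun x => Real.cos (u + x) + x * Real.sin u)
      (-Real.sin (u + x) + Real.sin u) (uIcc 0 h) x := fun x _ => by
    have h1 := ((Real.hasDerivAt_cos (u + x)).comp_const_add u x).add
      ((hasDerivAt_id x).mul_const (Real.sin u))
    simp only [one_mul] at h1
    exact h1.hasDerivWithinAt
  have := Convex.norm_image_sub_le_of_norm_hasDerivWithin_le (C := |h|) hd (fun x hx => ?_)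
    (convex_uIcc 0 h) left_mem_uIcc right_mem_uIcc
  · simp only [add_zero, zero_mul, sub_zero, Real.norm_eq_abs, abs_mul_abs_self] at this
    rw [sq]
    convert! this using 2
    ring
  · rw [Real.norm_eq_abs, neg_add_eq_sub]
    refine (abs_sin_sub_sin_le _ _).trans ?_
    have h1 := abs_sub_left_of_mem_uIcc hx
    simpa using h1

theorem abs_sin_taylor_le (u h : ℝ) :
    |Real.sin (u + h) - Real.sin u - h * Real.cos u| ≤ h ^ 2 := by
  have := abs_cos_taylor_le (u - Real.pi / 2) h
  rw [show u - Real.pi / 2 + h = u + h - Real.pi / 2 by ring, Real.cos_sub_pi_div_two,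
    Real.cos_sub_pi_div_two, Real.sin_sub_pi_div_two] at this
  simpa [sub_eq_add_neg] using this

theorem hasDerivAt_of_norm_le_sq {E : Type*} [NormedAddCommGroup E] [NormedSpace ℝ E]
    {f : ℝ → E} {f' : E} {t C : ℝ} (h : ∀ s, ‖f (t + s) - f t - s • f'‖ ≤ C * s ^ 2) :
    HasDerivAt f f' t := by
  rw [hasDerivAt_iff_isLittleO_nhds_zero]
  refine (Asymptotics.IsBigO.of_bound C (Eventually.of_forall fun s => ?_)).trans_isLittleO
    (Asymptotics.isLittleO_pow_id one_lt_two)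
  simpa using h s

variable {H : Type*} [NormedAddCommGroup H] [InnerProductSpace ℂ H] [CompleteSpace H]

/-- `L^{-1/2} sin (t L^{1/2})` where `B = L⁻¹`. -/
def sinOp (B : H →L[ℂ] H) (t : ℝ) : H →L[ℂ] H :=
  cfc (fun r : ℝ => √r * Real.sin (t / √r)) B

/-- `L⁻¹ cos (t L^{1/2})` where `B = L⁻¹`. -/
def cosOp (B : H →L[ℂ] H) (t : ℝ) : H →L[ℂ] H :=
  cfc (fun r : ℝ => √r ^ 2 * Real.cos (t / √r)) B

theorem continuous_sinFun (t : ℝ) : Continuous fun r : ℝ => √r * Real.sin (t / √r) :=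
  (continuous_mul_sin_div t).comp Real.continuous_sqrt

theorem continuous_cosFun (t : ℝ) : Continuous fun r : ℝ => √r ^ 2 * Real.cos (t / √r) :=
  (continuous_sq_mul_cos_div t).comp Real.continuous_sqrt

variable {B : H →L[ℂ] H}

@[simp]
theorem sinOp_zero : sinOp B 0 = 0 := by
  simp [sinOp]

theorem sinOp_neg (t : ℝ) : sinOp B (-t) = -sinOp B t := by
  rw [sinOp, sinOp, ← cfc_neg]
  simp [neg_div]

theorem sinOp_isSelfAdjoint (t : ℝ) : IsSelfAdjoint (sinOp B t) := cfc_predicate _ _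

theorem inner_sinOp (t : ℝ) (x y : H) : ⟪sinOp B t x, y⟫_ℂ = ⟪x, sinOp B t y⟫_ℂ :=
  (ContinuousLinearMap.isSelfAdjoint_iff_isSymmetric.1 (sinOp_isSelfAdjoint t)) x y

/-- The factor `√r` cancels the Lipschitz constant `1 / √r` of the sine, uniformly over the
spectrum. -/
theorem norm_sinOp_sub_le (s t : ℝ) : ‖sinOp B s - sinOp B t‖ ≤ |s - t| := by
  rw [sinOp, sinOp, ← cfc_sub _ _ B (continuous_sinFun s).continuousOn
    (continuous_sinFun t).continuousOn]
  refine norm_cfc_le (abs_nonneg _) fun r _ => ?_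
  rw [Real.norm_eq_abs, ← mul_sub, abs_mul, abs_of_nonneg (Real.sqrt_nonneg r)]
  rcases eq_or_lt_of_le (Real.sqrt_nonneg r) with h | h
  · rw [← h, zero_mul]
    exact abs_nonneg _
  · calc √r * |Real.sin (s / √r) - Real.sin (t / √r)| ≤ √r * |s / √r - t / √r| :=
          mul_le_mul_of_nonneg_left (abs_sin_sub_sin_le _ _) h.le
      _ = |s - t| := by
          rw [← sub_div, abs_div, abs_of_pos h]
          field_simp

theorem norm_sinOp_le (t : ℝ) : ‖sinOp B t‖ ≤ |t| := by
  simpa using norm_sinOp_sub_le (B := B) t 0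

theorem continuous_sinOp : Continuous (sinOp B) := by
  refine LipschitzWith.continuous (K := 1) (LipschitzWith.of_dist_le_mul fun s t => ?_)
  simpa [dist_eq_norm] using norm_sinOp_sub_le s t

/-- The factor `L⁻¹` compensates two derivatives: the remainder at a spectral value `r > 0` is at
most `√r ^ 2 (h / √r) ^ 2 = h ^ 2`, so the derivative exists in operator norm. -/
theorem hasDerivAt_cosOp (t : ℝ) : HasDerivAt (cosOp B) (-sinOp B t) t := by
  refine hasDerivAt_of_norm_le_sq (C := 1) fun h => ?_
  have hc1 : Continuous fun r : ℝ => √r ^ 2 * Real.cos ((t + h) / √r)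
      - √r ^ 2 * Real.cos (t / √r) := (continuous_cosFun _).sub (continuous_cosFun _)
  have hc2 : Continuous fun r : ℝ => h • (√r * Real.sin (t / √r)) :=
    (continuous_sinFun t).const_smul h
  rw [cosOp, cosOp, sinOp, smul_neg, sub_neg_eq_add, ← cfc_smul h _ B
      (continuous_sinFun t).continuousOn,
    ← cfc_sub _ _ B (continuous_cosFun _).continuousOn (continuous_cosFun _).continuousOn,
    ← cfc_add B _ _ hc1.continuousOn hc2.continuousOn]
  refine norm_cfc_le (by positivity) fun r _ => ?_
  rcases eq_or_lt_of_le (Real.sqrt_nonneg r) with h0 | h0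
  · simp [← h0]
    positivity
  · have h1 := abs_cos_taylor_le (t / √r) (h / √r)
    have e : √r ^ 2 * Real.cos ((t + h) / √r) - √r ^ 2 * Real.cos (t / √r)
        + h • (√r * Real.sin (t / √r)) = √r ^ 2 * (Real.cos (t / √r + h / √r)
        - Real.cos (t / √r) + h / √r * Real.sin (t / √r)) := by
      rw [← add_div, smul_eq_mul]
      field_simp
    rw [e, Real.norm_eq_abs, abs_mul, abs_of_pos (by positivity : 0 < √r ^ 2)]
    refine (mul_le_mul_of_nonneg_left h1 (by positivity)).trans_eq ?_
    field_simp

variable (hB : B.IsPositive)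
include hB

theorem spectrum_nonneg {r : ℝ} (hr : r ∈ spectrum ℝ B) : 0 ≤ r :=
  spectrum_nonneg_of_nonneg (ContinuousLinearMap.nonneg_iff_isPositive B |>.2 hB) hr

theorem cosOp_zero : cosOp B 0 = B := by
  have h : (spectrum ℝ B).EqOn (fun r : ℝ => √r ^ 2 * Real.cos (0 / √r)) id := fun r hr => by
    simp [Real.sq_sqrt (spectrum_nonneg hB hr)]
  rw [cosOp, cfc_congr h, cfc_id ℝ B hB.isSelfAdjoint]

theorem comp_sinOp (t : ℝ) : B * sinOp B t = cfc (fun r : ℝ => r * (√r * Real.sin (t / √r))) B := by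
  rw [cfc_mul (fun r : ℝ => r) _ B continuousOn_id (continuous_sinFun t).continuousOn,
    cfc_id' ℝ B hB.isSelfAdjoint, sinOp]

theorem sinOp_comm (t : ℝ) : sinOp B t * B = B * sinOp B t := by
  rw [comp_sinOp hB]
  conv_lhs => rw [sinOp]; rhs; rw [← cfc_id' ℝ B hB.isSelfAdjoint]
  rw [← cfc_mul _ (fun r : ℝ => r) B (continuous_sinFun t).continuousOn continuousOn_id]
  simp only [mul_comm]

theorem sinOp_comm_apply (t : ℝ) (y : H) : sinOp B t (B y) = B (sinOp B t y) :=
  congrArg (fun T : H →L[ℂ] H => T y) (sinOp_comm hB t)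

/-- The Taylor remainder is at most `√r ^ 3 (h / √r) ^ 2 = √r h ^ 2`, and `r ≤ ‖B‖` on the spectrum.
-/
theorem hasDerivAt_comp_sinOp (t : ℝ) : HasDerivAt (fun t => B * sinOp B t) (cosOp B t) t := by
  refine hasDerivAt_of_norm_le_sq (C := √‖B‖) fun h => ?_
  have hc : ∀ t : ℝ, Continuous fun r : ℝ => r * (√r * Real.sin (t / √r)) := fun t =>
    continuous_id.mul (continuous_sinFun t)
  have hc1 : Continuous fun r : ℝ => r * (√r * Real.sin ((t + h) / √r))
      - r * (√r * Real.sin (t / √r)) := (hc _).sub (hc _)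
  have hc2 : Continuous fun r : ℝ => h • (√r ^ 2 * Real.cos (t / √r)) :=
    (continuous_cosFun t).const_smul h
  rw [comp_sinOp hB, comp_sinOp hB, cosOp, ← cfc_smul h _ B (continuous_cosFun t).continuousOn,
    ← cfc_sub _ _ B (hc _).continuousOn (hc _).continuousOn,
    ← cfc_sub _ _ B hc1.continuousOn hc2.continuousOn]
  refine norm_cfc_le (by positivity) fun r hr => ?_
  have hr0 := spectrum_nonneg hB hr
  rcases eq_or_lt_of_le (Real.sqrt_nonneg r) with h0 | h0
  · simp [← h0]
    positivity
  · have h1 := abs_sin_taylor_le (t / √r) (h / √r)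
    have e : r * (√r * Real.sin ((t + h) / √r)) - r * (√r * Real.sin (t / √r))
        - h • (√r ^ 2 * Real.cos (t / √r)) = √r ^ 3 * (Real.sin (t / √r + h / √r)
        - Real.sin (t / √r) - h / √r * Real.cos (t / √r)) := by
      have e' : ∀ a b c σ : ℝ, 0 < σ → σ ^ 2 * (σ * a) - σ ^ 2 * (σ * b) - h * (σ ^ 2 * c)
          = σ ^ 3 * (a - b - h / σ * c) := fun a b c σ hσ => by
        field_simp
      have := e' (Real.sin ((t + h) / √r)) (Real.sin (t / √r)) (Real.cos (t / √r)) _ h0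
      rw [Real.sq_sqrt hr0] at this
      rw [← add_div, smul_eq_mul, Real.sq_sqrt hr0, this]
    rw [e, Real.norm_eq_abs, abs_mul, abs_of_pos (by positivity : 0 < √r ^ 3)]
    refine (mul_le_mul_of_nonneg_left h1 (by positivity)).trans ?_
    have e2 : √r ^ 3 * (h / √r) ^ 2 = √r * h ^ 2 := by field_simp
    rw [e2]
    refine mul_le_mul_of_nonneg_right (Real.sqrt_le_sqrt ?_) (sq_nonneg _)
    have := (spectrum.norm_le_norm_mul_of_mem hr).trans
      (mul_le_of_le_one_right (norm_nonneg B) ContinuousLinearMap.norm_id_le)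
    rwa [Real.norm_eq_abs, abs_of_nonneg hr0] at this

theorem hasDerivAt_comp_sinOp_apply (y : H) (t : ℝ) :
    HasDerivAt (fun t => B (sinOp B t y)) (cosOp B t y) t :=
  ((ContinuousLinearMap.apply ℂ H y).restrictScalars ℝ).hasFDerivAt.comp_hasDerivAt t
    (hasDerivAt_comp_sinOp hB t)

omit hB in
theorem hasDerivAt_cosOp_apply (y : H) (t : ℝ) :
    HasDerivAt (fun t => cosOp B t y) (-sinOp B t y) t :=
  ((ContinuousLinearMap.apply ℂ H y).restrictScalars ℝ).hasFDerivAt.comp_hasDerivAt t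
    (hasDerivAt_cosOp t)

/-- The sine propagator has the strong derivative `1` at `t = 0`. -/
theorem tendsto_inv_smul_sinOp (hd : DenseRange B) (y : H) :
    Tendsto (fun t : ℝ => t⁻¹ • sinOp B t y) (𝓝[≠] 0) (𝓝 y) := by
  -- The difference quotients are contractions, so convergence need only be checked on the dense
  -- range of `B`, where the norm derivative of `B S(t)` applies.
  have hnorm : ∀ (t : ℝ) (z : H), ‖t⁻¹ • sinOp B t z‖ ≤ ‖z‖ := by
    intro t z
    rcases eq_or_ne t 0 with rfl | ht
    · simp
    · have h1 := (sinOp B t).le_of_opNorm_le (norm_sinOp_le t) z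
      rw [norm_smul, norm_inv, Real.norm_eq_abs, inv_mul_le_iff₀ (abs_pos.2 ht)]
      exact h1
  rw [Metric.tendsto_nhds]
  intro ε hε
  obtain ⟨w, hw⟩ := hd.exists_dist_lt y (show 0 < ε / 3 by positivity)
  have h1 : Tendsto (fun t : ℝ => t⁻¹ • sinOp B t (B w)) (𝓝[≠] 0) (𝓝 (B w)) := by
    have h := (hasDerivAt_comp_sinOp_apply hB w 0).tendsto_slope_zero
    simp only [zero_add, sinOp_zero, zero_apply, map_zero, sub_zero,
      cosOp_zero hB] at h
    simpa only [sinOp_comm_apply hB] using h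
  filter_upwards [(Metric.tendsto_nhds.1 h1) (ε / 3) (by positivity)] with t ht
  have h2 := hnorm t (y - B w)
  rw [map_sub, smul_sub, ← dist_eq_norm, ← dist_eq_norm] at h2
  have := dist_triangle4 (t⁻¹ • sinOp B t y) (t⁻¹ • sinOp B t (B w)) (B w) y
  rw [dist_comm (B w) y] at this
  linarith

end Propagators

/-! ### Absolute continuity and integration by parts. -/

section Calculus

/-- Increments of the primitive of `f` are dominated by those of the primitive of `‖f‖`, which
reduces the claim to real functions. -/
theorem absolutelyContinuousOnInterval_integral {E : Type*} [NormedAddCommGroup E]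
    [NormedSpace ℝ E] {f : ℝ → E} {a b c : ℝ}
    (h : IntervalIntegrable f volume a b) (hc : c ∈ uIcc a b) :
    AbsolutelyContinuousOnInterval (fun x => ∫ v in c..x, f v) a b := by
  have hN := h.norm.absolutelyContinuousOnInterval_intervalIntegral hc
  have hi : ∀ x ∈ uIcc a b, IntervalIntegrable f volume c x := fun x hx =>
    h.mono_set (uIcc_subset_uIcc hc hx)
  unfold AbsolutelyContinuousOnInterval at hN ⊢
  refine squeeze_zero' (Eventually.of_forall fun _ => Finset.sum_nonneg fun i _ => dist_nonneg)
    ?_ hN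
  rw [eventually_inf_principal]
  refine Eventually.of_forall fun E hE => Finset.sum_le_sum fun i hi' => ?_
  have h1 := (hE.1 i hi').1
  have h2 := (hE.1 i hi').2
  rw [dist_eq_norm, intervalIntegral.integral_interval_sub_left (hi _ h1) (hi _ h2),
    Real.dist_eq, intervalIntegral.integral_interval_sub_left (hi _ h1).norm (hi _ h2).norm]
  exact intervalIntegral.norm_integral_le_abs_integral_norm

/-- Integration by parts for primitives of integrable functions. -/
theorem integral_parts {F F' G G' : ℝ → ℂ} {R : ℝ} (hR : 0 ≤ R)
    (hF' : IntervalIntegrable F' volume 0 R) (hG' : IntervalIntegrable G' volume 0 R)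
    (hF : ∀ x, 0 ≤ x → F x = F 0 + ∫ t in (0 : ℝ)..x, F' t)
    (hG : ∀ x, 0 ≤ x → G x = G 0 + ∫ t in (0 : ℝ)..x, G' t) :
    ∫ x in (0 : ℝ)..R, (F' x * G x + F x * G' x) = F R * G R - F 0 * G 0 := by
  have h0 : (0 : ℝ) ∈ uIcc 0 R := left_mem_uIcc
  have hcong : ∀ K K' : ℝ → ℂ, IntervalIntegrable K' volume 0 R →
      (∀ x, 0 ≤ x → K x = K 0 + ∫ t in (0 : ℝ)..x, K' t) →
      AbsolutelyContinuousOnInterval (fun x => K 0 + ∫ t in (0 : ℝ)..x, K' t) 0 R ∧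
      ContinuousOn K (uIcc 0 R) := by
    intro K K' hK' hK
    have h1 : AbsolutelyContinuousOnInterval (fun x => K 0 + ∫ t in (0 : ℝ)..x, K' t) 0 R :=
      (LipschitzWith.const (K 0)).lipschitzOnWith.absolutelyContinuousOnInterval.add
        (absolutelyContinuousOnInterval_integral hK' h0)
    refine ⟨h1, h1.continuousOn.congr fun x hx => hK x ?_⟩
    rw [uIcc_of_le hR] at hx
    exact hx.1
  obtain ⟨aF, cF⟩ := hcong F F' hF' hF
  obtain ⟨aG, cG⟩ := hcong G G' hG' hG
  set P : ℝ → ℂ := fun x => F' x * G x + F x * G' x with hP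
  have hPi : IntervalIntegrable P volume 0 R :=
    (hF'.mul_continuousOn cG).add (hG'.continuousOn_mul cF)
  -- The product minus the primitive of its formal derivative is absolutely continuous with
  -- derivative zero almost everywhere, hence constant.
  have hac := (aF.smul aG).sub (absolutelyContinuousOnInterval_integral hPi h0)
  obtain ⟨C, hC⟩ := hac.const_of_ae_hasDerivAt_zero (by
    filter_upwards [hF'.ae_hasDerivAt_integral, hG'.ae_hasDerivAt_integral,
      hPi.ae_hasDerivAt_integral] with x h1 h2 h3 hx
    have hx0 : 0 ≤ x := by
      rw [uIcc_of_le hR] at hx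
      exact hx.1
    have e1 := (h1 hx 0 h0).const_add (F 0)
    have e2 := (h2 hx 0 h0).const_add (G 0)
    have e3 := (e1.mul e2).sub (h3 hx 0 h0)
    refine e3.congr_deriv ?_
    rw [← hF x hx0, ← hG x hx0]
    simp [hP])
  have e0 := hC 0 h0
  have eR := hC R right_mem_uIcc
  simp only [Pi.sub_apply, smul_eq_mul, Pi.mul_apply] at e0 eR
  rw [← hF R hR, ← hG R hR] at eR
  simp only [intervalIntegral.integral_same, add_zero, sub_zero] at e0
  rw [e0, ← eR]
  ring

end Calculus

/-! ### Functions of class `H²_loc`. -/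

section H2

namespace IsH2Loc

variable {f f₁ f₂ g g₁ g₂ : ℝ → ℂ}

theorem continuousOn₁ (h : IsH2Loc f f₁ f₂) : ContinuousOn f₁ (Ici 0) := by
  intro x hx
  have hc : ContinuousOn (fun y => f₁ 0 + ∫ t in (0 : ℝ)..y, f₂ t) (uIcc 0 (x + 1)) :=
    continuousOn_const.add (intervalIntegral.continuousOn_primitive_interval'
      (h.intervalIntegrable₂ (by linarith [mem_Ici.1 hx])) left_mem_uIcc)
  rw [uIcc_of_le (by linarith [mem_Ici.1 hx])] at hc
  have h1 : ContinuousWithinAt f₁ (Icc 0 (x + 1)) x :=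
    (hc.congr fun y hy => h.integral_deriv₂ y hy.1) x ⟨hx, by linarith⟩
  refine h1.mono_of_mem_nhdsWithin ?_
  rw [← Ici_inter_Iic]
  exact inter_mem_nhdsWithin _ (Iic_mem_nhds (by linarith))

theorem continuousOn (h : IsH2Loc f f₁ f₂) : ContinuousOn f (Ici 0) := by
  intro x hx
  have hc : ContinuousOn (fun y => f 0 + ∫ t in (0 : ℝ)..y, f₁ t) (uIcc 0 (x + 1)) :=
    continuousOn_const.add (intervalIntegral.continuousOn_primitive_interval'
      (h.intervalIntegrable₁ (by linarith [mem_Ici.1 hx])) left_mem_uIcc)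
  rw [uIcc_of_le (by linarith [mem_Ici.1 hx])] at hc
  have h1 : ContinuousWithinAt f (Icc 0 (x + 1)) x :=
    (hc.congr fun y hy => h.integral_deriv y hy.1) x ⟨hx, by linarith⟩
  refine h1.mono_of_mem_nhdsWithin ?_
  rw [← Ici_inter_Iic]
  exact inter_mem_nhdsWithin _ (Iic_mem_nhds (by linarith))

theorem hasDerivAt (h : IsH2Loc f f₁ f₂) {x : ℝ} (hx : 0 < x) : HasDerivAt f (f₁ x) x := by
  have h1 : HasDerivAt (fun y => f 0 + ∫ t in (0 : ℝ)..y, f₁ t) (f₁ x) x := by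
    refine HasDerivAt.const_add _ (intervalIntegral.integral_hasDerivAt_right
      (h.intervalIntegrable₁ hx.le) ?_ (h.continuousOn₁.continuousAt (Ici_mem_nhds hx)))
    exact (h.continuousOn₁.mono Ioi_subset_Ici_self).stronglyMeasurableAtFilter isOpen_Ioi x hx
  refine h1.congr_of_eventuallyEq ?_
  filter_upwards [Ioi_mem_nhds hx] with y hy using h.integral_deriv y hy.le

theorem sub (hf : IsH2Loc f f₁ f₂) (hg : IsH2Loc g g₁ g₂) :
    IsH2Loc (f - g) (f₁ - g₁) (f₂ - g₂) := by
  have := hf.add (hg.const_smul (-1))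
  simpa [sub_eq_add_neg] using this

theorem green (hf : IsH2Loc f f₁ f₂) (hg : IsH2Loc g g₁ g₂) {R : ℝ} (hR : 0 ≤ R) :
    ∫ x in (0 : ℝ)..R, (f x * g₂ x - f₂ x * g x) =
      (f R * g₁ R - f₁ R * g R) - (f 0 * g₁ 0 - f₁ 0 * g 0) := by
  have h1 := integral_parts hR (hf.intervalIntegrable₁ hR) (hg.intervalIntegrable₂ hR)
    hf.integral_deriv hg.integral_deriv₂
  have h2 := integral_parts hR (hf.intervalIntegrable₂ hR) (hg.intervalIntegrable₁ hR)
    hf.integral_deriv₂ hg.integral_deriv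
  have c : ∀ {k : ℝ → ℂ}, ContinuousOn k (Ici 0) → ContinuousOn k (uIcc 0 R) := fun hk =>
    hk.mono (by rw [uIcc_of_le hR]; exact Icc_subset_Ici_self)
  have i1 := ((hf.intervalIntegrable₁ hR).mul_continuousOn (c hg.continuousOn₁)).add
    ((hg.intervalIntegrable₂ hR).continuousOn_mul (c hf.continuousOn))
  have i2 := ((hf.intervalIntegrable₂ hR).mul_continuousOn (c hg.continuousOn)).add
    ((hg.intervalIntegrable₁ hR).continuousOn_mul (c hf.continuousOn₁))
  have e : ∫ x in (0 : ℝ)..R, (f x * g₂ x - f₂ x * g x) =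
      ∫ x in (0 : ℝ)..R, ((f₁ x * g₁ x + f x * g₂ x) - (f₂ x * g x + f₁ x * g₁ x)) := by
    congr 1
    ext x
    ring
  rw [e, intervalIntegral.integral_sub i1 i2, h1, h2]
  ring

/-- An `L₂` class thus determines `f` and `f₁` pointwise on `[0, ∞)`, so that Cauchy data at `0` are
meaningful, and determines `f₂` almost everywhere. -/
theorem eqOn_zero (h : IsH2Loc f f₁ f₂) (h0 : f =ᵐ[volume.restrict (Ioi 0)] 0) :
    EqOn f 0 (Ici 0) ∧ EqOn f₁ 0 (Ici 0) ∧ f₂ =ᵐ[volume.restrict (Ioi 0)] 0 := by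
  have hcl : ∀ {k : ℝ → ℂ}, ContinuousOn k (Ici 0) → EqOn k 0 (Ioi 0) → EqOn k 0 (Ici 0) := by
    intro k hk he
    exact he.of_subset_closure hk continuousOn_const Ioi_subset_Ici_self
      (by rw [closure_Ioi])
  have a1 : EqOn f 0 (Ioi 0) := Measure.eqOn_open_of_ae_eq h0 isOpen_Ioi
    (h.continuousOn.mono Ioi_subset_Ici_self) continuousOn_const
  have a2 : EqOn f₁ 0 (Ioi 0) := fun x hx => by
    refine (h.hasDerivAt hx).unique ((hasDerivAt_const x (0 : ℂ)).congr_of_eventuallyEq ?_)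
    filter_upwards [Ioi_mem_nhds hx] with y hy using a1 hy
  have a3 := hcl h.continuousOn₁ a2
  refine ⟨hcl h.continuousOn a1, a3, ?_⟩
  have hn : ∀ n : ℕ, ∀ᵐ x, x ∈ uIcc (0 : ℝ) n → ∀ c ∈ uIcc (0 : ℝ) n,
      HasDerivAt (fun x => ∫ t in c..x, f₂ t) (f₂ x) x := fun n =>
    (h.intervalIntegrable₂ n.cast_nonneg).ae_hasDerivAt_integral
  rw [EventuallyEq, ae_restrict_iff' measurableSet_Ioi]
  filter_upwards [ae_all_iff.2 hn] with x hx hx0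
  obtain ⟨n, hxn⟩ := exists_nat_ge x
  have hxm : x ∈ uIcc (0 : ℝ) n := by
    rw [uIcc_of_le n.cast_nonneg]
    exact ⟨le_of_lt hx0, hxn⟩
  refine (hx n hxm 0 left_mem_uIcc).unique
    ((hasDerivAt_const x (0 : ℂ)).congr_of_eventuallyEq ?_)
  filter_upwards [Ioi_mem_nhds hx0] with y hy
  have := h.integral_deriv₂ y (le_of_lt hy)
  rw [a3 (mem_Ici.2 (mem_Ioi.1 hy).le), a3 self_mem_Ici] at this
  simpa using this.symm

theorem eqOn_of_ae_eq (hf : IsH2Loc f f₁ f₂) (hg : IsH2Loc g g₁ g₂)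
    (h : f =ᵐ[volume.restrict (Ioi 0)] g) :
    EqOn f g (Ici 0) ∧ EqOn f₁ g₁ (Ici 0) ∧ f₂ =ᵐ[volume.restrict (Ioi 0)] g₂ := by
  obtain ⟨h1, h2, h3⟩ := (hf.sub hg).eqOn_zero (by
    filter_upwards [h] with x hx
    simp [hx])
  refine ⟨fun x hx => sub_eq_zero.1 (h1 hx), fun x hx => sub_eq_zero.1 (h2 hx), ?_⟩
  filter_upwards [h3] with x hx using sub_eq_zero.1 hx

theorem conj (h : IsH2Loc f f₁ f₂) :
    IsH2Loc (fun x => starRingEnd ℂ (f x)) (fun x => starRingEnd ℂ (f₁ x))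
      (fun x => starRingEnd ℂ (f₂ x)) where
  memLp R := (h.memLp R).star
  integral_deriv x hx := by
    rw [h.integral_deriv x hx, map_add, intervalIntegral.integral_of_le hx, ← integral_conj,
      intervalIntegral.integral_of_le hx]
  integral_deriv₂ x hx := by
    rw [h.integral_deriv₂ x hx, map_add, intervalIntegral.integral_of_le hx, ← integral_conj,
      intervalIntegral.integral_of_le hx]

theorem of_contDiff {ψ : ℝ → ℂ} (h : ContDiff ℝ 2 ψ) :
    IsH2Loc ψ (deriv ψ) (deriv (deriv ψ)) := by
  have h1 : ContDiff ℝ 1 (deriv ψ) := h.deriv'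
  have h2 : Continuous (deriv (deriv ψ)) := h1.continuous_deriv le_rfl
  refine ⟨fun R => ?_, fun x _ => ?_, fun x _ => ?_⟩
  · obtain ⟨C, hC⟩ := isCompact_Icc.exists_bound_of_continuousOn (s := Icc 0 R) h2.continuousOn
    refine MemLp.of_bound h2.aestronglyMeasurable C ?_
    rw [ae_restrict_iff' measurableSet_Ioc]
    exact Eventually.of_forall fun x hx => hC x ⟨hx.1.le, hx.2⟩
  · rw [intervalIntegral.integral_deriv_eq_sub
      (fun y _ => (h.differentiable (by norm_num)).differentiableAt)
      (h1.continuous.intervalIntegrable _ _)]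
    ring
  · rw [intervalIntegral.integral_deriv_eq_sub
      (fun y _ => (h1.differentiable (by norm_num)).differentiableAt)
      (h2.intervalIntegrable _ _)]
    ring

/-- The double primitive of a locally square integrable function. -/
theorem of_integral {k : ℝ → ℂ} (hk : ∀ R : ℝ, MemLp k 2 (volume.restrict (Ioc 0 R))) (a b : ℂ) :
    IsH2Loc (fun x => a + b * x + ∫ t in (0 : ℝ)..x, ∫ s in (0 : ℝ)..t, k s)
      (fun x => b + ∫ s in (0 : ℝ)..x, k s) k := by
  have hki : ∀ x, 0 ≤ x → IntervalIntegrable k volume 0 x := fun x hx => by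
    rw [intervalIntegrable_iff_integrableOn_Ioc_of_le hx]
    exact (hk x).integrable (by norm_num)
  refine ⟨hk, fun x hx => ?_, fun x hx => by simp⟩
  rw [intervalIntegral.integral_add (by simp)
    (intervalIntegral.continuousOn_primitive_interval' (hki x hx) left_mem_uIcc).intervalIntegrable]
  simp
  ring

end IsH2Loc

end H2

/-- Lebesgue measure on the half-line. -/
abbrev halfLine : Measure ℝ := volume.restrict (Ioi (0 : ℝ))

/-! ### Test functions and Green's identity against them. -/

section TestFunctions

theorem inner_eq_intervalIntegral {a b : L2Half} {u v : ℝ → ℂ} (ha : a =ᵐ[halfLine] u)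
    (hb : b =ᵐ[halfLine] v) {R : ℝ} (hR : 0 ≤ R) (hu : ∀ x, R < x → u x * v x = 0) :
    ⟪a, b⟫_ℂ = ∫ x in (0 : ℝ)..R, v x * starRingEnd ℂ (u x) := by
  have h1 : ⟪a, b⟫_ℂ = ∫ x in Ioi (0 : ℝ), v x * starRingEnd ℂ (u x) := by
    rw [L2.inner_def]
    refine integral_congr_ae ?_
    filter_upwards [ha, hb] with x h1 h2
    rw [RCLike.inner_apply, h1, h2]
  rw [h1, intervalIntegral.integral_of_le hR]
  refine setIntegral_eq_of_subset_of_forall_sdiff_eq_zero measurableSet_Ioi Ioc_subset_Ioi_self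
    fun x hx => ?_
  have hx' : R < x := by
    by_contra hc
    exact hx.2 ⟨hx.1, not_lt.1 hc⟩
  rcases mul_eq_zero.1 (hu x hx') with h | h <;> simp [h]

/-- Smooth compactly supported functions on the real line. -/
structure IsTest (ψ : ℝ → ℂ) : Prop where
  smooth : ContDiff ℝ ∞ ψ
  compact : HasCompactSupport ψ

namespace IsTest

variable {ψ : ℝ → ℂ}

theorem continuous (h : IsTest ψ) : Continuous ψ := h.smooth.continuous

theorem memLp (h : IsTest ψ) : MemLp ψ 2 halfLine :=
  h.continuous.memLp_of_hasCompactSupport h.compact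

theorem isH2Loc (h : IsTest ψ) : IsH2Loc ψ (deriv ψ) (deriv (deriv ψ)) :=
  IsH2Loc.of_contDiff (contDiff_infty.1 h.smooth 2)

theorem deriv (h : IsTest ψ) : IsTest (deriv ψ) :=
  ⟨(contDiff_infty_iff_deriv.1 h.smooth).2, h.compact.deriv⟩

theorem exists_bound (h : IsTest ψ) : ∃ R : ℝ, 0 ≤ R ∧ ∀ x, R ≤ x → x ∉ tsupport ψ := by
  obtain ⟨R, hR⟩ := h.compact.isBounded.subset_closedBall 0
  refine ⟨|R| + 1, by positivity, fun x hx hx' => ?_⟩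
  have h1 := hR hx'
  rw [Metric.mem_closedBall, Real.dist_eq, sub_zero] at h1
  have := le_abs_self x
  have := le_abs_self R
  linarith

theorem ofReal {g : ℝ → ℝ} (hg : ContDiff ℝ ∞ g) (hc : HasCompactSupport g) :
    IsTest fun x => (g x : ℂ) :=
  ⟨Complex.ofRealCLM.contDiff.comp hg, hc.comp_left Complex.ofReal_zero⟩

end IsTest

/-- The class in `L₂(0, ∞)` of a test function. -/
def testL2 {ψ : ℝ → ℂ} (h : IsTest ψ) : L2Half := h.memLp.toLp ψ

theorem testL2_coeFn {ψ : ℝ → ℂ} (h : IsTest ψ) : testL2 h =ᵐ[halfLine] ψ := h.memLp.coeFn_toLp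

/-- Test functions supported in an open set `U` detect functions on `U`. -/
theorem ae_eq_zero_of_inner_test {U : Set ℝ} (hU : IsOpen U) {y : L2Half}
    (h : ∀ ψ (hψ : IsTest ψ), tsupport ψ ⊆ U → ⟪testL2 hψ, y⟫_ℂ = 0) :
    ∀ᵐ x ∂halfLine, x ∈ U → y x = 0 := by
  refine IsOpen.ae_eq_zero_of_integral_contDiff_smul_eq_zero hU
    (((Lp.memLp y).locallyIntegrable (by norm_num)).locallyIntegrableOn U) fun g hg hc hs => ?_
  have hs' : tsupport (fun x => (g x : ℂ)) ⊆ U :=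
    (tsupport_comp_subset (g := fun r : ℝ => (r : ℂ)) Complex.ofReal_zero g).trans hs
  rw [← h _ (IsTest.ofReal hg hc) hs', L2.inner_def]
  refine integral_congr_ae ?_
  filter_upwards [testL2_coeFn (IsTest.ofReal hg hc)] with x hx
  rw [hx, RCLike.inner_apply, Complex.conj_ofReal, Complex.real_smul, mul_comm]

/-- The expression `-ψ'' + q ψ`, with the potential extended evenly. -/
def slFun (q : ℝ → ℝ) (ψ : ℝ → ℂ) : ℝ → ℂ := fun x => -deriv (deriv ψ) x + q |x| * ψ x

variable {q : ℝ → ℝ}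

theorem continuous_even (hq : ContinuousOn q (Ici 0)) : Continuous fun x => q |x| :=
  hq.comp_continuous continuous_abs fun x => abs_nonneg x

theorem slFun_memLp (hq : ContinuousOn q (Ici 0)) {ψ : ℝ → ℂ} (h : IsTest ψ) :
    MemLp (slFun q ψ) 2 halfLine := by
  have h1 : Continuous (slFun q ψ) :=
    h.deriv.deriv.continuous.neg.add
      ((Complex.continuous_ofReal.comp (continuous_even hq)).mul h.continuous)
  refine h1.memLp_of_hasCompactSupport ?_
  exact (h.deriv.deriv.compact.comp_left (g := Neg.neg) neg_zero).add h.compact.mul_left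

/-- The class in `L₂(0, ∞)` of `-ψ'' + q ψ`. -/
def slTest (hq : ContinuousOn q (Ici 0)) {ψ : ℝ → ℂ} (h : IsTest ψ) : L2Half :=
  (slFun_memLp hq h).toLp _

theorem slTest_coeFn (hq : ContinuousOn q (Ici 0)) {ψ : ℝ → ℂ} (h : IsTest ψ) :
    slTest hq h =ᵐ[halfLine] slFun q ψ := (slFun_memLp hq h).coeFn_toLp

/-- Since `ψ` vanishes for large `x`, the boundary terms survive only at `0`. Choosing `ψ 0` and `ψ'
0` therefore reads off the Cauchy data of `f`. -/
theorem inner_test_green (hq : ContinuousOn q (Ici 0)) {y g : L2Half} {f f₁ f₂ : ℝ → ℂ}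
    (hf : IsH2Loc f f₁ f₂) (hy : y =ᵐ[halfLine] f)
    (hg : g =ᵐ[halfLine] fun x => -f₂ x + q x * f x) {ψ : ℝ → ℂ} (h : IsTest ψ) :
    ⟪testL2 h, g⟫_ℂ - ⟪slTest hq h, y⟫_ℂ =
      starRingEnd ℂ (ψ 0) * f₁ 0 - starRingEnd ℂ (deriv ψ 0) * f 0 := by
  obtain ⟨R, hR, hs⟩ := h.exists_bound
  have z0 : ∀ x, R ≤ x → ψ x = 0 := fun x hx => image_eq_zero_of_notMem_tsupport (hs x hx)
  have z1 : ∀ x, R ≤ x → deriv ψ x = 0 := fun x hx =>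
    image_eq_zero_of_notMem_tsupport fun h' => hs x hx (tsupport_deriv_subset h')
  have z2 : ∀ x, R ≤ x → deriv (deriv ψ) x = 0 := fun x hx =>
    image_eq_zero_of_notMem_tsupport fun h' =>
      hs x hx (tsupport_deriv_subset (tsupport_deriv_subset h'))
  have hg' : g =ᵐ[halfLine] fun x => -f₂ x + q |x| * f x := by
    filter_upwards [hg, ae_restrict_mem measurableSet_Ioi] with x hx hx0
    rw [hx, abs_of_pos hx0]
  rw [inner_eq_intervalIntegral (testL2_coeFn h) hg' hR fun x hx => by rw [z0 x hx.le, zero_mul],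
    inner_eq_intervalIntegral (slTest_coeFn hq h) hy hR
      fun x hx => by simp [slFun, z0 x hx.le, z2 x hx.le]]
  have hc : ∀ {k : ℝ → ℂ}, Continuous k → ContinuousOn (fun x => starRingEnd ℂ (k x)) (uIcc 0 R) :=
    fun hk => (Complex.continuous_conj.comp hk).continuousOn
  have cf : ContinuousOn f (uIcc 0 R) :=
    hf.continuousOn.mono (by rw [uIcc_of_le hR]; exact Icc_subset_Ici_self)
  have cq : ContinuousOn (fun x => ((q |x| : ℝ) : ℂ)) (uIcc 0 R) :=
    (Complex.continuous_ofReal.comp (continuous_even hq)).continuousOn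
  have i1 : IntervalIntegrable (fun x => (-f₂ x + q |x| * f x) * starRingEnd ℂ (ψ x)) volume 0 R :=
    ((hf.intervalIntegrable₂ hR).neg.add (cq.mul cf).intervalIntegrable).mul_continuousOn
      (hc h.continuous)
  have cs : Continuous (slFun q ψ) := h.deriv.deriv.continuous.neg.add
      ((Complex.continuous_ofReal.comp (continuous_even hq)).mul h.continuous)
  have i2 : IntervalIntegrable (fun x => f x * starRingEnd ℂ (slFun q ψ x)) volume 0 R :=
    (cf.mul (hc cs)).intervalIntegrable
  rw [← intervalIntegral.integral_sub i1 i2]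
  have hG := hf.green h.isH2Loc.conj hR
  rw [z0 R le_rfl, z1 R le_rfl] at hG
  simp only [map_zero, mul_zero, sub_self, zero_sub] at hG
  rw [mul_comm (starRingEnd ℂ (ψ 0)), mul_comm (starRingEnd ℂ (deriv ψ 0)), ← neg_sub, ← hG]
  congr 1
  ext x
  simp only [slFun, map_add, map_neg, map_mul, Complex.conj_ofReal]
  ring

end TestFunctions

/-! ### The minimal operator and its adjoint on test functions. -/

section Operator

variable {q : ℝ → ℝ}

theorem slGraph_functional (p : L2Half × L2Half) (hp : p ∈ slGraph q) (h0 : p.1 = 0) :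
    p.2 = 0 := by
  obtain ⟨f, f₁, f₂, hf, -, -, ha, hb⟩ := hp
  rw [h0] at ha
  have h0' : f =ᵐ[halfLine] 0 := by
    filter_upwards [ha, Lp.coeFn_zero ℂ 2 halfLine] with x h1 h2
    rw [← h1, h2]
  obtain ⟨h1, -, h3⟩ := hf.eqOn_zero h0'
  refine Lp.ext ?_
  filter_upwards [hb, h3, h0', Lp.coeFn_zero ℂ 2 halfLine] with x e1 e2 e3 e4
  rw [e1, e2, e3, e4]
  simp

theorem slOp_graph : (slOp q).graph = slGraph q :=
  Submodule.toLinearPMap_graph_eq _ slGraph_functional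

theorem test_mem_slGraph (hq : ContinuousOn q (Ici 0)) {ψ : ℝ → ℂ} (h : IsTest ψ) (h0 : ψ 0 = 0)
    (h1 : deriv ψ 0 = 0) : (testL2 h, slTest hq h) ∈ slGraph q := by
  refine ⟨ψ, deriv ψ, deriv (deriv ψ), h.isH2Loc, h0, h1, testL2_coeFn h, ?_⟩
  filter_upwards [slTest_coeFn hq h, ae_restrict_mem measurableSet_Ioi] with x hx hx0
  rw [hx, slFun, abs_of_pos hx0]

theorem mem_domain_of_mem_slGraph {y g : L2Half} (h : (y, g) ∈ slGraph q) :
    y ∈ (slOp q).domain := by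
  rw [← slOp_graph] at h
  exact LinearPMap.mem_domain_of_mem_graph h

theorem slOp_dense (hq : ContinuousOn q (Ici 0)) : Dense ((slOp q).domain : Set L2Half) := by
  rw [Submodule.dense_iff_topologicalClosure_eq_top, Submodule.topologicalClosure_eq_top_iff,
    Submodule.eq_bot_iff]
  intro y hy
  have := ae_eq_zero_of_inner_test isOpen_Ioi (y := y) fun ψ hψ hs => by
    have hn : (0 : ℝ) ∉ tsupport ψ := fun h => lt_irrefl (0 : ℝ) (hs h)
    exact (Submodule.mem_orthogonal _ _).1 hy _ (mem_domain_of_mem_slGraph (test_mem_slGraph hq hψ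
      (image_eq_zero_of_notMem_tsupport hn)
      (image_eq_zero_of_notMem_tsupport fun h => hn (tsupport_deriv_subset h))))
  refine Lp.ext ?_
  filter_upwards [this, ae_restrict_mem measurableSet_Ioi, Lp.coeFn_zero ℂ 2 halfLine]
    with x h1 h2 h3
  rw [h1 h2, h3]
  rfl

/-- No condition on `ψ` at `0` is required, because elements of the domain of `slOp q` have zero
Cauchy data there. -/
theorem test_mem_adjoint_graph (hq : ContinuousOn q (Ici 0)) {ψ : ℝ → ℂ} (h : IsTest ψ) :
    (testL2 h, slTest hq h) ∈ (slOp q).adjoint.graph := by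
  rw [mem_adjoint_graph_iff (slOp_dense hq)]
  intro x
  have hx : ((x : L2Half), slOp q x) ∈ slGraph q := by
    rw [← slOp_graph]
    exact LinearPMap.mem_graph _ x
  obtain ⟨f, f₁, f₂, hf, h0, h1, hy, hg⟩ := hx
  have := inner_test_green hq hf hy hg h
  rw [h0, h1, mul_zero, mul_zero, sub_zero, sub_eq_zero] at this
  exact this.symm

theorem L2Half.memLp_Ioc (y : L2Half) (R : ℝ) : MemLp y 2 (volume.restrict (Ioc 0 R)) :=
  (Lp.memLp y).mono_measure (Measure.restrict_mono Ioc_subset_Ioi_self le_rfl)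

theorem memLp_potential_mul (hq : ContinuousOn q (Ici 0)) {y : ℝ → ℂ} {R : ℝ}
    (hy : MemLp y 2 (volume.restrict (Ioc 0 R))) :
    MemLp (fun x => (q x : ℂ) * y x) 2 (volume.restrict (Ioc 0 R)) := by
  obtain ⟨C, hC⟩ := isCompact_Icc.exists_bound_of_continuousOn (s := Icc 0 R)
    (hq.mono Icc_subset_Ici_self)
  have hm : AEStronglyMeasurable (fun x => (q x : ℂ)) (volume.restrict (Ioc 0 R)) :=
    (Complex.continuous_ofReal.comp_continuousOn
      (hq.mono (Ioc_subset_Icc_self.trans Icc_subset_Ici_self))).aestronglyMeasurable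
      measurableSet_Ioc
  refine hy.of_le_mul (c := C) (hm.mul hy.1) ?_
  rw [ae_restrict_iff' measurableSet_Ioc]
  refine Eventually.of_forall fun x hx => ?_
  rw [norm_mul, Complex.norm_real]
  exact mul_le_mul_of_nonneg_right (hC x ⟨hx.1.le, hx.2⟩) (norm_nonneg _)

/-- A function orthogonal to all functions with vanishing moments of order `0` and `1` is affine. -/
theorem exists_affine_of_orthogonal {R : ℝ} {w : ℝ → ℂ}
    (hw : MemLp w 2 (volume.restrict (Ioc 0 R)))
    (h : ∀ k : ℝ → ℂ, MemLp k 2 (volume.restrict (Ioc 0 R)) → ∫ x in Ioc 0 R, k x = 0 →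
      ∫ x in Ioc 0 R, (x : ℂ) * k x = 0 → ∫ x in Ioc 0 R, starRingEnd ℂ (w x) * k x = 0) :
    ∃ a b : ℂ, w =ᵐ[volume.restrict (Ioc 0 R)] fun x => a + b * x := by
  set ν := volume.restrict (Ioc 0 R)
  have m1 : MemLp (fun _ : ℝ => (1 : ℂ)) 2 ν := memLp_const 1
  have m2 : MemLp (fun x : ℝ => (x : ℂ)) 2 ν := by
    refine MemLp.of_bound Complex.continuous_ofReal.aestronglyMeasurable |R| ?_
    rw [ae_restrict_iff' measurableSet_Ioc]
    refine Eventually.of_forall fun x hx => ?_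
    rw [Complex.norm_real, Real.norm_eq_abs, abs_of_pos hx.1]
    exact hx.2.trans (le_abs_self R)
  let V : Submodule ℂ (Lp ℂ 2 ν) := Submodule.span ℂ {m1.toLp, m2.toLp}
  have : FiniteDimensional ℂ V := FiniteDimensional.span_of_finite ℂ (by simp)
  have hmem : hw.toLp w ∈ V := by
    rw [← Submodule.orthogonal_orthogonal V]
    rw [Submodule.mem_orthogonal]
    intro k hk
    have hk' := (Submodule.mem_orthogonal V k).1 hk
    have e1 := hk' _ (Submodule.subset_span (mem_insert _ _))
    have e2 := hk' _ (Submodule.subset_span (mem_insert_of_mem _ (mem_singleton _)))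
    rw [L2.inner_def] at e1 e2
    have := h k (Lp.memLp k) (by
      rw [← e1]
      refine integral_congr_ae ?_
      filter_upwards [m1.coeFn_toLp] with x hx
      rw [RCLike.inner_apply, hx, map_one, mul_one]) (by
      rw [← e2]
      refine integral_congr_ae ?_
      filter_upwards [m2.coeFn_toLp] with x hx
      rw [RCLike.inner_apply, hx, Complex.conj_ofReal, mul_comm])
    rw [← inner_conj_symm, L2.inner_def]
    rw [← map_zero (starRingEnd ℂ), ← this]
    congr 1
    refine integral_congr_ae ?_
    filter_upwards [hw.coeFn_toLp] with x hx
    rw [RCLike.inner_apply, hx, mul_comm]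
  obtain ⟨a, b, hab⟩ := Submodule.mem_span_pair.1 hmem
  refine ⟨a, b, ?_⟩
  have e := hw.coeFn_toLp
  rw [← hab] at e
  filter_upwards [e, Lp.coeFn_add (a • m1.toLp) (b • m2.toLp), Lp.coeFn_smul a m1.toLp,
    Lp.coeFn_smul b m2.toLp, m1.coeFn_toLp, m2.coeFn_toLp] with x h1 h2 h3 h4 h5 h6
  rw [← h1, h2, Pi.add_apply, h3, h4, Pi.smul_apply, Pi.smul_apply, h5, h6]
  simp

end Operator

/-! ### Regularity of the domain of the adjoint. -/

section AdjointRegularity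

variable {q : ℝ → ℝ}

theorem exists_slOp_apply_eq {p : L2Half × L2Half} (hp : p ∈ slGraph q) :
    ∃ x : (slOp q).domain, (x : L2Half) = p.1 ∧ slOp q x = p.2 := by
  rw [← slOp_graph] at hp
  exact (LinearPMap.mem_graph_iff _).1 hp

theorem memLp_of_continuousOn {f : ℝ → ℂ} (hf : ContinuousOn f (Ici 0)) {R : ℝ}
    (h0 : ∀ x, R < x → f x = 0) : MemLp f 2 halfLine := by
  have h1 : MemLp ((Ioc 0 R).indicator f) 2 halfLine := by
    rw [memLp_indicator_iff_restrict measurableSet_Ioc]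
    obtain ⟨C, hC⟩ := isCompact_Icc.exists_bound_of_continuousOn (s := Icc 0 R)
      (hf.mono Icc_subset_Ici_self)
    rw [Measure.restrict_restrict_of_subset Ioc_subset_Ioi_self]
    refine MemLp.of_bound ((hf.mono (Ioc_subset_Icc_self.trans
      Icc_subset_Ici_self)).aestronglyMeasurable measurableSet_Ioc) C ?_
    rw [ae_restrict_iff' measurableSet_Ioc]
    exact Eventually.of_forall fun x hx => hC x ⟨hx.1.le, hx.2⟩
  refine (memLp_congr_ae ?_).1 h1
  filter_upwards [ae_restrict_mem measurableSet_Ioi] with x hx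
  by_cases hxR : x ≤ R
  · exact indicator_of_mem (show x ∈ Ioc 0 R from ⟨hx, hxR⟩) f
  · rw [indicator_of_notMem fun h => hxR h.2, h0 x (not_le.1 hxR)]

/-- Elements of the domain of the adjoint are in `H²_loc`. -/
theorem adjoint_regular (hq : ContinuousOn q (Ici 0)) {y g : L2Half}
    (h : (y, g) ∈ (slOp q).adjoint.graph) :
    ∃ f f₁ f₂ : ℝ → ℂ, IsH2Loc f f₁ f₂ ∧ y =ᵐ[halfLine] f ∧
      g =ᵐ[halfLine] fun x => -f₂ x + q x * f x := by
  have hadj := (mem_adjoint_graph_iff (slOp_dense hq)).1 h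
  -- `k` is what `y''` must be, and `Y` below is its double primitive, so the aim is that `y - Y` is
  -- affine.
  set k : ℝ → ℂ := fun x => q x * y x - g x with hk
  have hkm : ∀ R : ℝ, MemLp k 2 (volume.restrict (Ioc 0 R)) := fun R =>
    (memLp_potential_mul hq (y.memLp_Ioc R)).sub (g.memLp_Ioc R)
  have hY := IsH2Loc.of_integral hkm 0 0
  set Y : ℝ → ℂ := fun x => 0 + 0 * (x : ℂ) + ∫ t in (0 : ℝ)..x, ∫ s in (0 : ℝ)..t, k s with hYdef
  set Y₁ : ℝ → ℂ := fun x => 0 + ∫ s in (0 : ℝ)..x, k s with hY₁def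
  have hY0 : Y 0 = 0 := by simp [hYdef]
  have hY10 : Y₁ 0 = 0 := by simp [hY₁def]
  have haff : ∀ R : ℝ, 0 < R → ∃ a b : ℂ,
      (fun x => y x - Y x) =ᵐ[volume.restrict (Ioc 0 R)] fun x => a + b * x := by
    intro R hR
    have hYm : MemLp Y 2 (volume.restrict (Ioc 0 R)) := by
      obtain ⟨C, hC⟩ := isCompact_Icc.exists_bound_of_continuousOn (s := Icc 0 R)
        (hY.continuousOn.mono Icc_subset_Ici_self)
      refine MemLp.of_bound ((hY.continuousOn.mono (Ioc_subset_Icc_self.trans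
        Icc_subset_Ici_self)).aestronglyMeasurable measurableSet_Ioc) C ?_
      rw [ae_restrict_iff' measurableSet_Ioc]
      exact Eventually.of_forall fun x hx => hC x ⟨hx.1.le, hx.2⟩
    -- The two vanishing moments of `v` are exactly what makes the double primitive `χ` of its zero
    -- extension vanish, with its derivative, beyond `R`. Hence `χ` lies in the domain of `slOp q`
    -- and may be paired with `y`.
    refine exists_affine_of_orthogonal ((y.memLp_Ioc R).sub hYm) fun v hv hv0 hv1 => ?_
    set r : ℝ → ℂ := (Ioc 0 R).indicator v with hr
    have hrm : MemLp r 2 volume := (memLp_indicator_iff_restrict measurableSet_Ioc).2 hv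
    have hχ := IsH2Loc.of_integral (fun R => hrm.restrict (Ioc 0 R)) 0 0
    set χ : ℝ → ℂ := fun x => 0 + 0 * (x : ℂ) + ∫ t in (0 : ℝ)..x, ∫ s in (0 : ℝ)..t, r s
      with hχdef
    set χ₁ : ℝ → ℂ := fun x => 0 + ∫ s in (0 : ℝ)..x, r s with hχ₁def
    have hχ0 : χ 0 = 0 := by simp [hχdef]
    have hχ10 : χ₁ 0 = 0 := by simp [hχ₁def]
    have hrint : ∀ (m : ℝ → ℂ) (x : ℝ), R ≤ x →
        ∫ t in (0 : ℝ)..x, m t * r t = ∫ t in Ioc 0 R, m t * v t := by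
      intro m x hx
      rw [intervalIntegral.integral_of_le (hR.le.trans hx)]
      have : (fun t => m t * r t) = (Ioc 0 R).indicator fun t => m t * v t := by
        ext t
        by_cases ht : t ∈ Ioc 0 R <;> simp [hr, ht]
      rw [this, setIntegral_indicator measurableSet_Ioc,
        inter_eq_self_of_subset_right (Ioc_subset_Ioc_right hx)]
    have hχ₁R : ∀ x, R ≤ x → χ₁ x = 0 := by
      intro x hx
      have := hrint (fun _ => 1) x hx
      simp only [one_mul, hv0] at this
      rw [hχ₁def]
      simp only
      rw [this, add_zero]
    -- Integration by parts: `χ x = x χ₁ x - ∫ t r(t) dt`, where both terms vanish.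
    have hχR : ∀ x, R ≤ x → χ x = 0 := by
      intro x hx
      have hx0 := hR.le.trans hx
      have hp := integral_parts (F := fun x : ℝ => (x : ℂ)) (F' := fun _ => 1) (G := χ₁) (G' := r)
        hx0 intervalIntegrable_const (hχ.intervalIntegrable₂ hx0) (fun t _ => by simp)
        hχ.integral_deriv₂
      have i1 : IntervalIntegrable (fun t => (1 : ℂ) * χ₁ t) volume 0 x := by
        simpa using hχ.intervalIntegrable₁ hx0
      have i2 : IntervalIntegrable (fun t : ℝ => (t : ℂ) * r t) volume 0 x :=
        (hχ.intervalIntegrable₂ hx0).continuousOn_mul Complex.continuous_ofReal.continuousOn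
      rw [intervalIntegral.integral_add i1 i2, hrint _ x hx, hv1, hχ₁R x hx] at hp
      rw [hχ.integral_deriv x hx0, hχ0]
      simpa using hp
    have hχm : MemLp χ 2 halfLine := memLp_of_continuousOn hχ.continuousOn fun x hx => hχR x hx.le
    have hqχ : MemLp (fun x => q x * χ x) 2 halfLine :=
      memLp_of_continuousOn ((Complex.continuous_ofReal.comp_continuousOn hq).mul hχ.continuousOn)
        (fun x hx => by rw [hχR x hx.le, mul_zero])
    have hAχ : MemLp (fun x => -r x + q x * χ x) 2 halfLine := (hrm.restrict _).neg.add hqχ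
    obtain ⟨p, hp1, hp2⟩ := exists_slOp_apply_eq (q := q) (p := (hχm.toLp, hAχ.toLp))
      ⟨χ, χ₁, r, hχ, hχ0, hχ10, hχm.coeFn_toLp, hAχ.coeFn_toLp⟩
    have he := hadj p
    have hr0 : ∀ x, R < x → r x = 0 := fun x hx =>
      indicator_of_notMem (fun h => not_lt.2 h.2 hx) _
    rw [hp1, hp2, inner_eq_intervalIntegral ae_eq_rfl hχm.coeFn_toLp hR.le
        (fun x hx => by rw [hχR x hx.le, mul_zero]),
      inner_eq_intervalIntegral ae_eq_rfl hAχ.coeFn_toLp hR.le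
        (fun x hx => by rw [hχR x hx.le, hr0 x hx]; simp)] at he
    have hG := hY.conj.green hχ hR.le
    rw [hχR R le_rfl, hχ₁R R le_rfl, hχ0, hχ10] at hG
    simp only [mul_zero, sub_self] at hG
    have cc : ∀ {u : ℝ → ℂ}, ContinuousOn u (Ici 0) → ContinuousOn u (uIcc 0 R) := fun hu =>
      hu.mono (by rw [uIcc_of_le hR.le]; exact Icc_subset_Ici_self)
    have hyi : ∀ z : L2Half, IntervalIntegrable (fun x => starRingEnd ℂ (z x)) volume 0 R := by
      intro z
      rw [intervalIntegrable_iff_integrableOn_Ioc_of_le hR.le]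
      exact (z.memLp_Ioc R).star.integrable (by norm_num)
    have hyr : ∀ {u : ℝ → ℂ}, MemLp u 2 (volume.restrict (Ioc 0 R)) →
        IntervalIntegrable (fun x => starRingEnd ℂ (u x) * r x) volume 0 R := by
      intro u hu
      rw [intervalIntegrable_iff_integrableOn_Ioc_of_le hR.le]
      exact hu.star.integrable_mul (hrm.restrict _)
    have i1 : IntervalIntegrable (fun x => χ x * starRingEnd ℂ (g x)) volume 0 R :=
      (hyi g).continuousOn_mul (cc hχ.continuousOn)
    have i2 : IntervalIntegrable (fun x => (-r x + q x * χ x) * starRingEnd ℂ (y x)) volume 0 R := by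
      refine ((hyr (y.memLp_Ioc R)).neg.add ((hyi y).continuousOn_mul
        (cc ((Complex.continuous_ofReal.comp_continuousOn hq).mul hχ.continuousOn)))).congr ?_
      intro x _
      simp only [Pi.neg_apply, Pi.mul_apply, Function.comp_apply]
      ring
    have i3 : IntervalIntegrable (fun x => starRingEnd ℂ (Y x) * r x - starRingEnd ℂ (k x) * χ x)
        volume 0 R := by
      refine (hyr hYm).sub ?_
      have : IntervalIntegrable (fun x => starRingEnd ℂ (k x)) volume 0 R := by
        rw [intervalIntegrable_iff_integrableOn_Ioc_of_le hR.le]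
        exact (hkm R).star.integrable (by norm_num)
      exact this.mul_continuousOn (cc hχ.continuousOn)
    have hfin : ∫ x in (0 : ℝ)..R, (starRingEnd ℂ (y x - Y x) * r x) = 0 := by
      have e : ∫ x in (0 : ℝ)..R, (starRingEnd ℂ (y x - Y x) * r x) =
          ∫ x in (0 : ℝ)..R, ((χ x * starRingEnd ℂ (g x)
            - (-r x + q x * χ x) * starRingEnd ℂ (y x))
            - (starRingEnd ℂ (Y x) * r x - starRingEnd ℂ (k x) * χ x)) := by
        congr 1
        ext x
        simp only [hk, map_sub, map_mul, Complex.conj_ofReal]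
        ring
      rw [e, intervalIntegral.integral_sub (i1.sub i2) i3, intervalIntegral.integral_sub i1 i2, he,
        hG]
      simp
    rw [← hfin, hrint _ R le_rfl]
  obtain ⟨a, b, hab⟩ := haff 1 one_pos
  -- The affine functions found on nested intervals agree on `(0, 1)`, so they have the same
  -- coefficients.
  have hall : ∀ n : ℕ, (fun x => y x - Y x) =ᵐ[volume.restrict (Ioc 0 ((n : ℝ) + 1))]
      fun x => a + b * x := by
    intro n
    obtain ⟨c, d, hcd⟩ := haff (n + 1) (by positivity)
    have hsub : Ioo (0 : ℝ) 1 ⊆ Ioc 0 1 := Ioo_subset_Ioc_self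
    have hsub' : Ioo (0 : ℝ) 1 ⊆ Ioc 0 ((n : ℝ) + 1) := fun x hx =>
      ⟨hx.1, hx.2.le.trans (by linarith [n.cast_nonneg (α := ℝ)])⟩
    have he : EqOn (fun x : ℝ => a + b * (x : ℂ)) (fun x => c + d * x) (Ioo 0 1) := by
      refine Measure.eqOn_open_of_ae_eq (μ := volume) ?_ isOpen_Ioo (by fun_prop) (by fun_prop)
      filter_upwards [ae_restrict_of_ae_restrict_of_subset hsub hab,
        ae_restrict_of_ae_restrict_of_subset hsub' hcd] with x e1 e2
      exact e1.symm.trans e2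
    have h1 := he (show (1 / 2 : ℝ) ∈ Ioo (0 : ℝ) 1 by norm_num)
    have h2 := he (show (1 / 4 : ℝ) ∈ Ioo (0 : ℝ) 1 by norm_num)
    push_cast at h1 h2
    have hb : b = d := by linear_combination 4 * h1 - 4 * h2
    have ha : a = c := by
      rw [hb] at h1
      exact add_right_cancel h1
    rw [ha, hb]
    exact hcd
  have hae : ∀ᵐ x ∂halfLine, y x - Y x = a + b * x := by
    have h1 : ∀ n : ℕ, ∀ᵐ x : ℝ, x ∈ Ioc 0 ((n : ℝ) + 1) → y x - Y x = a + b * x := fun n =>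
      (ae_restrict_iff' measurableSet_Ioc).1 (hall n)
    rw [ae_restrict_iff' measurableSet_Ioi]
    filter_upwards [ae_all_iff.2 h1] with x hx hx0
    obtain ⟨n, hn⟩ := exists_nat_ge x
    exact hx n ⟨hx0, by linarith⟩
  refine ⟨_, _, _, IsH2Loc.of_integral hkm a b, ?_, ?_⟩
  · filter_upwards [hae] with x hx
    rw [← hx, hYdef]
    ring
  · filter_upwards [hae] with x hx
    rw [← hx, hYdef, hk]
    ring

end AdjointRegularity

/-! ### The Dirichlet condition on the range of `L⁻¹`. -/

section Dirichlet

variable {q : ℝ → ℝ}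

theorem IsTest.sub {ψ χ : ℝ → ℂ} (hψ : IsTest ψ) (hχ : IsTest χ) : IsTest fun x => ψ x - χ x :=
  ⟨hψ.smooth.sub hχ.smooth, hψ.compact.sub hχ.compact⟩

theorem testL2_sub {ψ χ : ℝ → ℂ} (hψ : IsTest ψ) (hχ : IsTest χ) :
    testL2 (hψ.sub hχ) = testL2 hψ - testL2 hχ := rfl

/-- Only first derivatives remain, so form convergence of test functions amounts to first-order
convergence on a bounded interval. -/
theorem form_test (hq : ContinuousOn q (Ici 0)) {ψ : ℝ → ℂ} (h : IsTest ψ) (h0 : ψ 0 = 0) {R : ℝ}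
    (hR : 0 ≤ R) (hs : ∀ x, R ≤ x → ψ x = 0) :
    ⟪testL2 h, slTest hq h⟫_ℂ = ∫ x in (0 : ℝ)..R, (deriv ψ x * starRingEnd ℂ (deriv ψ x) +
      q |x| * (ψ x * starRingEnd ℂ (ψ x))) := by
  rw [inner_eq_intervalIntegral (testL2_coeFn h) (slTest_coeFn hq h) hR
    fun x hx => by rw [hs x hx.le, zero_mul]]
  have hp := integral_parts hR (h.isH2Loc.conj.intervalIntegrable₁ hR)
    (h.isH2Loc.intervalIntegrable₂ hR) h.isH2Loc.conj.integral_deriv h.isH2Loc.integral_deriv₂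
  rw [h0, hs R le_rfl] at hp
  simp only [map_zero, zero_mul, sub_zero] at hp
  have cq : Continuous fun x => ((q |x| : ℝ) : ℂ) :=
    Complex.continuous_ofReal.comp (continuous_even hq)
  have c0 := h.continuous
  have c1 := h.deriv.continuous
  have c2 := h.deriv.deriv.continuous
  have cc : ∀ {u : ℝ → ℂ}, Continuous u → Continuous fun x => starRingEnd ℂ (u x) :=
    fun hu => Complex.continuous_conj.comp hu
  have i1 : IntervalIntegrable (fun x => deriv ψ x * starRingEnd ℂ (deriv ψ x) +
      q |x| * (ψ x * starRingEnd ℂ (ψ x))) volume 0 R :=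
    ((c1.mul (cc c1)).add (cq.mul (c0.mul (cc c0)))).intervalIntegrable _ _
  have i2 : IntervalIntegrable (fun x => starRingEnd ℂ (deriv ψ x) * deriv ψ x +
      starRingEnd ℂ (ψ x) * deriv (deriv ψ) x) volume 0 R :=
    (((cc c1).mul c1).add ((cc c0).mul c2)).intervalIntegrable _ _
  rw [← sub_zero (∫ x in (0 : ℝ)..R, (deriv ψ x * starRingEnd ℂ (deriv ψ x) +
      q |x| * (ψ x * starRingEnd ℂ (ψ x)))), ← hp, ← intervalIntegral.integral_sub i1 i2]
  congr 1
  ext x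
  simp only [slFun]
  ring

theorem exists_cutoff : ∃ η : ℝ → ℝ, ContDiff ℝ ∞ η ∧ HasCompactSupport η ∧
    (∀ x, |x| ≤ 1 → η x = 1) ∧ ∀ x, 2 ≤ |x| → η x = 0 := by
  let b : ContDiffBump (0 : ℝ) := ⟨1, 2, one_pos, one_lt_two⟩
  refine ⟨b, b.contDiff, b.hasCompactSupport, fun x hx => b.one_of_mem_closedBall ?_,
    fun x hx => b.zero_of_le_dist ?_⟩
  · simpa using hx
  · simpa using hx

variable (hA : IsPositiveDefinite (slOp q))

/-- The vector `x η(x)` lies in the domain of the closed form. -/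
theorem mem_formDomain_id_mul_cutoff (hq : ContinuousOn q (Ici 0)) {η : ℝ → ℝ}
    (hη : ContDiff ℝ ∞ η) (hc : HasCompactSupport η)
    (h2 : ∀ x, 2 ≤ |x| → η x = 0) (ht : IsTest fun x => ((x * η x : ℝ) : ℂ)) :
    testL2 ht ∈ formDomain (slOp q) hA := by
  -- Here `δ n 0 = 0` and `(δ n)' 0 = -1`, so `(x + δ n x) η x` has zero Cauchy data at `0`. On `x ≥
  -- 0` one has `|δ n| ≤ 1 / (n + 1)`, and the derivative `-exp (-(n + 1) x)` is bounded and tends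
  -- to `0` for `x > 0`. The corrections thus vanish in the form, although the slope at `0` jumps to
  -- `η 0` in the limit.
  set δ : ℕ → ℝ → ℝ := fun n x => -((1 - Real.exp (-((n : ℝ) + 1) * x)) / ((n : ℝ) + 1)) with hδ
  have hδs : ∀ n, ContDiff ℝ ∞ (δ n) := fun n => by
    simp only [hδ]
    fun_prop
  have hδd : ∀ n x, HasDerivAt (δ n) (-Real.exp (-((n : ℝ) + 1) * x)) x := fun n x => by
    have h3 : HasDerivAt (fun x : ℝ => -((n : ℝ) + 1) * x) (-((n : ℝ) + 1) * 1) x :=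
      (hasDerivAt_id x).const_mul _
    have h4 := ((h3.exp.const_sub 1).div_const ((n : ℝ) + 1)).neg
    refine h4.congr_deriv ?_
    have : (n : ℝ) + 1 ≠ 0 := by positivity
    field_simp
  have hδb : ∀ n x, 0 ≤ x → |δ n x| ≤ 1 / ((n : ℝ) + 1) := fun n x hx => by
    have hn : (0 : ℝ) < (n : ℝ) + 1 := by positivity
    simp only [hδ, abs_neg, abs_div, abs_of_pos hn]
    refine div_le_div_of_nonneg_right ?_ hn.le
    have e1 : Real.exp (-((n : ℝ) + 1) * x) ≤ 1 := Real.exp_le_one_iff.2 (by nlinarith)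
    have e2 := Real.exp_pos (-((n : ℝ) + 1) * x)
    rw [abs_le]
    constructor <;> linarith
  have hδn : ∀ n, IsTest fun x => ((δ n x * η x : ℝ) : ℂ) := fun n =>
    IsTest.ofReal ((hδs n).mul hη) hc.mul_left
  have hηt : IsTest fun x => ((η x : ℝ) : ℂ) := IsTest.ofReal hη hc
  have hκ : ∀ n, IsTest fun x => ((x + δ n x) * η x : ℝ) := fun n =>
    IsTest.ofReal ((contDiff_id.add (hδs n)).mul hη) hc.mul_left
  have hsplit : ∀ n, testL2 (hκ n) = testL2 ht + testL2 (hδn n) := fun n => by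
    rw [testL2, testL2, testL2, ← MemLp.toLp_add]
    congr 1
    ext x
    simp only [Pi.add_apply]
    push_cast
    ring
  have hκ0 : ∀ n, (((0 + δ n 0) * η 0 : ℝ) : ℂ) = 0 := fun n => by simp [hδ]
  have hκ1 : ∀ n, deriv (fun x => (((x + δ n x) * η x : ℝ) : ℂ)) 0 = 0 := fun n => by
    have h3 : HasDerivAt (fun x => (x + δ n x) * η x)
        ((1 + -Real.exp (-((n : ℝ) + 1) * 0)) * η 0 + (0 + δ n 0) * deriv η 0) 0 :=
      ((hasDerivAt_id (0 : ℝ)).add (hδd n 0)).mul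
        ((hη.differentiable (by norm_num)) 0).hasDerivAt
    rw [h3.ofReal_comp.deriv]
    simp [hδ]
  have hmem : ∀ n, (testL2 (hκ n), slTest hq (hκ n)) ∈ slGraph q := fun n =>
    test_mem_slGraph hq (hκ n) (hκ0 n) (hκ1 n)
  refine ⟨fun n => ⟨testL2 (hκ n), mem_domain_of_mem_slGraph (hmem n)⟩, ?_, ?_⟩
  · simp only [hsplit]
    rw [tendsto_iff_norm_sub_tendsto_zero]
    simp only [add_sub_cancel_left]
    have hl : Tendsto (fun n : ℕ => 1 / ((n : ℝ) + 1) * ‖testL2 hηt‖) atTop (𝓝 0) := by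
      simpa using tendsto_one_div_add_atTop_nhds_zero_nat.mul_const ‖testL2 hηt‖
    refine squeeze_zero (fun n => norm_nonneg _) (fun n => ?_) hl
    refine Lp.norm_le_mul_norm_of_ae_le_mul ?_
    filter_upwards [testL2_coeFn (hδn n), testL2_coeFn hηt, ae_restrict_mem measurableSet_Ioi]
      with x e1 e2 hx
    rw [e1, e2, Complex.ofReal_mul, norm_mul]
    refine mul_le_mul_of_nonneg_right ?_ (norm_nonneg _)
    rw [Complex.norm_real]
    exact hδb n x (le_of_lt hx)
  · have hval : ∀ p : ℕ × ℕ, ∀ (u v : (slOp q).domain), (u : L2Half) = testL2 (hκ p.1) →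
        (v : L2Half) = testL2 (hκ p.2) →
        ⟪((u - v : (slOp q).domain) : L2Half), slOp q (u - v)⟫_ℂ =
          ∫ x in (0 : ℝ)..2, (
            deriv (fun x => (((δ p.1 x - δ p.2 x) * η x : ℝ) : ℂ)) x *
              starRingEnd ℂ (deriv (fun x => (((δ p.1 x - δ p.2 x) * η x : ℝ) : ℂ)) x) +
            q |x| * ((((δ p.1 x - δ p.2 x) * η x : ℝ) : ℂ) *
              starRingEnd ℂ (((δ p.1 x - δ p.2 x) * η x : ℝ) : ℂ))) := by
      intro p u v hu hv
      have hd : IsTest fun x => (((δ p.1 x - δ p.2 x) * η x : ℝ) : ℂ) :=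
        IsTest.ofReal (((hδs _).sub (hδs _)).mul hη) hc.mul_left
      have hd0 : (((δ p.1 0 - δ p.2 0) * η 0 : ℝ) : ℂ) = 0 := by simp [hδ]
      have hd1 : deriv (fun x => (((δ p.1 x - δ p.2 x) * η x : ℝ) : ℂ)) 0 = 0 := by
        have h3 := (((hδd p.1 0).sub (hδd p.2 0)).mul
          ((hη.differentiable (by norm_num)) 0).hasDerivAt)
        have h4 : HasDerivAt (fun x => (((δ p.1 x - δ p.2 x) * η x : ℝ) : ℂ)) _ 0 :=
          h3.ofReal_comp
        rw [h4.deriv]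
        simp [hδ]
      rw [← form_test hq hd hd0 (by norm_num) fun x hx => by
        simp [h2 x (hx.trans (le_abs_self x))]]
      have e1 : ((u - v : (slOp q).domain) : L2Half) = testL2 hd := by
        rw [Submodule.coe_sub, hu, hv, ← testL2_sub, testL2, testL2]
        congr 1
        ext x
        push_cast
        ring
      obtain ⟨w, hw1, hw2⟩ := exists_slOp_apply_eq (test_mem_slGraph hq hd hd0 hd1)
      have e2 : u - v = w := Subtype.ext (e1.trans hw1.symm)
      rw [e2, hw2, hw1]
    have hint : Tendsto (fun p : ℕ × ℕ => ∫ x in (0 : ℝ)..2, (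
            deriv (fun x => (((δ p.1 x - δ p.2 x) * η x : ℝ) : ℂ)) x *
              starRingEnd ℂ (deriv (fun x => (((δ p.1 x - δ p.2 x) * η x : ℝ) : ℂ)) x) +
            q |x| * ((((δ p.1 x - δ p.2 x) * η x : ℝ) : ℂ) *
              starRingEnd ℂ (((δ p.1 x - δ p.2 x) * η x : ℝ) : ℂ)))) atTop (𝓝 0) := by
      have hηd : Continuous (deriv η) := hη.continuous_deriv (by norm_num)
      obtain ⟨C0, hC0⟩ := isCompact_Icc.exists_bound_of_continuousOn (s := Icc (0 : ℝ) 2)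
        hη.continuous.continuousOn
      obtain ⟨C1, hC1⟩ := isCompact_Icc.exists_bound_of_continuousOn (s := Icc (0 : ℝ) 2)
        hηd.continuousOn
      obtain ⟨Q, hQ⟩ := isCompact_Icc.exists_bound_of_continuousOn (s := Icc (0 : ℝ) 2)
        (continuous_even hq).continuousOn
      have hder : ∀ (p : ℕ × ℕ) (x : ℝ),
          deriv (fun x => (((δ p.1 x - δ p.2 x) * η x : ℝ) : ℂ)) x =
          (((-Real.exp (-((p.1 : ℝ) + 1) * x) - -Real.exp (-((p.2 : ℝ) + 1) * x)) * η x +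
            (δ p.1 x - δ p.2 x) * deriv η x : ℝ) : ℂ) := fun p x => by
        have h3 := (((hδd p.1 x).sub (hδd p.2 x)).mul
          ((hη.differentiable (by norm_num)) x).hasDerivAt)
        have h4 : HasDerivAt (fun x => (((δ p.1 x - δ p.2 x) * η x : ℝ) : ℂ)) _ x :=
          h3.ofReal_comp
        exact h4.deriv
      simp only [hder, Complex.conj_ofReal, ← Complex.ofReal_mul, ← Complex.ofReal_add]
      have hexp1 : ∀ (n : ℕ) (x : ℝ), 0 ≤ x → |Real.exp (-((n : ℝ) + 1) * x)| ≤ 1 := by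
        intro n x hx
        rw [abs_of_pos (Real.exp_pos _)]
        exact Real.exp_le_one_iff.2 (by nlinarith [n.cast_nonneg (α := ℝ)])
      have hδ1 : ∀ n x, 0 ≤ x → |δ n x| ≤ 1 := fun n x hx =>
        (hδb n x hx).trans (by
          rw [div_le_one (by positivity)]
          linarith [n.cast_nonneg (α := ℝ)])
      have hz : (0 : ℂ) = ∫ x in (0 : ℝ)..2, (0 : ℂ) := by simp
      rw [hz]
      refine intervalIntegral.tendsto_integral_filter_of_dominated_convergence
        (fun _ => (2 * C0 + 2 * C1) ^ 2 + Q * (2 * C0) ^ 2) (Eventually.of_forall fun p => ?_)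
        (Eventually.of_forall fun p => Eventually.of_forall fun x hx => ?_)
        intervalIntegrable_const (Eventually.of_forall fun x hx => ?_)
      · refine (Complex.continuous_ofReal.comp ?_).aestronglyMeasurable
        have := (hδs p.1).continuous
        have := (hδs p.2).continuous
        have := hη.continuous
        exact Continuous.add (by fun_prop) (Continuous.mul (continuous_even hq) (by fun_prop))
      · rw [uIoc_of_le (by norm_num : (0 : ℝ) ≤ 2)] at hx
        have hx' : x ∈ Icc (0 : ℝ) 2 := ⟨hx.1.le, hx.2⟩
        have b0 := hC0 x hx'
        have b1 := hC1 x hx'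
        have bq := hQ x hx'
        rw [Real.norm_eq_abs] at b0 b1 bq
        have a1 : |-Real.exp (-((p.1 : ℝ) + 1) * x) - -Real.exp (-((p.2 : ℝ) + 1) * x)| ≤ 2 := by
          refine (abs_sub _ _).trans ?_
          rw [abs_neg, abs_neg]
          linarith [hexp1 p.1 x hx'.1, hexp1 p.2 x hx'.1]
        have a2 : |δ p.1 x - δ p.2 x| ≤ 2 :=
          (abs_sub _ _).trans (by linarith [hδ1 p.1 x hx'.1, hδ1 p.2 x hx'.1])
        rw [Complex.norm_real, Real.norm_eq_abs]
        refine (abs_add_le _ _).trans ?_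
        rw [abs_mul_self, abs_mul, abs_mul_self]
        have m1 : |(-Real.exp (-((p.1 : ℝ) + 1) * x) - -Real.exp (-((p.2 : ℝ) + 1) * x)) * η x +
            (δ p.1 x - δ p.2 x) * deriv η x| ≤ 2 * C0 + 2 * C1 := by
          refine (abs_add_le _ _).trans ?_
          rw [abs_mul, abs_mul]
          exact add_le_add (mul_le_mul a1 b0 (abs_nonneg _) (by norm_num))
            (mul_le_mul a2 b1 (abs_nonneg _) (by norm_num))
        have m2 : |(δ p.1 x - δ p.2 x) * η x| ≤ 2 * C0 := by
          rw [abs_mul]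
          exact mul_le_mul a2 b0 (abs_nonneg _) (by norm_num)
        rw [← abs_mul_abs_self, ← sq, ← abs_mul_abs_self ((δ p.1 x - δ p.2 x) * η x), ← sq]
        exact add_le_add (pow_le_pow_left₀ (abs_nonneg _) m1 2)
          (mul_le_mul bq (pow_le_pow_left₀ (abs_nonneg _) m2 2) (by positivity)
            ((abs_nonneg _).trans bq))
      · rw [uIoc_of_le (by norm_num : (0 : ℝ) ≤ 2)] at hx
        have t1 : Tendsto (fun n : ℕ => δ n x) atTop (𝓝 0) :=
          squeeze_zero_norm (fun n => hδb n x hx.1.le) tendsto_one_div_add_atTop_nhds_zero_nat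
        have t2 : Tendsto (fun n : ℕ => Real.exp (-((n : ℝ) + 1) * x)) atTop (𝓝 0) := by
          refine Real.tendsto_exp_atBot.comp ?_
          refine Tendsto.atBot_mul_const hx.1 (tendsto_neg_atTop_atBot.comp ?_)
          exact tendsto_atTop_add_const_right _ _ tendsto_natCast_atTop_atTop
        rw [← prod_atTop_atTop_eq]
        have f1 := t1.comp (tendsto_fst (f := atTop) (g := (atTop : Filter ℕ)))
        have f2 := t1.comp (tendsto_snd (f := (atTop : Filter ℕ)) (g := atTop))
        have f3 := t2.comp (tendsto_fst (f := atTop) (g := (atTop : Filter ℕ)))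
        have f4 := t2.comp (tendsto_snd (f := (atTop : Filter ℕ)) (g := atTop))
        have g1 := ((f3.neg.sub f4.neg).mul_const (η x)).add ((f1.sub f2).mul_const (deriv η x))
        have g2 := (f1.sub f2).mul_const (η x)
        have g3 := (g1.mul g1).add ((g2.mul g2).const_mul (q |x|))
        have g4 := (Complex.continuous_ofReal.tendsto _).comp g3
        simpa [Function.comp_def] using g4
    have h5 := (Complex.continuous_re.tendsto _).comp hint
    rw [Complex.zero_re] at h5
    refine h5.congr fun p => ?_
    rw [Function.comp_apply, ← hval p ⟨testL2 (hκ p.1), mem_domain_of_mem_slGraph (hmem p.1)⟩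
      ⟨testL2 (hκ p.2), mem_domain_of_mem_slGraph (hmem p.2)⟩ rfl rfl]

/-- Elements of the range of `L⁻¹` satisfy the Dirichlet condition. -/
theorem exists_rep_friedrichsInv (hq : ContinuousOn q (Ici 0)) (g : L2Half) :
    ∃ f f₁ f₂ : ℝ → ℂ, IsH2Loc f f₁ f₂ ∧ f 0 = 0 ∧
      friedrichsInv (slOp q) hA g =ᵐ[halfLine] f ∧
      g =ᵐ[halfLine] fun x => -f₂ x + q x * f x := by
  have hd := slOp_dense hq
  obtain ⟨f, f₁, f₂, hf, hy, hg⟩ := adjoint_regular hq (friedrichsInv_mem_adjoint_graph hd hA g)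
  refine ⟨f, f₁, f₂, hf, ?_, hy, hg⟩
  obtain ⟨η, hη, hc, h1, h2⟩ := exists_cutoff
  have ht : IsTest fun x => ((x * η x : ℝ) : ℂ) :=
    IsTest.ofReal (contDiff_id.mul hη) hc.mul_left
  have hB : friedrichsInv (slOp q) hA (slTest hq ht) = testL2 ht :=
    (friedrichsInv_eq_iff hd hA).2 ((mem_friedrichs_graph_iff hA).2
      ⟨mem_formDomain_id_mul_cutoff hA hq hη hc h2 ht, test_mem_adjoint_graph hq ht⟩)
  have hG := inner_test_green hq hf hy hg ht
  have hder : deriv (fun x => ((x * η x : ℝ) : ℂ)) 0 = 1 := by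
    have h3 : HasDerivAt (fun x => x * η x) (1 * η 0 + 0 * deriv η 0) 0 :=
      (hasDerivAt_id (0 : ℝ)).mul ((hη.differentiable (by norm_num)) 0).hasDerivAt
    rw [h3.ofReal_comp.deriv, h1 0 (by simp)]
    simp
  -- The test vector lies in `Ran L⁻¹`, so symmetry of `L⁻¹` cancels the left side of Green's
  -- identity. With `ψ 0 = 0` and `ψ' 0 = 1` the right side is `-f 0`.
  rw [← hB, friedrichsInv_symm hd hA, sub_self, hder] at hG
  simpa using hG.symm

end Dirichlet

/-! ### Weyl's alternative. -/

section LimitPoint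

theorem norm_integral_mul_sq_le {ν : Measure ℝ} {f g : ℝ → ℂ} (hf : MemLp f 2 ν)
    (hg : MemLp g 2 ν) :
    ‖∫ x, f x * g x ∂ν‖ ^ 2 ≤ (∫ x, ‖f x‖ ^ 2 ∂ν) * ∫ x, ‖g x‖ ^ 2 ∂ν := by
  have h1 : ‖∫ x, f x * g x ∂ν‖ ≤ ∫ x, ‖f x‖ * ‖g x‖ ∂ν := by
    refine (norm_integral_le_integral_norm _).trans_eq ?_
    simp only [norm_mul]
  have h2 := integral_mul_norm_le_Lp_mul_Lq (μ := ν) (f := f) (g := g) Real.HolderConjugate.two_two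
    (by simpa using hf) (by simpa using hg)
  have e : ∀ u : ℝ → ℂ, (∫ x, ‖u x‖ ^ (2 : ℝ) ∂ν) = ∫ x, ‖u x‖ ^ 2 ∂ν := fun u => by
    simp only [Real.rpow_two]
  rw [e, e, ← Real.sqrt_eq_rpow, ← Real.sqrt_eq_rpow] at h2
  have h3 := pow_le_pow_left₀ (norm_nonneg _) (h1.trans h2) 2
  rwa [mul_pow, Real.sq_sqrt (by positivity), Real.sq_sqrt (by positivity)] at h3

/-- The two equations differ only by `l`, so the derivative of the Wronskian is `l y v`. The case `l
= 0` gives its constancy. -/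
theorem wronskian_sub {q : ℝ → ℝ} {y y₁ v v₁ : ℝ → ℂ} {l : ℂ}
    (hy : ∀ x, 0 < x → HasDerivAt y (y₁ x) x)
    (hy₁ : ∀ x, 0 < x → HasDerivAt y₁ ((q x - l) * y x) x)
    (hv : ∀ x, 0 < x → HasDerivAt v (v₁ x) x) (hv₁ : ∀ x, 0 < x → HasDerivAt v₁ (q x * v x) x)
    {c x : ℝ} (hc : 0 < c) (hx : c ≤ x) :
    y x * v₁ x - y₁ x * v x = (y c * v₁ c - y₁ c * v c) + l * ∫ t in c..x, y t * v t := by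
  have hd : ∀ t ∈ uIcc c x,
      HasDerivAt (fun t => y t * v₁ t - y₁ t * v t) (l * (y t * v t)) t := fun t ht => by
    rw [uIcc_of_le hx] at ht
    have ht0 := hc.trans_le ht.1
    refine (((hy t ht0).mul (hv₁ t ht0)).sub ((hy₁ t ht0).mul (hv t ht0))).congr_deriv ?_
    ring
  have hcont : ContinuousOn (fun t => l * (y t * v t)) (uIcc c x) := fun t ht => by
    rw [uIcc_of_le hx] at ht
    have ht0 := hc.trans_le ht.1
    exact (continuousAt_const.mul ((hy t ht0).continuousAt.mul
      (hv t ht0).continuousAt)).continuousWithinAt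
  have := intervalIntegral.integral_eq_sub_of_hasDerivAt hd hcont.intervalIntegrable
  rw [intervalIntegral.integral_const_mul] at this
  rw [this]
  ring

/-- Weyl's alternative: if all solutions for the spectral parameter `0` are square integrable, the
same holds for every spectral parameter. -/
theorem memLp_of_two_solutions {q : ℝ → ℝ}
    {u u₁ v v₁ y y₁ : ℝ → ℂ} {l : ℂ}
    (hu : ∀ x, 0 < x → HasDerivAt u (u₁ x) x) (hu₁ : ∀ x, 0 < x → HasDerivAt u₁ (q x * u x) x)
    (hv : ∀ x, 0 < x → HasDerivAt v (v₁ x) x) (hv₁ : ∀ x, 0 < x → HasDerivAt v₁ (q x * v x) x)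
    (hy : ∀ x, 0 < x → HasDerivAt y (y₁ x) x)
    (hy₁ : ∀ x, 0 < x → HasDerivAt y₁ ((q x - l) * y x) x) (hyc : ContinuousOn y (Ici 0))
    (hW : u 1 * v₁ 1 - u₁ 1 * v 1 ≠ 0) (huL : MemLp u 2 halfLine) (hvL : MemLp v 2 halfLine) :
    MemLp y 2 halfLine := by
  set W := u 1 * v₁ 1 - u₁ 1 * v 1 with hWdef
  have hWc : ∀ x, 1 ≤ x → u x * v₁ x - u₁ x * v x = W := fun x hx => by
    have := wronskian_sub (l := 0) hu (by simpa using hu₁) hv hv₁ one_pos hx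
    rw [this, zero_mul, add_zero]
  have hu2 := (memLp_two_iff_integrable_sq_norm huL.1).1 huL
  have hv2 := (memLp_two_iff_integrable_sq_norm hvL.1).1 hvL
  have tail : ∀ k : ℝ → ℝ, IntegrableOn k (Ioi 0) →
      Tendsto (fun c => ∫ x in Ioi c, k x) atTop (𝓝 0) := fun k hk => by
    have h1 := intervalIntegral_tendsto_integral_Ioi 0 hk tendsto_id
    have h2 := (tendsto_const_nhds (x := ∫ x in Ioi (0 : ℝ), k x)).sub h1
    rw [sub_self] at h2
    refine h2.congr' ?_
    filter_upwards [eventually_ge_atTop 0] with c hc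
    rw [← intervalIntegral.integral_interval_add_Ioi hk (hk.mono_set (Ioi_subset_Ioi hc))]
    simp
  -- Beyond a large `c` the tails of `u` and `v` are so small that the terms containing the unknown
  -- norm of `y` can be absorbed in `hbound`.
  have hsmall : Tendsto (fun c => 16 * ‖l‖ ^ 2 * ((∫ x in Ioi c, ‖u x‖ ^ 2) *
      ∫ x in Ioi c, ‖v x‖ ^ 2)) atTop (𝓝 0) := by
    simpa using ((tail _ hu2).mul (tail _ hv2)).const_mul (16 * ‖l‖ ^ 2)
  have hW2 : 0 < ‖W‖ ^ 2 := by positivity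
  obtain ⟨c, hcs, hc1⟩ := ((hsmall.eventually (gt_mem_nhds hW2)).and (eventually_ge_atTop 1)).exists
  have hc0 : 0 < c := by linarith
  set U := ∫ x in Ioi c, ‖u x‖ ^ 2 with hU
  set V := ∫ x in Ioi c, ‖v x‖ ^ 2 with hV
  have hU0 : 0 ≤ U := integral_nonneg fun _ => by positivity
  have hV0 : 0 ≤ V := integral_nonneg fun _ => by positivity
  set a := y c * v₁ c - y₁ c * v c with ha
  set b := y c * u₁ c - y₁ c * u c with hb
  have cy : ContinuousOn y (Ioi 0) := fun t ht => (hy t ht).continuousAt.continuousWithinAt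
  have sub : ∀ X, Ioc c X ⊆ Ioi 0 := fun X x hx => hc0.trans hx.1
  have ymem : ∀ X, MemLp y 2 (volume.restrict (Ioc c X)) := fun X => by
    obtain ⟨C, hC⟩ := isCompact_Icc.exists_bound_of_continuousOn (s := Icc c X)
      (cy.mono fun x hx => hc0.trans_le hx.1)
    refine MemLp.of_bound ((cy.mono (sub X)).aestronglyMeasurable measurableSet_Ioc) C ?_
    rw [ae_restrict_iff' measurableSet_Ioc]
    exact Eventually.of_forall fun x hx => hC x ⟨hx.1.le, hx.2⟩
  have umem : ∀ X, MemLp u 2 (volume.restrict (Ioc c X)) := fun X =>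
    huL.mono_measure (Measure.restrict_mono (sub X) le_rfl)
  have vmem : ∀ X, MemLp v 2 (volume.restrict (Ioc c X)) := fun X =>
    hvL.mono_measure (Measure.restrict_mono (sub X) le_rfl)
  have hle : ∀ (k : ℝ → ℂ) (X : ℝ), Integrable (fun x => ‖k x‖ ^ 2) halfLine →
      ∫ x in Ioc c X, ‖k x‖ ^ 2 ≤ ∫ x in Ioi c, ‖k x‖ ^ 2 := fun k X hk =>
    setIntegral_mono_set (hk.mono_measure (Measure.restrict_mono (Ioi_subset_Ioi hc0.le) le_rfl))
      (Eventually.of_forall fun _ => by positivity) Ioc_subset_Ioi_self.eventuallyLE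
  have hbound : ∀ X, c ≤ X → ∫ x in Ioc c X, ‖y x‖ ^ 2 ≤
      8 * (‖a‖ ^ 2 * U + ‖b‖ ^ 2 * V) / ‖W‖ ^ 2 := by
    intro X hX
    set N := ∫ x in Ioc c X, ‖y x‖ ^ 2 with hN
    have hN0 : 0 ≤ N := integral_nonneg fun _ => by positivity
    have hcs2 : ∀ (k : ℝ → ℂ), MemLp k 2 halfLine → ∀ x ∈ Ioc c X,
        ‖∫ t in c..x, y t * k t‖ ^ 2 ≤ N * ∫ x in Ioi c, ‖k x‖ ^ 2 := by
      intro k hk x hx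
      have hk2 := (memLp_two_iff_integrable_sq_norm hk.1).1 hk
      rw [intervalIntegral.integral_of_le hx.1.le]
      refine (norm_integral_mul_sq_le (ymem x)
        (hk.mono_measure (Measure.restrict_mono (sub x) le_rfl))).trans ?_
      refine mul_le_mul ?_ (hle k x hk2) (integral_nonneg fun _ => by positivity) hN0
      exact setIntegral_mono_set ((memLp_two_iff_integrable_sq_norm (ymem X).1).1 (ymem X))
        (Eventually.of_forall fun _ => by positivity) (Ioc_subset_Ioc_right hx.2).eventuallyLE
    -- Variation of constants: `W y = u (a + l I) - v (b + l K)`, with Cauchy–Schwarz for `I` and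
    -- `K`. Two uses of `‖p + r‖² ≤ 2 (‖p‖² + ‖r‖²)` give the factor `4`.
    have hpt : ∀ x ∈ Ioc c X, ‖W‖ ^ 2 * ‖y x‖ ^ 2 ≤
        4 * (‖a‖ ^ 2 + ‖l‖ ^ 2 * (N * V)) * ‖u x‖ ^ 2 +
        4 * (‖b‖ ^ 2 + ‖l‖ ^ 2 * (N * U)) * ‖v x‖ ^ 2 := by
      intro x hx
      have e1 := wronskian_sub hy hy₁ hv hv₁ hc0 hx.1.le
      have e2 := wronskian_sub hy hy₁ hu hu₁ hc0 hx.1.le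
      have e3 := hWc x (hc1.trans hx.1.le)
      set I := ∫ t in c..x, y t * v t
      set K := ∫ t in c..x, y t * u t
      have hI := hcs2 v hvL x hx
      have hK := hcs2 u huL x hx
      have e : W * y x = u x * (a + l * I) - v x * (b + l * K) := by
        rw [ha, hb, ← e1, ← e2, ← e3]
        ring
      have hsq : ∀ p r : ℂ, ‖p + r‖ ^ 2 ≤ 2 * (‖p‖ ^ 2 + ‖r‖ ^ 2) := fun p r => by
        have h1 := pow_le_pow_left₀ (norm_nonneg _) (norm_add_le p r) 2
        have h2 : (‖p‖ + ‖r‖) ^ 2 ≤ 2 * (‖p‖ ^ 2 + ‖r‖ ^ 2) := by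
          nlinarith [sq_nonneg (‖p‖ - ‖r‖)]
        exact h1.trans h2
      have s1 := hsq (u x * (a + l * I)) (-(v x * (b + l * K)))
      have s2 := hsq a (l * I)
      have s3 := hsq b (l * K)
      rw [← sub_eq_add_neg, ← e, norm_neg, norm_mul, norm_mul, norm_mul, mul_pow, mul_pow,
        mul_pow] at s1
      rw [norm_mul, mul_pow] at s2 s3
      have t1 : ‖l‖ ^ 2 * ‖I‖ ^ 2 ≤ ‖l‖ ^ 2 * (N * V) := mul_le_mul_of_nonneg_left hI (by positivity)
      have t2 : ‖l‖ ^ 2 * ‖K‖ ^ 2 ≤ ‖l‖ ^ 2 * (N * U) := mul_le_mul_of_nonneg_left hK (by positivity)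
      have r1 : ‖u x‖ ^ 2 * ‖a + l * I‖ ^ 2 ≤ ‖u x‖ ^ 2 * (2 * (‖a‖ ^ 2 + ‖l‖ ^ 2 * (N * V))) :=
        mul_le_mul_of_nonneg_left (by linarith) (by positivity)
      have r2 : ‖v x‖ ^ 2 * ‖b + l * K‖ ^ 2 ≤ ‖v x‖ ^ 2 * (2 * (‖b‖ ^ 2 + ‖l‖ ^ 2 * (N * U))) :=
        mul_le_mul_of_nonneg_left (by linarith) (by positivity)
      linarith
    have yi := (memLp_two_iff_integrable_sq_norm (ymem X).1).1 (ymem X)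
    have ui := (memLp_two_iff_integrable_sq_norm (umem X).1).1 (umem X)
    have vi := (memLp_two_iff_integrable_sq_norm (vmem X).1).1 (vmem X)
    have hint := setIntegral_mono_on (yi.const_mul (‖W‖ ^ 2))
      ((ui.const_mul (4 * (‖a‖ ^ 2 + ‖l‖ ^ 2 * (N * V)))).add
        (vi.const_mul (4 * (‖b‖ ^ 2 + ‖l‖ ^ 2 * (N * U))))) measurableSet_Ioc hpt
    simp only [Pi.add_apply] at hint
    rw [integral_add (ui.const_mul _) (vi.const_mul _), integral_const_mul, integral_const_mul,
      integral_const_mul] at hint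
    have m1 := mul_le_mul_of_nonneg_left (hle u X hu2)
      (show 0 ≤ 4 * (‖a‖ ^ 2 + ‖l‖ ^ 2 * (N * V)) by positivity)
    have m2 := mul_le_mul_of_nonneg_left (hle v X hv2)
      (show 0 ≤ 4 * (‖b‖ ^ 2 + ‖l‖ ^ 2 * (N * U)) by positivity)
    -- After integration the terms with `N` add up to `8 ‖l‖² U V N`, at most half of `‖W‖² N`; the
    -- bound that results is uniform in `X`.
    have m3 : 16 * ‖l‖ ^ 2 * (U * V) * N ≤ ‖W‖ ^ 2 * N := mul_le_mul_of_nonneg_right hcs.le hN0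
    rw [le_div_iff₀ hW2]
    rw [← hN] at hint
    rw [← hU] at m1
    rw [← hV] at m2
    linarith
  have hIoi : IntegrableOn (fun x => ‖y x‖ ^ 2) (Ioi c) := by
    refine integrableOn_Ioi_of_intervalIntegral_norm_bounded (l := atTop) (b := id)
      (8 * (‖a‖ ^ 2 * U + ‖b‖ ^ 2 * V) / ‖W‖ ^ 2) c (fun X => (memLp_two_iff_integrable_sq_norm (ymem X).1).1 (ymem X)) tendsto_id ?_
    filter_upwards [eventually_ge_atTop c] with X hX
    rw [id, intervalIntegral.integral_of_le hX]
    simpa using hbound X hX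
  have hIoc : IntegrableOn (fun x => ‖y x‖ ^ 2) (Ioc 0 c) := by
    have : ContinuousOn (fun x => ‖y x‖ ^ 2) (Icc 0 c) :=
      ((hyc.mono Icc_subset_Ici_self).norm).pow 2
    exact this.integrableOn_Icc.mono_set Ioc_subset_Icc_self
  rw [memLp_two_iff_integrable_sq_norm
    ((hyc.mono Ioi_subset_Ici_self).aestronglyMeasurable measurableSet_Ioi)]
  have := hIoc.union hIoi
  rwa [Ioc_union_Ioi_eq_Ioi hc0.le] at this

theorem hasDerivAt_of_ker {q : ℝ → ℝ} (hq : ContinuousOn q (Ici 0)) {f f₁ f₂ : ℝ → ℂ}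
    (hf : IsH2Loc f f₁ f₂) (h : (0 : L2Half) =ᵐ[halfLine] fun x => -f₂ x + q x * f x) {x : ℝ}
    (hx : 0 < x) : HasDerivAt f₁ (q x * f x) x := by
  have h2 : f₂ =ᵐ[halfLine] fun x => q x * f x := by
    filter_upwards [h, Lp.coeFn_zero ℂ 2 halfLine] with t h1 h3
    rw [h3, Pi.zero_apply, eq_comm, neg_add_eq_zero] at h1
    exact h1
  have hc : ContinuousOn (fun x => (q x : ℂ) * f x) (Ici 0) :=
    (Complex.continuous_ofReal.comp_continuousOn hq).mul hf.continuousOn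
  have h3 : HasDerivAt (fun y => f₁ 0 + ∫ t in (0 : ℝ)..y, (q t : ℂ) * f t) (q x * f x) x := by
    refine HasDerivAt.const_add _ (intervalIntegral.integral_hasDerivAt_right
      (hc.mono ?_).intervalIntegrable ?_ (hc.continuousAt (Ici_mem_nhds hx)))
    · rw [uIcc_of_le hx.le]
      exact Icc_subset_Ici_self
    · exact (hc.mono Ioi_subset_Ici_self).stronglyMeasurableAtFilter isOpen_Ioi x hx
  refine h3.congr_of_eventuallyEq ?_
  filter_upwards [Ioi_mem_nhds hx] with y hy
  rw [hf.integral_deriv₂ y (le_of_lt hy), intervalIntegral.integral_of_le (le_of_lt hy),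
    intervalIntegral.integral_of_le (le_of_lt hy)]
  congr 1
  exact integral_congr_ae (ae_restrict_of_ae_restrict_of_subset Ioc_subset_Ioi_self h2)

end LimitPoint

/-! ### The one-dimensional kernel of the adjoint. -/

section Kernel

variable {q : ℝ → ℝ} (hA : IsPositiveDefinite (slOp q))

/-- The kernel of the adjoint is spanned by a vector which represents the slope at the origin. -/
structure IsKernelVector (φ : L2Half) : Prop where
  mem_ker : (φ, (0 : L2Half)) ∈ (slOp q).adjoint.graph
  slope : ∀ g, ∃ f f₁ f₂ : ℝ → ℂ, IsH2Loc f f₁ f₂ ∧ f 0 = 0 ∧ f₁ 0 = ⟪φ, g⟫_ℂ ∧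
    friedrichsInv (slOp q) hA g =ᵐ[halfLine] f ∧ g =ᵐ[halfLine] fun x => -f₂ x + q x * f x
  span : ∀ w, (w, (0 : L2Half)) ∈ (slOp q).adjoint.graph → ∃ c : ℂ, w = c • φ

/-- With `η = 1` near `0`, Green's identity against `η` reads off the slope at `0`, and moving `L⁻¹`
across produces `φ = η - L⁻¹ (-η'' + q η)`. For the spanning property subtract from `w` the multiple
of `φ` with the same value at `0`. If the difference has zero slope it lies in the trivial kernel of
`slOp q`. Otherwise it and `φ` are independent square integrable solutions, and Weyl's alternative
contradicts the limit point case. -/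
theorem exists_isKernelVector (hq : ContinuousOn q (Ici 0)) (hlp : IsLimitPoint q) :
    ∃ φ, IsKernelVector hA φ := by
  have hd := slOp_dense hq
  obtain ⟨η, hη, hc, h1, h2⟩ := exists_cutoff
  have ht : IsTest fun x => ((η x : ℝ) : ℂ) := IsTest.ofReal hη hc
  have hη0 : η 0 = 1 := h1 0 (by simp)
  have hη1 : deriv (fun x => ((η x : ℝ) : ℂ)) 0 = 0 := by
    have : (fun x => ((η x : ℝ) : ℂ)) =ᶠ[𝓝 0] fun _ => (1 : ℂ) := by
      filter_upwards [Metric.closedBall_mem_nhds (0 : ℝ) one_pos] with x hx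
      rw [Metric.mem_closedBall, Real.dist_eq, sub_zero] at hx
      rw [h1 x hx, Complex.ofReal_one]
    rw [this.deriv_eq, deriv_const]
  set φ := testL2 ht - friedrichsInv (slOp q) hA (slTest hq ht) with hφ
  have hker : (φ, (0 : L2Half)) ∈ (slOp q).adjoint.graph := by
    have := (slOp q).adjoint.graph.sub_mem (test_mem_adjoint_graph hq ht)
      (friedrichsInv_mem_adjoint_graph hd hA (slTest hq ht))
    rwa [Prod.mk_sub_mk, sub_self] at this
  refine ⟨φ, hker, fun g => ?_, fun w hw => ?_⟩
  · obtain ⟨f, f₁, f₂, hf, hf0, hy, hg⟩ := exists_rep_friedrichsInv hA hq g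
    refine ⟨f, f₁, f₂, hf, hf0, ?_, hy, hg⟩
    have hG := inner_test_green hq hf hy hg ht
    rw [hη0, hη1, map_zero, zero_mul, sub_zero, Complex.ofReal_one, map_one, one_mul] at hG
    rw [← hG, hφ, inner_sub_left, friedrichsInv_symm hd hA]
  · obtain ⟨u, u₁, u₂, hu, hφu, hu0⟩ := adjoint_regular hq hker
    have huval : u 0 = 1 := by
      obtain ⟨f, f₁, f₂, hf, hf0, hy, -⟩ := exists_rep_friedrichsInv hA hq (slTest hq ht)
      have := (hu.eqOn_of_ae_eq (ht.isH2Loc.sub hf) (by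
        have hs := Lp.coeFn_sub (testL2 ht) (friedrichsInv (slOp q) hA (slTest hq ht))
        filter_upwards [hφu, hy, testL2_coeFn ht, hs] with x e1 e2 e3 e4
        rw [← e1, hφ, e4, Pi.sub_apply, Pi.sub_apply, e2, e3])).1 self_mem_Ici
      simpa [hf0, hη0] using this
    obtain ⟨p, p₁, p₂, hp, hwp, hp0⟩ := adjoint_regular hq hw
    refine ⟨p 0, ?_⟩
    set z := w - p 0 • φ with hz
    have hzker : (z, (0 : L2Half)) ∈ (slOp q).adjoint.graph := by
      have := (slOp q).adjoint.graph.sub_mem hw ((slOp q).adjoint.graph.smul_mem (p 0) hker)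
      rwa [Prod.smul_mk, smul_zero, Prod.mk_sub_mk, sub_zero] at this
    obtain ⟨v, v₁, v₂, hv, hzv, hv0⟩ := adjoint_regular hq hzker
    have hvval : v 0 = 0 := by
      have := (hv.eqOn_of_ae_eq (hp.sub (hu.const_smul (p 0))) (by
        have hs := Lp.coeFn_sub w (p 0 • φ)
        filter_upwards [hφu, hwp, hzv, hs, Lp.coeFn_smul (p 0) φ] with x e1 e2 e3 e4 e5
        rw [← e3, hz, e4, Pi.sub_apply, Pi.sub_apply, e2, e5, Pi.smul_apply, Pi.smul_apply,
          e1])).1 self_mem_Ici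
      simpa [huval] using this
    suffices hz0 : z = 0 from sub_eq_zero.1 hz0
    by_cases hv1 : v₁ 0 = 0
    · have hmem : (z, (0 : L2Half)) ∈ (slOp q).graph := by
        rw [slOp_graph]
        exact ⟨v, v₁, v₂, hv, hvval, hv1, hzv, hv0⟩
      rw [← friedrichsInv_apply_of_mem_graph hd hA hmem, map_zero]
    · exfalso
      obtain ⟨l, y, hyC, hyeq, hyL⟩ := hlp
      refine hyL ?_
      have hun : UniqueDiffOn ℝ (Ici (0 : ℝ)) := uniqueDiffOn_Ici 0
      have d1 : ∀ x, 0 < x → HasDerivAt y (derivWithin y (Ici 0) x) x := fun x hx =>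
        ((hyC.differentiableOn (by norm_num)) x hx.le).hasDerivWithinAt.hasDerivAt
          (Ici_mem_nhds hx)
      have d2 : ∀ x, 0 < x → HasDerivAt (derivWithin y (Ici 0)) ((q x - l) * y x) x := by
        intro x hx
        have hC1 : ContDiffOn ℝ 1 (derivWithin y (Ici 0)) (Ici 0) :=
          hyC.derivWithin hun (by norm_num)
        have := ((hC1.differentiableOn (by norm_num)) x hx.le).hasDerivWithinAt.hasDerivAt
          (Ici_mem_nhds hx)
        refine this.congr_deriv ?_
        have e := hyeq x hx.le
        rw [iteratedDerivWithin_succ] at e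
        have e1 : derivWithin (iteratedDerivWithin 1 y (Ici 0)) (Ici 0) x =
            derivWithin (derivWithin y (Ici 0)) (Ici 0) x :=
          by
          rw [iteratedDerivWithin_one]
        rw [e1] at e
        linear_combination -e
      -- The Wronskian is constant on `(0, 1]` and continuous up to `0`, where it equals `v₁ 0`.
      have hWr : u 1 * v₁ 1 - u₁ 1 * v 1 ≠ 0 := by
        have hcW : ContinuousOn (fun x => u x * v₁ x - u₁ x * v x) (Ici 0) :=
          (hu.continuousOn.mul hv.continuousOn₁).sub (hu.continuousOn₁.mul hv.continuousOn)
        have heq : EqOn (fun x => u x * v₁ x - u₁ x * v x)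
            (fun _ => u 1 * v₁ 1 - u₁ 1 * v 1) (Ioc 0 1) := fun x hx => by
          have := wronskian_sub (l := 0) (fun _ => hu.hasDerivAt)
            (by simpa using fun _ => hasDerivAt_of_ker hq hu hu0) (fun _ => hv.hasDerivAt)
            (fun _ => hasDerivAt_of_ker hq hv hv0) hx.1 hx.2
          rw [zero_mul, add_zero] at this
          exact this.symm
        have := (heq.of_subset_closure (t := Icc 0 1) (hcW.mono Icc_subset_Ici_self)
          continuousOn_const Ioc_subset_Icc_self (by rw [closure_Ioc zero_ne_one]))
          (left_mem_Icc.2 zero_le_one)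
        simp only [huval, hvval, one_mul, mul_zero, sub_zero] at this
        rw [← this]
        exact hv1
      exact memLp_of_two_solutions (fun _ => hu.hasDerivAt)
        (fun _ => hasDerivAt_of_ker hq hu hu0) (fun _ => hv.hasDerivAt)
        (fun _ => hasDerivAt_of_ker hq hv hv0) d1 d2 hyC.continuousOn hWr
        ((memLp_congr_ae hφu).1 (Lp.memLp φ)) ((memLp_congr_ae hzv).1 (Lp.memLp z))

end Kernel

/-! ### Uniqueness for the one-dimensional wave equation, forwards and sideways. -/

section WaveUniqueness

/-- A solution `p` of `p_ss - p_xx = Q p` with `a = p_s` and `b = p_x`; the equation is expressed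
by the derivatives of `a ∓ b` along the characteristics. -/
structure IsWave (Q p a b : ℝ → ℝ → ℂ) : Prop where
  contQ : Continuous (Function.uncurry Q)
  cont : Continuous (Function.uncurry p)
  deriv_s : ∀ s x, HasDerivAt (fun σ => p σ x) (a s x) s
  deriv_x : ∀ s x, HasDerivAt (fun ξ => p s ξ) (b s x) x
  plus : ∀ s x, HasDerivAt (fun τ => a (s + τ) (x + τ) - b (s + τ) (x + τ)) (Q s x * p s x) 0
  minus : ∀ s x, HasDerivAt (fun τ => a (s + τ) (x - τ) + b (s + τ) (x - τ)) (Q s x * p s x) 0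

namespace IsWave

variable {Q p a b : ℝ → ℝ → ℂ}

theorem reflect (h : IsWave Q p a b) :
    IsWave (fun s x => Q s (-x)) (fun s x => p s (-x)) (fun s x => a s (-x))
      (fun s x => -b s (-x)) where
  contQ := h.contQ.comp (continuous_fst.prodMk continuous_snd.neg)
  cont := h.cont.comp (continuous_fst.prodMk continuous_snd.neg)
  deriv_s s x := h.deriv_s s (-x)
  deriv_x s x := by
    have := (h.deriv_x s (-x)).scomp x (hasDerivAt_neg x)
    simpa [Function.comp_def] using this
  plus s x := by
    have := h.minus s (-x)
    refine this.congr_of_eventuallyEq (Eventually.of_forall fun τ => ?_)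
    simp only
    rw [sub_neg_eq_add, neg_add, ← sub_eq_add_neg]
  minus s x := by
    have := h.plus s (-x)
    refine this.congr_of_eventuallyEq (Eventually.of_forall fun τ => ?_)
    simp only
    rw [← sub_eq_add_neg, neg_sub', sub_neg_eq_add]

/-- Exchanging time and space only changes the sign of the potential, so lateral Cauchy data become
initial data. -/
theorem swap (h : IsWave Q p a b) :
    IsWave (fun s x => -Q x s) (fun s x => p x s) (fun s x => b x s) (fun s x => a x s) where
  contQ := (h.contQ.comp continuous_swap).neg
  cont := h.cont.comp continuous_swap
  deriv_s s x := h.deriv_x x s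
  deriv_x s x := h.deriv_s x s
  plus s x := by
    have := (h.plus x s).neg
    simp only [← neg_mul] at this
    refine this.congr_of_eventuallyEq (Eventually.of_forall fun τ => ?_)
    simp
  minus s x := by
    have h1 : HasDerivAt (fun τ => a (x + τ) (s - τ) + b (x + τ) (s - τ)) (Q x s * p x s)
        (-(0 : ℝ)) := by
      rw [neg_zero]
      exact h.minus x s
    have := h1.scomp (0 : ℝ) (hasDerivAt_neg (0 : ℝ))
    rw [neg_one_smul, ← neg_mul] at this
    refine this.congr_of_eventuallyEq (Eventually.of_forall fun τ => ?_)
    simp only [Function.comp_apply, sub_neg_eq_add, ← sub_eq_add_neg]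
    rw [add_comm]

/-- Integrating `a - b` and `a + b` along characteristics, and then `a` in time, bounds `p` on the
backward triangle `D` by half of any bound it already satisfies in an exponentially weighted norm;
iteration gives zero. The potential need only be bounded on the compact `D`. -/
theorem eq_zero_of_initial (h : IsWave Q p a b) {s₀ x₀ r : ℝ}
    (h0 : ∀ x, |x - x₀| < r → p s₀ x = 0 ∧ a s₀ x = 0) {s x : ℝ} (hs : s₀ ≤ s)
    (hx : |x - x₀| + (s - s₀) < r) : p s x = 0 := by
  have hb0 : ∀ x, |x - x₀| < r → b s₀ x = 0 := fun x hx => by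
    refine (h.deriv_x s₀ x).unique ((hasDerivAt_const x (0 : ℂ)).congr_of_eventuallyEq ?_)
    have : ∀ᶠ y in 𝓝 x, |y - x₀| < r :=
      (continuous_abs.comp (continuous_id.sub continuous_const)).continuousAt.eventually_lt
        continuousAt_const hx
    filter_upwards [this] with y hy using (h0 y hy).1
  set ρ := |x - x₀| + (s - s₀) with hρ
  set D : Set (ℝ × ℝ) := {z | s₀ ≤ z.1 ∧ |z.2 - x₀| ≤ ρ - (z.1 - s₀)} with hD
  have hDc : IsCompact D := by
    refine (isCompact_Icc (a := s₀) (b := s₀ + ρ) |>.prod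
      (isCompact_Icc (a := x₀ - ρ) (b := x₀ + ρ))).of_isClosed_subset ?_ ?_
    · exact (isClosed_le (f := fun _ : ℝ × ℝ => s₀) (g := fun z => z.1) (by fun_prop)
        (by fun_prop)).inter (isClosed_le (f := fun z : ℝ × ℝ => |z.2 - x₀|)
        (g := fun z => ρ - (z.1 - s₀)) (by fun_prop) (by fun_prop))
    · rintro ⟨σ, y⟩ ⟨h1, h2⟩
      simp only at h1 h2
      have h3 := abs_nonneg (y - x₀)
      have h4 := abs_le.1 h2
      refine ⟨⟨h1, ?_⟩, ⟨?_, ?_⟩⟩ <;> simp only <;> linarith [h4.1, h4.2]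
  obtain ⟨M₀, hM₀⟩ := hDc.exists_bound_of_continuousOn h.contQ.continuousOn
  obtain ⟨N₀, hN₀⟩ := hDc.exists_bound_of_continuousOn h.cont.continuousOn
  set M := |M₀| + 1 with hM
  have hMpos : 0 < M := by positivity
  have hMb : ∀ z ∈ D, ‖Q z.1 z.2‖ ≤ M := fun z hz =>
    (hM₀ z hz).trans (by linarith [le_abs_self M₀])
  -- Each integration of `exp (lam (s - s₀))` gains `1 / lam`, so the two integrations cost `M / lam
  -- ^ 2 = 1 / 2`.
  set lam := √(2 * M) with hlam
  have hlpos : 0 < lam := Real.sqrt_pos.2 (by positivity)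
  have hl2 : lam ^ 2 = 2 * M := Real.sq_sqrt (by positivity)
  have hexp : ∀ (C σ : ℝ), HasDerivAt (fun σ => C * Real.exp (lam * (σ - s₀)) / lam)
      (C * Real.exp (lam * (σ - s₀))) σ := fun C σ => by
    have h1 : HasDerivAt (fun σ => lam * (σ - s₀)) (lam * 1) σ :=
      ((hasDerivAt_id σ).sub_const s₀).const_mul lam
    refine ((h1.exp.const_mul C).div_const lam).congr_deriv ?_
    field_simp
  have step : ∀ N : ℝ, 0 ≤ N → (∀ z ∈ D, ‖p z.1 z.2‖ ≤ N * Real.exp (lam * (z.1 - s₀))) →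
      ∀ z ∈ D, ‖p z.1 z.2‖ ≤ N / 2 * Real.exp (lam * (z.1 - s₀)) := by
    intro N hN hp
    have hline : ∀ (c : ℝ → ℂ) (ξ : ℝ → ℝ) (s₁ : ℝ), s₀ ≤ s₁ →
        (∀ σ ∈ Icc s₀ s₁, (σ, ξ σ) ∈ D) → c s₀ = 0 →
        (∀ σ, HasDerivAt c (Q σ (ξ σ) * p σ (ξ σ)) σ) →
        ‖c s₁‖ ≤ M * N * Real.exp (lam * (s₁ - s₀)) / lam := by
      intro c ξ s₁ hs₁ hmem hc0 hc
      refine image_norm_le_of_norm_deriv_right_le_deriv_boundary (a := s₀) (b := s₁)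
        (fun σ _ => (hc σ).continuousAt.continuousWithinAt) (fun σ _ => (hc σ).hasDerivWithinAt)
        (by rw [hc0, norm_zero]; positivity) (fun σ => hexp (M * N) σ) (fun σ hσ => ?_)
        (right_mem_Icc.2 hs₁)
      have hz := hmem σ ⟨hσ.1, hσ.2.le⟩
      rw [norm_mul, mul_assoc]
      exact mul_le_mul (hMb _ hz) (hp _ hz) (norm_nonneg _) hMpos.le
    have ha : ∀ z ∈ D, ‖a z.1 z.2‖ ≤ M * N * Real.exp (lam * (z.1 - s₀)) / lam := by
      rintro ⟨s₁, x₁⟩ ⟨hs₁, hx₁⟩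
      simp only at hs₁ hx₁ ⊢
      have base : ∀ y, |y - x₀| ≤ ρ → |y - x₀| < r := fun y hy => hy.trans_lt hx
      have m₁ : ∀ σ ∈ Icc s₀ s₁, (σ, x₁ - s₁ + σ) ∈ D := fun σ hσ => by
        refine ⟨hσ.1, ?_⟩
        have h4 := abs_le.1 hx₁
        rw [abs_le]
        constructor <;> linarith [h4.1, h4.2, hσ.2]
      have m₂ : ∀ σ ∈ Icc s₀ s₁, (σ, x₁ + s₁ - σ) ∈ D := fun σ hσ => by
        refine ⟨hσ.1, ?_⟩
        have h4 := abs_le.1 hx₁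
        rw [abs_le]
        constructor <;> linarith [h4.1, h4.2, hσ.2]
      have b₁ := (m₁ s₀ (left_mem_Icc.2 hs₁)).2
      have b₂ := (m₂ s₀ (left_mem_Icc.2 hs₁)).2
      simp only [sub_self, sub_zero] at b₁ b₂
      have e₁ := hline (fun σ => a σ (x₁ - s₁ + σ) - b σ (x₁ - s₁ + σ)) (fun σ => x₁ - s₁ + σ) s₁
        hs₁ m₁ (by simp only [(h0 _ (base _ b₁)).2, hb0 _ (base _ b₁), sub_zero]) (fun σ => by
          have h5 := h.plus σ (x₁ - s₁ + σ)
          rw [← sub_self σ] at h5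
          have h6 := h5.comp_sub_const σ σ
          simpa [add_sub_cancel, add_assoc] using h6)
      have e₂ := hline (fun σ => a σ (x₁ + s₁ - σ) + b σ (x₁ + s₁ - σ)) (fun σ => x₁ + s₁ - σ) s₁
        hs₁ m₂ (by simp only [(h0 _ (base _ b₂)).2, hb0 _ (base _ b₂), add_zero]) (fun σ => by
          have h5 := h.minus σ (x₁ + s₁ - σ)
          rw [← sub_self σ] at h5
          have h6 := h5.comp_sub_const σ σ
          simpa [add_sub_cancel, sub_sub] using h6)
      simp only [sub_add_cancel, add_sub_cancel_right] at e₁ e₂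
      -- `a` is the mean of the two characteristic combinations, each already bounded along its own
      -- line.
      have e : a s₁ x₁ = (1 / 2 : ℂ) * ((a s₁ x₁ - b s₁ x₁) + (a s₁ x₁ + b s₁ x₁)) := by ring
      rw [e, norm_mul]
      have h7 := (norm_add_le (a s₁ x₁ - b s₁ x₁) (a s₁ x₁ + b s₁ x₁))
      have h8 : ‖(1 / 2 : ℂ)‖ = 1 / 2 := by norm_num
      rw [h8]
      linarith
    rintro ⟨s₁, x₁⟩ ⟨hs₁, hx₁⟩
    simp only at hs₁ hx₁ ⊢
    have m₃ : ∀ σ ∈ Icc s₀ s₁, (σ, x₁) ∈ D := fun σ hσ =>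
      ⟨hσ.1, hx₁.trans (by simp only; linarith [hσ.2])⟩
    have b₃ := (m₃ s₀ (left_mem_Icc.2 hs₁)).2
    simp only [sub_self, sub_zero] at b₃
    have e₃ := image_norm_le_of_norm_deriv_right_le_deriv_boundary (a := s₀) (b := s₁)
        (f := fun σ => p σ x₁) (f' := fun σ => a σ x₁)
        (B := fun σ => M * N / lam * Real.exp (lam * (σ - s₀)) / lam)
        (fun σ _ => (h.deriv_s σ x₁).continuousAt.continuousWithinAt)
        (fun σ _ => (h.deriv_s σ x₁).hasDerivWithinAt)
        (by simp only [(h0 _ (b₃.trans_lt hx)).1, norm_zero]; positivity)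
        (fun σ => hexp (M * N / lam) σ) (fun σ hσ => by
          have := ha _ (m₃ σ ⟨hσ.1, hσ.2.le⟩)
          simp only at this ⊢
          rwa [div_mul_eq_mul_div])
        (right_mem_Icc.2 hs₁)
    refine e₃.trans_eq ?_
    have : M * N / lam * Real.exp (lam * (s₁ - s₀)) / lam =
        M * N * Real.exp (lam * (s₁ - s₀)) / lam ^ 2 := by field_simp
    rw [this, hl2]
    field_simp
  have hall : ∀ n : ℕ, ∀ z ∈ D,
      ‖p z.1 z.2‖ ≤ |N₀| / 2 ^ n * Real.exp (lam * (z.1 - s₀)) := by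
    intro n
    induction n with
    | zero =>
      intro z hz
      have h1 : 1 ≤ Real.exp (lam * (z.1 - s₀)) :=
        Real.one_le_exp (mul_nonneg hlpos.le (by linarith [hz.1]))
      have h2 : ‖p z.1 z.2‖ ≤ N₀ := hN₀ z hz
      rw [pow_zero, div_one]
      exact (h2.trans (le_abs_self _)).trans (le_mul_of_one_le_right (abs_nonneg _) h1)
    | succ n ih =>
      have := step _ (by positivity) ih
      intro z hz
      rw [pow_succ, ← div_div]
      exact this z hz
  have hmem : (s, x) ∈ D := ⟨hs, by simp only [hρ]; linarith⟩
  have hlim : Tendsto (fun n : ℕ => |N₀| / 2 ^ n * Real.exp (lam * (s - s₀))) atTop (𝓝 0) := by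
    have h1 : Tendsto (fun n : ℕ => |N₀| / 2 ^ n) atTop (𝓝 0) :=
      tendsto_const_nhds.div_atTop (tendsto_pow_atTop_atTop_of_one_lt one_lt_two)
    simpa using h1.mul_const (Real.exp (lam * (s - s₀)))
  exact norm_le_zero_iff.1 (ge_of_tendsto' hlim fun n => hall n _ hmem)

/-- The exchanged wave evolves in `x` from the line `x = x₀`; points to the left are reached after a
reflection. -/
theorem eq_zero_of_lateral (h : IsWave Q p a b) {s₀ x₀ r : ℝ}
    (h0 : ∀ s, |s - s₀| < r → p s x₀ = 0 ∧ b s x₀ = 0) {s x : ℝ}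
    (hx : |x - x₀| + |s - s₀| < r) : p s x = 0 := by
  rcases le_total x₀ x with hle | hle
  · refine h.swap.eq_zero_of_initial (s₀ := x₀) (x₀ := s₀) (r := r) h0 hle ?_
    rw [abs_of_nonneg (sub_nonneg.2 hle)] at hx
    linarith
  · have := h.reflect.swap.eq_zero_of_initial (s₀ := -x₀) (x₀ := s₀) (r := r) (s := -x) (x := s)
      (fun y hy => by simpa using h0 y hy) (neg_le_neg hle) (by
        rw [abs_of_nonpos (sub_nonpos.2 hle)] at hx
        linarith)
    simpa using this

end IsWave

end WaveUniqueness

/-! ### Vectors representing point evaluations, and classical solutions built from them. -/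

section PointEvaluation

variable {q : ℝ → ℝ} (hA : IsPositiveDefinite (slOp q))

/-- The kernel of the double primitive, extended to an odd function of `x`. -/
def tent (x t : ℝ) : ℝ := max (x - t) 0 - max (-x - t) 0

theorem tent_neg (x t : ℝ) : tent (-x) t = -tent x t := by
  simp [tent]

theorem tent_of_le {x t : ℝ} (h : |x| ≤ t) : tent x t = 0 := by
  have := abs_le.1 h
  rw [tent, max_eq_right (by linarith), max_eq_right (by linarith), sub_zero]

theorem tent_of_nonneg {x t : ℝ} (hx : 0 ≤ x) (ht : 0 ≤ t) (h : t ≤ x) : tent x t = x - t := by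
  rw [tent, max_eq_left (by linarith), max_eq_right (by linarith), sub_zero]

theorem continuous_tent (x : ℝ) : Continuous (tent x) := by
  unfold tent
  fun_prop

theorem abs_tent_sub_le (x y t : ℝ) : |tent x t - tent y t| ≤ 2 * |x - y| := by
  have h1 := abs_max_sub_max_le_abs (x - t) (y - t) 0
  have h2 := abs_max_sub_max_le_abs (-x - t) (-y - t) 0
  have e1 : x - t - (y - t) = x - y := by ring
  have e2 : -x - t - (-y - t) = -(x - y) := by ring
  rw [e1] at h1
  rw [e2, abs_neg] at h2
  have e3 : tent x t - tent y t = (max (x - t) 0 - max (y - t) 0) -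
      (max (-x - t) 0 - max (-y - t) 0) := by
    simp only [tent]
    ring
  rw [e3]
  exact (abs_sub _ _).trans (by linarith)

theorem tent_memLp {m : ℝ → ℝ} (hm : ContinuousOn m (Ici 0)) (x : ℝ) :
    MemLp (fun t => (m t : ℂ) * tent x t) 2 halfLine :=
  memLp_of_continuousOn (R := |x|) ((Complex.continuous_ofReal.comp_continuousOn hm).mul
    (Complex.continuous_ofReal.comp (continuous_tent x)).continuousOn)
    fun t ht => by rw [tent_of_le ht.le]; simp

/-- The class in `L₂(0, ∞)` of `m` times the kernel of the double primitive. -/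
def tentL2 {m : ℝ → ℝ} (hm : ContinuousOn m (Ici 0)) (x : ℝ) : L2Half := (tent_memLp hm x).toLp _

theorem tentL2_coeFn {m : ℝ → ℝ} (hm : ContinuousOn m (Ici 0)) (x : ℝ) :
    tentL2 hm x =ᵐ[halfLine] fun t => (m t : ℂ) * tent x t := (tent_memLp hm x).coeFn_toLp

theorem tentL2_neg {m : ℝ → ℝ} (hm : ContinuousOn m (Ici 0)) (x : ℝ) :
    tentL2 hm (-x) = -tentL2 hm x := by
  rw [tentL2, tentL2, ← MemLp.toLp_neg]
  congr 1
  ext t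
  simp [tent_neg]

theorem continuous_tentL2 {m : ℝ → ℝ} (hm : ContinuousOn m (Ici 0)) :
    Continuous (tentL2 hm) := by
  refine continuous_iff_continuousAt.2 fun x => ?_
  obtain ⟨C, hC⟩ := isCompact_Icc.exists_bound_of_continuousOn (s := Icc 0 (|x| + 1))
    (hm.mono Icc_subset_Ici_self)
  have hC0 : 0 ≤ C := (norm_nonneg _).trans (hC 0 ⟨le_rfl, by positivity⟩)
  have hfin : halfLine (Ioc 0 (|x| + 1)) ≠ ⊤ :=
    ((Measure.restrict_apply_le _ _).trans_lt measure_Ioc_lt_top).ne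
  set e : L2Half := indicatorConstLp 2 measurableSet_Ioc hfin (1 : ℂ) with he
  rw [ContinuousAt, tendsto_iff_norm_sub_tendsto_zero]
  have hlim : Tendsto (fun y => C * (2 * |y - x|) * ‖e‖) (𝓝 x) (𝓝 0) := by
    have : Continuous fun y => C * (2 * |y - x|) * ‖e‖ := by fun_prop
    simpa using this.tendsto x
  refine squeeze_zero' (Eventually.of_forall fun _ => norm_nonneg _) ?_ hlim
  filter_upwards [Metric.ball_mem_nhds x one_pos] with y hy
  refine Lp.norm_le_mul_norm_of_ae_le_mul ?_
  filter_upwards [Lp.coeFn_sub (tentL2 hm y) (tentL2 hm x), tentL2_coeFn hm y, tentL2_coeFn hm x,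
    indicatorConstLp_coeFn (p := 2) (hs := measurableSet_Ioc) (hμs := hfin) (c := (1 : ℂ)),
    ae_restrict_mem measurableSet_Ioi] with t e1 e2 e3 e4 ht
  rw [e1, Pi.sub_apply, e2, e3, he, e4, ← mul_sub, norm_mul, ← Complex.ofReal_sub,
    Complex.norm_real, Complex.norm_real]
  have hyx : |y| ≤ |x| + 1 := by
    rw [Metric.mem_ball, Real.dist_eq] at hy
    have := abs_sub_abs_le_abs_sub y x
    linarith
  by_cases htx : t ≤ |x| + 1
  · rw [indicator_of_mem (show t ∈ Ioc 0 (|x| + 1) from ⟨ht, htx⟩), norm_one, mul_one]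
    exact mul_le_mul (hC t ⟨le_of_lt ht, htx⟩) (abs_tent_sub_le y x t) (norm_nonneg _) hC0
  · push Not at htx
    rw [tent_of_le (hyx.trans htx.le), tent_of_le (by linarith), sub_self, norm_zero, mul_zero]
    positivity

/-- The Green function `v_x`, extended to an odd function of `x`: the vector which represents the
evaluation of `L⁻¹ g` at `x`. -/
def greenVec (hq : ContinuousOn q (Ici 0)) (φ : L2Half) (x : ℝ) : L2Half :=
  (x : ℂ) • φ + friedrichsInv (slOp q) hA (tentL2 hq x) - tentL2 continuousOn_const (m := fun _ => 1) x

variable {hA} (hq : ContinuousOn q (Ici 0)) {φ : L2Half}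

theorem greenVec_neg (x : ℝ) : greenVec hA hq φ (-x) = -greenVec hA hq φ x := by
  simp only [greenVec, tentL2_neg, map_neg, Complex.ofReal_neg, neg_smul]
  abel

theorem continuous_greenVec : Continuous (greenVec hA hq φ) := by
  have h1 := continuous_tentL2 hq
  have h2 := continuous_tentL2 (m := fun _ => 1) continuousOn_const
  unfold greenVec
  fun_prop

/-- This is Taylor's formula `f x = x f'(0) + ∫₀ˣ (x - t) f''(t) dt` with `f'' = q f - g`. The slope
is the pairing with `φ`, and the term with `q f` has `L⁻¹` moved onto the tent function. -/
theorem inner_greenVec {g : L2Half} {f f₁ f₂ : ℝ → ℂ} (hf : IsH2Loc f f₁ f₂) (h0 : f 0 = 0)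
    (h1 : f₁ 0 = ⟪φ, g⟫_ℂ) (hy : friedrichsInv (slOp q) hA g =ᵐ[halfLine] f)
    (hg : g =ᵐ[halfLine] fun x => -f₂ x + q x * f x) {x : ℝ} (hx : 0 ≤ x) :
    ⟪greenVec hA hq φ x, g⟫_ℂ = f x := by
  rw [greenVec, inner_sub_left, inner_add_left, inner_smul_left, Complex.conj_ofReal, ← h1,
    friedrichsInv_symm (slOp_dense hq) hA]
  rw [inner_eq_intervalIntegral (tentL2_coeFn hq x) hy hx fun t ht => by
      rw [tent_of_le (by rw [abs_of_nonneg hx]; exact ht.le)]; simp,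
    inner_eq_intervalIntegral (tentL2_coeFn continuousOn_const x) hg hx fun t ht => by
      rw [tent_of_le (by rw [abs_of_nonneg hx]; exact ht.le)]; simp]
  have cc : ∀ {u : ℝ → ℂ}, ContinuousOn u (Ici 0) → ContinuousOn u (uIcc 0 x) := fun hu =>
    hu.mono (by rw [uIcc_of_le hx]; exact Icc_subset_Ici_self)
  have cq : ContinuousOn (fun t => (q t : ℂ)) (uIcc 0 x) :=
    cc (Complex.continuous_ofReal.comp_continuousOn hq)
  have ct : ContinuousOn (fun t => (tent x t : ℂ)) (uIcc 0 x) :=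
    (Complex.continuous_ofReal.comp (continuous_tent x)).continuousOn
  have i1 : IntervalIntegrable (fun t => f t * starRingEnd ℂ ((q t : ℂ) * tent x t)) volume 0 x :=
    ((cc hf.continuousOn).mul (Complex.continuous_conj.comp_continuousOn
      (cq.mul ct))).intervalIntegrable
  have i2 : IntervalIntegrable (fun t => (-f₂ t + q t * f t) *
      starRingEnd ℂ (((1 : ℝ) : ℂ) * tent x t)) volume 0 x := by
    refine ((hf.intervalIntegrable₂ hx).neg.add
      (cq.mul (cc hf.continuousOn)).intervalIntegrable).mul_continuousOn ?_
    exact Complex.continuous_conj.comp_continuousOn (continuousOn_const.mul ct)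
  rw [add_sub_assoc, ← intervalIntegral.integral_sub i1 i2]
  have hp := integral_parts (F := fun t : ℝ => (x : ℂ) - t) (F' := fun _ => -1) (G := f₁) (G' := f₂)
    hx intervalIntegrable_const (hf.intervalIntegrable₂ hx) (fun t _ => by simp [sub_eq_add_neg])
    hf.integral_deriv₂
  have i3 : IntervalIntegrable (fun t : ℝ => (-1 : ℂ) * f₁ t) volume 0 x :=
    (hf.intervalIntegrable₁ hx).const_mul (-1)
  have i4 : IntervalIntegrable (fun t : ℝ => ((x : ℂ) - t) * f₂ t) volume 0 x :=
    (hf.intervalIntegrable₂ hx).continuousOn_mul (by fun_prop)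
  rw [intervalIntegral.integral_add i3 i4, intervalIntegral.integral_const_mul] at hp
  have e : ∫ t in (0 : ℝ)..x, (f t * starRingEnd ℂ ((q t : ℂ) * tent x t) - (-f₂ t + q t * f t) *
      starRingEnd ℂ (((1 : ℝ) : ℂ) * tent x t)) = ∫ t in (0 : ℝ)..x, ((x : ℂ) - t) * f₂ t := by
    refine intervalIntegral.integral_congr fun t ht => ?_
    rw [uIcc_of_le hx] at ht
    simp only [tent_of_nonneg hx ht.1 ht.2, map_mul, Complex.conj_ofReal]
    push_cast
    ring
  rw [e, hf.integral_deriv x hx, h0]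
  simp only [sub_self, zero_mul, Complex.ofReal_zero, sub_zero] at hp
  linear_combination hp

/-- The vector which represents the evaluation of `L⁻² g` at `x`. -/
def greenVec₂ (hA : IsPositiveDefinite (slOp q)) (hq : ContinuousOn q (Ici 0)) (φ : L2Half)
    (x : ℝ) : L2Half := friedrichsInv (slOp q) hA (greenVec hA hq φ x)

/-- The derivative of `greenVec₂`. -/
def greenVec₂Deriv (hA : IsPositiveDefinite (slOp q)) (hq : ContinuousOn q (Ici 0)) (φ : L2Half)
    (x : ℝ) : L2Half := friedrichsInv (slOp q) hA φ +
      ∫ t in (0 : ℝ)..x, ((q |t| : ℝ) : ℂ) • greenVec₂ hA hq φ t - greenVec hA hq φ t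

theorem greenVec₂_neg (x : ℝ) : greenVec₂ hA hq φ (-x) = -greenVec₂ hA hq φ x := by
  rw [greenVec₂, greenVec_neg, map_neg, greenVec₂]

theorem continuous_greenVec₂ : Continuous (greenVec₂ hA hq φ) :=
  (friedrichsInv (slOp q) hA).continuous.comp (continuous_greenVec hq)

theorem continuous_greenVec₂_rhs : Continuous fun t =>
    ((q |t| : ℝ) : ℂ) • greenVec₂ hA hq φ t - greenVec hA hq φ t :=
  ((Complex.continuous_ofReal.comp (continuous_even hq)).smul (continuous_greenVec₂ hq)).sub
    (continuous_greenVec hq)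

theorem hasDerivAt_greenVec₂Deriv (x : ℝ) : HasDerivAt (greenVec₂Deriv hA hq φ)
    (((q |x| : ℝ) : ℂ) • greenVec₂ hA hq φ x - greenVec hA hq φ x) x :=
  ((continuous_greenVec₂_rhs hq).integral_hasStrictDerivAt 0 x).hasDerivAt.const_add _

theorem continuous_greenVec₂Deriv : Continuous (greenVec₂Deriv hA hq φ) :=
  continuous_iff_continuousAt.2 fun x => (hasDerivAt_greenVec₂Deriv hq x).continuousAt

/-- Both sides are a value at `0` plus the primitive of `f₂ = q f - L⁻¹ g`, up to conjugation. The
vector is thereby identified weakly as the derivative of `greenVec₂`. -/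
theorem inner_greenVec₂Deriv (hφ : IsKernelVector hA φ) {g : L2Half} {f f₁ f₂ : ℝ → ℂ}
    (hf : IsH2Loc f f₁ f₂) (h0 : f 0 = 0) (h1 : f₁ 0 = ⟪φ, friedrichsInv (slOp q) hA g⟫_ℂ)
    (hy : friedrichsInv (slOp q) hA (friedrichsInv (slOp q) hA g) =ᵐ[halfLine] f)
    (hg : friedrichsInv (slOp q) hA g =ᵐ[halfLine] fun x => -f₂ x + q x * f x) {x : ℝ}
    (hx : 0 ≤ x) : ⟪g, greenVec₂Deriv hA hq φ x⟫_ℂ = starRingEnd ℂ (f₁ x) := by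
  obtain ⟨u, u₁, u₂, hu, hu0, hu1, hyu, hgu⟩ := hφ.slope g
  have hint := (innerSL ℂ g).intervalIntegral_comp_comm
    ((continuous_greenVec₂_rhs (hA := hA) hq (φ := φ)).intervalIntegrable (μ := volume) 0 x)
  rw [greenVec₂Deriv, inner_add_right, ← friedrichsInv_symm (slOp_dense hq) hA,
    ← inner_conj_symm, ← h1]
  simp only [innerSL_apply_apply] at hint
  rw [← hint, hf.integral_deriv₂ x hx, map_add]
  congr 1
  rw [intervalIntegral.integral_of_le hx, intervalIntegral.integral_of_le hx, ← integral_conj]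
  refine integral_congr_ae ?_
  have hfg : u =ᵐ[halfLine] fun x => -f₂ x + q x * f x := hyu.symm.trans hg
  filter_upwards [ae_restrict_of_ae_restrict_of_subset Ioc_subset_Ioi_self hfg,
    ae_restrict_mem measurableSet_Ioc] with t ht ht0
  have e1 := inner_greenVec hq hu hu0 hu1 hyu hgu ht0.1.le
  have e2 := inner_greenVec hq hf h0 h1 hy hg ht0.1.le
  rw [inner_sub_right, inner_smul_right, greenVec₂, ← friedrichsInv_symm (slOp_dense hq) hA,
    ← inner_conj_symm, e2, ← inner_conj_symm g, e1, ht, abs_of_pos ht0.1]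
  simp only [map_add, map_neg, map_mul, Complex.conj_ofReal]
  ring

theorem integral_comp_even {E : Type*} [NormedAddCommGroup E] [NormedSpace ℝ E] {k : ℝ → E}
    (hk : ∀ t, k (-t) = k t) (x : ℝ) : ∫ t in (0 : ℝ)..-x, k t = -∫ t in (0 : ℝ)..x, k t := by
  have := intervalIntegral.integral_comp_neg (a := 0) (b := x) k
  simp only [hk, neg_zero] at this
  rw [intervalIntegral.integral_symm, ← this]

theorem integral_comp_odd {E : Type*} [NormedAddCommGroup E] [NormedSpace ℝ E] {k : ℝ → E}
    (hk : ∀ t, k (-t) = -k t) (x : ℝ) : ∫ t in (0 : ℝ)..-x, k t = ∫ t in (0 : ℝ)..x, k t := by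
  have := intervalIntegral.integral_comp_neg (a := 0) (b := x) k
  simp only [hk, neg_zero, intervalIntegral.integral_neg] at this
  rw [intervalIntegral.integral_symm, ← this, neg_neg]

/-- For `x ≥ 0` it is tested against every `g`. Negative `x` follow because `greenVec₂` is odd and
its derivative even. -/
theorem greenVec₂_eq_integral (hφ : IsKernelVector hA φ) (x : ℝ) :
    greenVec₂ hA hq φ x = ∫ t in (0 : ℝ)..x, greenVec₂Deriv hA hq φ t := by
  have hpos : ∀ x, 0 ≤ x →
      greenVec₂ hA hq φ x = ∫ t in (0 : ℝ)..x, greenVec₂Deriv hA hq φ t := by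
    intro x hx
    refine ext_inner_left ℂ fun g => ?_
    obtain ⟨f, f₁, f₂, hf, h0, h1, hy, hg⟩ := hφ.slope (friedrichsInv (slOp q) hA g)
    have hint := (innerSL ℂ g).intervalIntegral_comp_comm
      ((continuous_greenVec₂Deriv (hA := hA) hq (φ := φ)).intervalIntegrable (μ := volume) 0 x)
    simp only [innerSL_apply_apply] at hint
    rw [← hint, greenVec₂, ← friedrichsInv_symm (slOp_dense hq) hA, ← inner_conj_symm,
      inner_greenVec hq hf h0 h1 hy hg hx, hf.integral_deriv x hx, h0, zero_add,
      intervalIntegral.integral_of_le hx, intervalIntegral.integral_of_le hx, ← integral_conj]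
    refine setIntegral_congr_fun measurableSet_Ioc fun t ht => ?_
    exact (inner_greenVec₂Deriv hq hφ hf h0 h1 hy hg ht.1.le).symm
  rcases le_total 0 x with hx | hx
  · exact hpos x hx
  · have h1 := hpos (-x) (by linarith)
    rw [greenVec₂_neg, integral_comp_even] at h1
    · exact neg_injective h1
    · intro t
      rw [greenVec₂Deriv, greenVec₂Deriv, integral_comp_odd]
      intro t
      rw [greenVec₂_neg, greenVec_neg, abs_neg, smul_neg]
      abel

theorem hasDerivAt_greenVec₂ (hφ : IsKernelVector hA φ) (x : ℝ) :
    HasDerivAt (greenVec₂ hA hq φ) (greenVec₂Deriv hA hq φ x) x := by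
  have h := ((continuous_greenVec₂Deriv (hA := hA) (φ := φ) hq).integral_hasStrictDerivAt
    0 x).hasDerivAt
  exact h.congr_of_eventuallyEq (Eventually.of_forall fun y => greenVec₂_eq_integral hq hφ y)

/-- Smooth curves with `L⁻¹ G'' = -G` give classical solutions of the wave equation. -/
theorem isWave_inner (hφ : IsKernelVector hA φ) {G G₁ G₂ : ℝ → L2Half}
    (h1 : ∀ s, HasDerivAt G (G₁ s) s) (h2 : ∀ s, HasDerivAt G₁ (G₂ s) s)
    (heq : ∀ s, friedrichsInv (slOp q) hA (G₂ s) = -G s) :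
    IsWave (fun _ x => -((q |x| : ℝ) : ℂ)) (fun s x => ⟪G s, greenVec₂ hA hq φ x⟫_ℂ)
      (fun s x => ⟪G₁ s, greenVec₂ hA hq φ x⟫_ℂ)
      (fun s x => ⟪G s, greenVec₂Deriv hA hq φ x⟫_ℂ) := by
  have cG : Continuous G := continuous_iff_continuousAt.2 fun s => (h1 s).continuousAt
  -- The abstract equation trades two time derivatives for one `L⁻¹`. Along a characteristic the
  -- mixed terms then cancel, as do those with `greenVec`, and the potential term remains.
  have key : ∀ s x, ⟪G₂ s, greenVec₂ hA hq φ x⟫_ℂ = -⟪G s, greenVec hA hq φ x⟫_ℂ := fun s x => by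
    rw [greenVec₂, ← friedrichsInv_symm (slOp_dense hq) hA, heq, inner_neg_left]
  refine ⟨?_, ?_, fun s x => ?_, fun s x => ?_, fun s x => ?_, fun s x => ?_⟩
  · exact (Complex.continuous_ofReal.comp ((continuous_even hq).comp continuous_snd)).neg
  · exact (cG.comp continuous_fst).inner ((continuous_greenVec₂ hq).comp continuous_snd)
  · simpa using (h1 s).inner ℂ (hasDerivAt_const s (greenVec₂ hA hq φ x))
  · simpa using (hasDerivAt_const x (G s)).inner ℂ (hasDerivAt_greenVec₂ hq hφ x)
  · have a0 : HasDerivAt (fun τ : ℝ => s + τ) 1 0 := (hasDerivAt_id (0 : ℝ)).const_add s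
    have b0 : HasDerivAt (fun τ : ℝ => x + τ) 1 0 := (hasDerivAt_id (0 : ℝ)).const_add x
    have g1 := HasDerivAt.scomp_of_eq (0 : ℝ) (h1 s) a0 (by simp)
    have g2 := HasDerivAt.scomp_of_eq (0 : ℝ) (h2 s) a0 (by simp)
    have w1 := HasDerivAt.scomp_of_eq (0 : ℝ) (hasDerivAt_greenVec₂ hq hφ x) b0 (by simp)
    have w2 := HasDerivAt.scomp_of_eq (0 : ℝ) (hasDerivAt_greenVec₂Deriv (hA := hA) (φ := φ) hq x)
      b0 (by simp)
    refine ((g2.inner ℂ w1).sub (g1.inner ℂ w2)).congr_deriv ?_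
    simp only [Function.comp_apply, add_zero, one_smul, inner_sub_right, inner_smul_right, key]
    ring
  · have a0 : HasDerivAt (fun τ : ℝ => s + τ) 1 0 := (hasDerivAt_id (0 : ℝ)).const_add s
    have b0 : HasDerivAt (fun τ : ℝ => x - τ) (-1) 0 := (hasDerivAt_id (0 : ℝ)).const_sub x
    have g1 := HasDerivAt.scomp_of_eq (0 : ℝ) (h1 s) a0 (by simp)
    have g2 := HasDerivAt.scomp_of_eq (0 : ℝ) (h2 s) a0 (by simp)
    have w1 := HasDerivAt.scomp_of_eq (0 : ℝ) (hasDerivAt_greenVec₂ hq hφ x) b0 (by simp)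
    have w2 := HasDerivAt.scomp_of_eq (0 : ℝ) (hasDerivAt_greenVec₂Deriv (hA := hA) (φ := φ) hq x)
      b0 (by simp)
    refine ((g2.inner ℂ w1).add (g1.inner ℂ w2)).congr_deriv ?_
    simp only [Function.comp_apply, add_zero, sub_zero, one_smul, neg_smul, inner_neg_right,
      inner_sub_right, inner_smul_right, key]
    ring

/-- Pointwise values of elements of the range of `L⁻²`. -/
theorem friedrichsInv_sq_ae_eq (hφ : IsKernelVector hA φ) (g : L2Half) :
    friedrichsInv (slOp q) hA (friedrichsInv (slOp q) hA g) =ᵐ[halfLine]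
      fun x => starRingEnd ℂ ⟪g, greenVec₂ hA hq φ x⟫_ℂ := by
  obtain ⟨f, f₁, f₂, hf, h0, h1, hy, hg⟩ := hφ.slope (friedrichsInv (slOp q) hA g)
  filter_upwards [hy, ae_restrict_mem measurableSet_Ioi] with x hx hx0
  rw [hx, ← inner_greenVec hq hf h0 h1 hy hg (le_of_lt hx0), greenVec₂,
    ← friedrichsInv_symm (slOp_dense hq) hA, inner_conj_symm]

end PointEvaluation

/-! ### Integrals with values in a closed subspace. -/

section ClosedSubspace

variable {H : Type*} [NormedAddCommGroup H] [InnerProductSpace ℂ H] [CompleteSpace H]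

theorem mem_iff_inner_orthogonal (M : ClosedSubmodule ℂ H) {x : H} :
    x ∈ M ↔ ∀ z ∈ Mᗮ, ⟪z, x⟫_ℂ = 0 := by
  rw [← ClosedSubmodule.mem_toSubmodule_iff, ← Submodule.orthogonal_orthogonal M.toSubmodule]
  exact Submodule.mem_orthogonal _ _

/-- Integrability is not needed: the default value `0` of the integral lies in `M` as well. -/
theorem integral_mem_closedSubmodule {α : Type*} [MeasurableSpace α] {μ : Measure α}
    (M : ClosedSubmodule ℂ H) {g : α → H} (hg : ∀ᵐ s ∂μ, g s ∈ M) : ∫ s, g s ∂μ ∈ M := by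
  by_cases hi : Integrable g μ
  · rw [mem_iff_inner_orthogonal]
    intro z hz
    rw [← integral_inner hi]
    refine integral_eq_zero_of_ae ?_
    filter_upwards [hg] with s hs
    exact (M.mem_orthogonal' z).1 hz _ hs
  · rw [integral_undef hi]
    exact M.zero_mem'

end ClosedSubspace

/-! ### The lattice of the subspaces `L2On E`. -/

section SupportSubspace

theorem mem_L2On {E : Set ℝ} {y : L2Half} : y ∈ L2On E ↔ ∀ᵐ s ∂halfLine, s ∉ E → y s = 0 :=
  Iff.rfl

theorem L2On_le_of_ae {E F : Set ℝ} (h : ∀ᵐ s ∂halfLine, s ∈ E → s ∈ F) : L2On E ≤ L2On F := by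
  intro y hy
  filter_upwards [mem_L2On.1 hy, h] with s h1 h2 h3
  exact h1 fun h4 => h3 (h2 h4)

theorem L2On_mono {E F : Set ℝ} (h : E ⊆ F) : L2On E ≤ L2On F :=
  L2On_le_of_ae (Eventually.of_forall fun _ hs => h hs)

theorem L2On_congr {E F : Set ℝ} (h : ∀ᵐ s ∂halfLine, s ∈ E ↔ s ∈ F) : L2On E = L2On F :=
  le_antisymm (L2On_le_of_ae (h.mono fun _ => Iff.mp)) (L2On_le_of_ae (h.mono fun _ => Iff.mpr))

/-- The restriction of a function to `E`, extended by zero. -/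
def cutOff {E : Set ℝ} (hE : MeasurableSet E) (y : L2Half) : L2Half :=
  ((Lp.memLp y).indicator hE).toLp _

variable {E F : Set ℝ}

theorem cutOff_coeFn (hE : MeasurableSet E) (y : L2Half) :
    cutOff hE y =ᵐ[halfLine] E.indicator y := MemLp.coeFn_toLp _

theorem cutOff_mem (hE : MeasurableSet E) (y : L2Half) : cutOff hE y ∈ L2On E := by
  filter_upwards [cutOff_coeFn hE y] with s h1 h2
  rw [h1, indicator_of_notMem h2]

theorem sub_cutOff_mem (hE : MeasurableSet E) (y : L2Half) : y - cutOff hE y ∈ L2On Eᶜ := by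
  filter_upwards [cutOff_coeFn hE y, Lp.coeFn_sub y (cutOff hE y)] with s h1 h3 h2
  rw [h3, Pi.sub_apply, h1, indicator_of_mem (not_notMem.1 h2), sub_self]

theorem inner_eq_zero_of_mem_compl {y z : L2Half} (hz : z ∈ L2On Eᶜ) (hy : y ∈ L2On E) :
    ⟪z, y⟫_ℂ = 0 := by
  rw [L2.inner_def]
  refine integral_eq_zero_of_ae ?_
  filter_upwards [mem_L2On.1 hz, mem_L2On.1 hy] with s h1 h2
  by_cases hs : s ∈ E
  · simp [h1 (not_not.2 hs)]
  · simp [h2 hs]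

theorem orthogonal_L2On (hE : MeasurableSet E) : (L2On E)ᗮ = L2On Eᶜ := by
  refine SetLike.ext fun z => ?_
  rw [ClosedSubmodule.mem_orthogonal']
  refine ⟨fun h => ?_, fun h y hy => inner_eq_zero_of_mem_compl h hy⟩
  have h1 := h _ (cutOff_mem hE z)
  have h2 := inner_eq_zero_of_mem_compl (sub_cutOff_mem hE z) (cutOff_mem hE z)
  rw [inner_sub_left, h1, zero_sub, neg_eq_zero, inner_self_eq_zero] at h2
  have h3 := sub_cutOff_mem hE z
  rwa [h2, sub_zero] at h3

theorem proj_L2On (hE : MeasurableSet E) (y : L2Half) : proj (L2On E) y = cutOff hE y := by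
  refine Submodule.eq_starProjection_of_mem_of_inner_eq_zero (cutOff_mem hE y) fun w hw => ?_
  exact inner_eq_zero_of_mem_compl (sub_cutOff_mem hE y) hw

theorem proj_L2On_coeFn (hE : MeasurableSet E) (y : L2Half) :
    proj (L2On E) y =ᵐ[halfLine] E.indicator y := by
  rw [proj_L2On hE]
  exact cutOff_coeFn hE y

theorem L2On_sup (hE : MeasurableSet E) : L2On E ⊔ L2On F = L2On (E ∪ F) := by
  refine le_antisymm (sup_le (L2On_mono subset_union_left) (L2On_mono subset_union_right)) ?_
  intro y hy
  have h2 : y - cutOff hE y ∈ L2On F := by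
    filter_upwards [mem_L2On.1 (sub_cutOff_mem hE y), mem_L2On.1 hy, cutOff_coeFn hE y,
      Lp.coeFn_sub y (cutOff hE y)] with s h1 h2 h3 h4 hs
    by_cases hE' : s ∈ E
    · exact h1 (not_not.2 hE')
    · rw [h4, Pi.sub_apply, h3, indicator_of_notMem hE', sub_zero]
      exact h2 fun h => h.elim hE' hs
  rw [← sub_add_cancel y (cutOff hE y)]
  exact add_mem ((le_sup_right : L2On F ≤ L2On E ⊔ L2On F) h2)
    ((le_sup_left : L2On E ≤ L2On E ⊔ L2On F) (cutOff_mem hE y))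

theorem L2On_inf : L2On E ⊓ L2On F = L2On (E ∩ F) := by
  refine le_antisymm ?_ (le_inf (L2On_mono inter_subset_left) (L2On_mono inter_subset_right))
  rintro y ⟨h1, h2⟩
  filter_upwards [mem_L2On.1 h1, mem_L2On.1 h2] with s h1 h2 h3
  by_cases hE : s ∈ E
  · exact h2 fun hF => h3 ⟨hE, hF⟩
  · exact h1 hE

theorem L2On_of_Ioi_subset (h : Ioi 0 ⊆ E) : L2On E = ⊤ := by
  refine top_le_iff.1 fun y _ => ?_
  filter_upwards [ae_restrict_mem measurableSet_Ioi] with s hs h1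
  exact absurd (h hs) h1

theorem L2On_empty : L2On ∅ = ⊥ := by
  refine le_bot_iff.1 fun y hy => ?_
  have : y =ᵐ[halfLine] (0 : L2Half) := by
    filter_upwards [mem_L2On.1 hy, Lp.coeFn_zero ℂ 2 halfLine] with s h1 h2
    rw [h1 (notMem_empty s), h2, Pi.zero_apply]
  exact Lp.ext this

/-- Locally null sets are null on the line, so vanishing on a set may be checked near each of its
points. -/
theorem mem_L2On_compl_of_locally {U : Set ℝ} {y : L2Half}
    (h : ∀ x ∈ U, ∃ V ∈ 𝓝 x, y ∈ L2On Vᶜ) : y ∈ L2On Uᶜ := by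
  have h0 : halfLine {s | s ∈ U ∧ y s ≠ 0} = 0 := by
    refine measure_null_of_locally_null _ fun x hx => ?_
    obtain ⟨V, hV, hy⟩ := h x hx.1
    refine ⟨V ∩ {s | s ∈ U ∧ y s ≠ 0}, inter_mem (mem_nhdsWithin_of_mem_nhds hV)
      self_mem_nhdsWithin, measure_mono_null (t := {s | ¬ (s ∉ Vᶜ → y s = 0)}) ?_ (ae_iff.1 hy)⟩
    rintro s ⟨h1, -, h2⟩
    simpa using ⟨h1, h2⟩
  rw [mem_L2On, ae_iff]
  convert h0 using 2
  ext s
  simp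

end SupportSubspace

/-! ### Finite speed of propagation. -/

section FiniteSpeed

variable {q : ℝ → ℝ}

theorem tsupport_slFun_subset {ψ : ℝ → ℂ} : tsupport (slFun q ψ) ⊆ tsupport ψ := by
  refine closure_minimal (fun x hx => ?_) (isClosed_tsupport ψ)
  by_contra hn
  refine hx ?_
  have h1 : x ∉ tsupport (deriv (deriv ψ)) := fun h =>
    hn (tsupport_deriv_subset (tsupport_deriv_subset h))
  rw [slFun, image_eq_zero_of_notMem_tsupport hn, image_eq_zero_of_notMem_tsupport h1]
  simp

/-- The even extension of `q` need not be smooth at `0`, which is why the support must avoid the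
origin. -/
theorem IsTest.slFun (hq : ContDiffOn ℝ ∞ q (Ici 0)) {ψ : ℝ → ℂ} (h : IsTest ψ)
    (hs : tsupport ψ ⊆ Ioi 0) : IsTest (slFun q ψ) := by
  refine ⟨contDiff_iff_contDiffAt.2 fun x => ?_, h.compact.of_isClosed_subset
    (isClosed_tsupport _) tsupport_slFun_subset⟩
  by_cases hx : x ∈ tsupport ψ
  · have hx0 : 0 < x := hs hx
    have hqx : ContDiffAt ℝ ∞ (fun x => q |x|) x := by
      refine (hq.contDiffAt (Ici_mem_nhds hx0)).congr_of_eventuallyEq ?_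
      filter_upwards [Ioi_mem_nhds hx0] with t ht
      rw [abs_of_pos ht]
    exact h.deriv.deriv.smooth.contDiffAt.neg.add
      ((Complex.ofRealCLM.contDiff.contDiffAt.comp x hqx).mul h.smooth.contDiffAt)
  · have h0 : WaveSpectrum.slFun q ψ =ᶠ[𝓝 x] 0 :=
      notMem_tsupport_iff_eventuallyEq.1 fun h => hx (tsupport_slFun_subset h)
    exact (contDiffAt_const (c := (0 : ℂ))).congr_of_eventuallyEq h0

variable (hA : IsPositiveDefinite (slOp q))

theorem testL2_eq_friedrichsInv (hq : ContDiffOn ℝ ∞ q (Ici 0)) {ψ : ℝ → ℂ} (h : IsTest ψ)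
    (hs : tsupport ψ ⊆ Ioi 0) :
    testL2 h = friedrichsInv (slOp q) hA (testL2 (h.slFun hq hs)) := by
  have hn : (0 : ℝ) ∉ tsupport ψ := fun h => lt_irrefl (0 : ℝ) (hs h)
  have hm := test_mem_slGraph hq.continuousOn h (image_eq_zero_of_notMem_tsupport hn)
    (image_eq_zero_of_notMem_tsupport fun h => hn (tsupport_deriv_subset h))
  rw [← slOp_graph] at hm
  exact (friedrichsInv_apply_of_mem_graph (slOp_dense hq.continuousOn) hA hm).symm

variable {hA} {φ : L2Half}

theorem greenVec₂_zero (hq : ContinuousOn q (Ici 0)) : greenVec₂ hA hq φ 0 = 0 := by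
  have := greenVec₂_neg (hA := hA) hq (φ := φ) 0
  rw [neg_zero] at this
  rw [eq_neg_iff_add_eq_zero, ← two_smul ℂ] at this
  exact (smul_eq_zero.1 this).resolve_left two_ne_zero

theorem continuous_inner_greenVec₂ (hq : ContinuousOn q (Ici 0)) (g : L2Half) :
    Continuous fun x => ⟪g, greenVec₂ hA hq φ x⟫_ℂ :=
  continuous_const.inner (continuous_greenVec₂ hq)

/-- Pointwise zeros of a continuous representative from almost everywhere zeros. -/
theorem inner_greenVec₂_eq_zero (hφ : IsKernelVector hA φ) (hq : ContinuousOn q (Ici 0))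
    {g : L2Half} {E : Set ℝ} (hE : IsOpen E) (hE0 : E ⊆ Ioi 0)
    (h : friedrichsInv (slOp q) hA (friedrichsInv (slOp q) hA g) ∈ L2On Eᶜ) {x : ℝ} (hx : x ∈ E) :
    ⟪g, greenVec₂ hA hq φ x⟫_ℂ = 0 := by
  have h1 : (fun x => ⟪g, greenVec₂ hA hq φ x⟫_ℂ) =ᵐ[volume.restrict E] 0 := by
    have h2 := friedrichsInv_sq_ae_eq hq hφ g
    filter_upwards [ae_restrict_of_ae_restrict_of_subset hE0 (mem_L2On.1 h),
      ae_restrict_of_ae_restrict_of_subset hE0 h2, ae_restrict_mem hE.measurableSet] with s h3 h4 h5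
    rw [h3 (not_not.2 h5)] at h4
    exact (map_eq_zero _).1 h4.symm
  have := Measure.eqOn_open_of_ae_eq h1 hE (continuous_inner_greenVec₂ hq g).continuousOn
    continuousOn_const
  exact this hx

/-- Since the test function is `L⁻³ z`, its evolution is `L⁻² (L⁻¹ S(s) z)`. Up to conjugation this
is a classical wave with zero initial value and the odd extension of the conjugate of `ψ` as initial
velocity. At a point `x₀` far from `U` the backward triangle misses the support. -/
theorem sinOp_test_mem (hφ : IsKernelVector hA φ) (hq : ContDiffOn ℝ ∞ q (Ici 0)) {U : Set ℝ}
    (hU : IsOpen U) (hU0 : U ⊆ Ioi 0) {ψ : ℝ → ℂ} (h : IsTest ψ) (hs : tsupport ψ ⊆ U) {s : ℝ}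
    (hs0 : 0 < s) :
    sinOp (friedrichsInv (slOp q) hA) s (testL2 h) ∈ L2On (Metric.thickening s U) := by
  have hd := slOp_dense hq.continuousOn
  have hB := friedrichsInv_isPositive hd hA
  set B := friedrichsInv (slOp q) hA with hBdef
  have s1 := hs.trans hU0
  have s2 := tsupport_slFun_subset (q := q).trans s1
  have s3 := tsupport_slFun_subset (q := q).trans s2
  set z := testL2 (((h.slFun hq s1).slFun hq s2).slFun hq s3) with hz
  have hy : testL2 h = B (B (B z)) := by
    rw [testL2_eq_friedrichsInv hA hq h s1, testL2_eq_friedrichsInv hA hq _ s2,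
      testL2_eq_friedrichsInv hA hq _ s3]
  have hw := isWave_inner hq.continuousOn hφ (G := fun s => B (sinOp B s z))
    (G₁ := fun s => cosOp B s z) (G₂ := fun s => -sinOp B s z)
    (hasDerivAt_comp_sinOp_apply hB z) (hasDerivAt_cosOp_apply z) (fun s => by rw [map_neg])
  have ha : ∀ x, 0 ≤ x → ⟪B z, greenVec₂ hA hq.continuousOn φ x⟫_ℂ = starRingEnd ℂ (ψ x) := by
    have h1 : (fun x => ⟪B z, greenVec₂ hA hq.continuousOn φ x⟫_ℂ) =ᵐ[halfLine]
        fun x => starRingEnd ℂ (ψ x) := by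
      filter_upwards [friedrichsInv_sq_ae_eq hq.continuousOn hφ (B z), testL2_coeFn h] with x h2 h3
      rw [← h3, hy, h2, Complex.conj_conj]
    have h2 := Measure.eqOn_open_of_ae_eq h1 isOpen_Ioi
      (continuous_inner_greenVec₂ hq.continuousOn _).continuousOn
      (Complex.continuous_conj.comp h.continuous).continuousOn
    intro x hx
    rcases hx.eq_or_lt with rfl | hx
    · have hn : (0 : ℝ) ∉ tsupport ψ := fun h => lt_irrefl (0 : ℝ) (s1 h)
      rw [greenVec₂_zero, inner_zero_right, image_eq_zero_of_notMem_tsupport hn, map_zero]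
    · exact h2 hx
  have hval : sinOp B s (testL2 h) = B (B (B (sinOp B s z))) := by
    rw [hy, sinOp_comm_apply hB, sinOp_comm_apply hB, sinOp_comm_apply hB]
  rw [hval, mem_L2On]
  filter_upwards [friedrichsInv_sq_ae_eq hq.continuousOn hφ (B (sinOp B s z)),
    ae_restrict_mem measurableSet_Ioi] with x₀ hx₀ hx0 hnot
  rw [hx₀, map_eq_zero]
  have hfar : ∀ u ∈ U, s ≤ |u - x₀| := fun u hu => by
    by_contra! hc
    exact hnot (Metric.mem_thickening_iff.2 ⟨u, hu, by rwa [Real.dist_eq, abs_sub_comm]⟩)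
  -- Uniqueness needs strict room. The support point nearest to `x₀` is interior to `U`, so `U`
  -- contains points still closer to `x₀`, and these are already at distance at least `s`.
  obtain ⟨r, hr, hr'⟩ : ∃ r, s < r ∧ ∀ u ∈ tsupport ψ, r ≤ |u - x₀| := by
    rcases (tsupport ψ).eq_empty_or_nonempty with he | hne
    · exact ⟨s + 1, by linarith, by simp [he]⟩
    · obtain ⟨u, hu, hmin⟩ := h.compact.isCompact.exists_isMinOn hne
        (f := fun u => |u - x₀|) (by fun_prop)
      refine ⟨|u - x₀|, ?_, fun v hv => hmin hv⟩
      obtain ⟨ε, hε, hball⟩ := Metric.isOpen_iff.1 hU u (hs hu)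
      by_contra! hc
      have hux : 0 < |u - x₀| := hs0.trans_le (hfar u (hs hu))
      rcases abs_cases (u - x₀) with ⟨h1, h2⟩ | ⟨h1, h2⟩
      · have h3 := hfar (u - min (ε / 2) (u - x₀)) (hball ?_)
        · have : 0 < min (ε / 2) (u - x₀) := lt_min (by linarith) (by linarith)
          have h4 := min_le_right (ε / 2) (u - x₀)
          rw [abs_of_nonneg (by linarith)] at h3
          linarith
        · have : 0 < min (ε / 2) (u - x₀) := lt_min (by linarith) (by linarith)
          have h4 := min_le_left (ε / 2) (u - x₀)
          rw [Metric.mem_ball, Real.dist_eq, abs_lt]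
          constructor <;> linarith
      · have h3 := hfar (u + min (ε / 2) (x₀ - u)) (hball ?_)
        · have : 0 < min (ε / 2) (x₀ - u) := lt_min (by linarith) (by linarith)
          have h4 := min_le_right (ε / 2) (x₀ - u)
          rw [abs_of_nonpos (by linarith)] at h3
          linarith
        · have : 0 < min (ε / 2) (x₀ - u) := lt_min (by linarith) (by linarith)
          have h4 := min_le_left (ε / 2) (x₀ - u)
          rw [Metric.mem_ball, Real.dist_eq, abs_lt]
          constructor <;> linarith
  refine hw.eq_zero_of_initial (s₀ := 0) (x₀ := x₀) (r := r) (fun x hx => ⟨?_, ?_⟩) hs0.le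
    (by simpa using hr)
  · simp [sinOp_zero]
  · have hx0' : (0 : ℝ) < x₀ := hx0
    have h0 : ψ |x| = 0 := by
      refine image_eq_zero_of_notMem_tsupport fun hm => ?_
      have h1 := hr' _ hm
      -- The triangle may reach negative `x`. As `x₀ > 0`, the mirror point `|x|` is no farther from
      -- `x₀` than `x` is.
      have h2 := abs_abs_sub_abs_le x x₀
      rw [abs_of_pos hx0'] at h2
      linarith
    rw [cosOp_zero hB]
    rcases le_total 0 x with hx1 | hx1
    · rw [ha x hx1, ← abs_of_nonneg hx1, h0, map_zero]
    · have h2 := ha (-x) (by linarith)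
      rw [greenVec₂_neg, inner_neg_right, ← abs_of_nonpos hx1, h0, map_zero, neg_eq_zero] at h2
      exact h2

/-- Finite speed of propagation. -/
theorem sinOp_mem_thickening (hφ : IsKernelVector hA φ) (hq : ContDiffOn ℝ ∞ q (Ici 0)) {U : Set ℝ}
    (hU : IsOpen U) (hU0 : U ⊆ Ioi 0) {y : L2Half} (hy : y ∈ L2On U) (s : ℝ) :
    sinOp (friedrichsInv (slOp q) hA) s y ∈ L2On (Metric.thickening |s| U) := by
  have hpos : ∀ s, 0 < s →
      sinOp (friedrichsInv (slOp q) hA) s y ∈ L2On (Metric.thickening s U) := by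
    intro s hs
    -- Duality: the propagator is self-adjoint, so it suffices to propagate test functions supported
    -- in `U`.
    rw [mem_iff_inner_orthogonal]
    intro z hz
    rw [← inner_sinOp]
    refine inner_eq_zero_of_mem_compl (E := U) ?_ hy
    have := ae_eq_zero_of_inner_test hU (y := sinOp (friedrichsInv (slOp q) hA) s z)
      fun ψ hψ hsψ => by
        rw [← inner_sinOp]
        exact (ClosedSubmodule.mem_orthogonal _ _).1 hz _ (sinOp_test_mem hφ hq hU hU0 hψ hsψ hs)
    filter_upwards [this] with x h1 h2
    exact h1 (not_not.1 h2)
  rcases lt_trichotomy s 0 with hs | rfl | hs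
  · have := hpos (-s) (by linarith)
    rw [sinOp_neg] at this
    rw [abs_of_neg hs]
    simpa using SMulMemClass.smul_mem (-1 : ℂ) this
  · rw [sinOp_zero]
    exact zero_mem _
  · rw [abs_of_pos hs]
    exact hpos s hs

end FiniteSpeed

/-- Real-valued test functions. -/
structure IsRealTest (ρ : ℝ → ℝ) : Prop where
  smooth : ContDiff ℝ ∞ ρ
  compact : HasCompactSupport ρ

theorem IsRealTest.deriv {ρ : ℝ → ℝ} (h : IsRealTest ρ) : IsRealTest (deriv ρ) :=
  ⟨(contDiff_infty_iff_deriv.1 h.smooth).2, h.compact.deriv⟩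

theorem IsRealTest.hasDerivAt {ρ : ℝ → ℝ} (h : IsRealTest ρ) (r : ℝ) :
    HasDerivAt ρ (_root_.deriv ρ r) r :=
  (h.smooth.differentiable (by simp) r).hasDerivAt

/-! ### Mollification in time. -/

section Mollification

variable {F : Type*} [NormedAddCommGroup F] [NormedSpace ℝ F]

/-- The convolution `ρ ⋆ K`. -/
def mollify (ρ : ℝ → ℝ) (K : ℝ → F) (s : ℝ) : F := ∫ r, ρ r • K (s - r)

variable {ρ : ℝ → ℝ} {K K' : ℝ → F}

theorem mollify_eq_convolution :
    mollify ρ K = convolution ρ K (ContinuousLinearMap.lsmul ℝ ℝ) volume := rfl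

theorem integrable_mollify (hρ : IsRealTest ρ) (hK : Continuous K) (s : ℝ) :
    Integrable fun r => ρ r • K (s - r) := by
  have hρc := hρ.smooth.continuous
  exact Continuous.integrable_of_hasCompactSupport (by fun_prop) hρ.compact.smul_right

theorem hasDerivAt_mollify (hρ : IsRealTest ρ) (hK : Continuous K) (s : ℝ) :
    HasDerivAt (mollify ρ K) (mollify (deriv ρ) K s) s := by
  rw [mollify_eq_convolution, mollify_eq_convolution]
  exact hρ.compact.hasDerivAt_convolution_left _ (contDiff_infty.1 hρ.smooth 1)
    hK.locallyIntegrable s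

/-- Integration by parts over the whole line; compact support of `ρ` removes the boundary terms. -/
theorem mollify_deriv (hρ : IsRealTest ρ) (hK : ∀ s, HasDerivAt K (K' s) s) (hK' : Continuous K')
    (s : ℝ) : mollify (deriv ρ) K s = mollify ρ K' s := by
  have hc : Continuous K := continuous_iff_continuousAt.2 fun s => (hK s).continuousAt
  have hd : ∀ r, HasDerivAt (fun r => ρ r • K (s - r))
      (deriv ρ r • K (s - r) - ρ r • K' (s - r)) r := fun r => by
    have h1 : HasDerivAt (fun r => K (s - r)) (-K' (s - r)) r := by
      simpa [Function.comp_def] using (hK (s - r)).scomp r ((hasDerivAt_id r).const_sub s)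
    refine ((hρ.hasDerivAt r).smul h1).congr_deriv ?_
    rw [smul_neg]
    abel
  have i1 := integrable_mollify hρ.deriv hc s
  have i2 := integrable_mollify hρ hK' s
  have := integral_eq_zero_of_hasDerivAt_of_integrable hd (i1.sub i2) (integrable_mollify hρ hc s)
  rw [integral_sub i1 i2, sub_eq_zero] at this
  exact this

end Mollification

/-! ### Mollified propagators. -/

section MollifiedWave

variable {H : Type*} [NormedAddCommGroup H] [InnerProductSpace ℂ H] [CompleteSpace H]

theorem map_mollify {ρ : ℝ → ℝ} {K : ℝ → H} (hρ : IsRealTest ρ) (hK : Continuous K)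
    (B : H →L[ℂ] H) (s : ℝ) : B (mollify ρ K s) = mollify ρ (fun s => B (K s)) s := by
  rw [mollify, ← B.integral_comp_comm (integrable_mollify hρ hK s), mollify]
  refine integral_congr_ae (Eventually.of_forall fun r => ?_)
  exact (B.restrictScalars ℝ).map_smul (ρ r) (K (s - r))

theorem inner_mollify {ρ : ℝ → ℝ} {K : ℝ → H} (hρ : IsRealTest ρ) (hK : Continuous K) (z : H)
    (s : ℝ) : ⟪z, mollify ρ K s⟫_ℂ = mollify ρ (fun s => ⟪z, K s⟫_ℂ) s := by
  rw [mollify, ← integral_inner (integrable_mollify hρ hK s), mollify]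
  refine integral_congr_ae (Eventually.of_forall fun r => ?_)
  exact ((innerSL ℂ z).restrictScalars ℝ).map_smul (ρ r) (K (s - r))

theorem mollify_mem {ρ : ℝ → ℝ} {K : ℝ → H} (M : ClosedSubmodule ℂ H) {s : ℝ}
    (h : ∀ r ∈ tsupport ρ, K (s - r) ∈ M) : mollify ρ K s ∈ M := by
  refine integral_mem_closedSubmodule M (Eventually.of_forall fun r => ?_)
  by_cases hr : r ∈ tsupport ρ
  · exact M.smul_mem' (ρ r : ℂ) (h r hr)
  · rw [image_eq_zero_of_notMem_tsupport hr, zero_smul]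
    exact zero_mem _

theorem continuous_sinOp_apply (B : H →L[ℂ] H) (y : H) : Continuous fun s => sinOp B s y :=
  continuous_sinOp.clm_apply continuous_const

variable {B : H →L[ℂ] H}

/-- This is `L⁻¹ S'' = -S` in integrated form. The derivatives sit on `ρ` because `s ↦ S(s) y` need
not be twice differentiable for a general `y`. -/
theorem map_mollify_sinOp (hB : B.IsPositive) {ρ : ℝ → ℝ} (hρ : IsRealTest ρ) (y : H) (s : ℝ) :
    B (mollify (deriv (deriv ρ)) (fun s => sinOp B s y) s) =
      -mollify ρ (fun s => sinOp B s y) s := by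
  have hc := continuous_sinOp_apply B y
  have hc' : Continuous fun s => cosOp B s y :=
    continuous_iff_continuousAt.2 fun s => (hasDerivAt_cosOp_apply y s).continuousAt
  rw [map_mollify hρ.deriv.deriv hc, mollify_deriv hρ.deriv (hasDerivAt_comp_sinOp_apply hB y) hc',
    mollify_deriv hρ (hasDerivAt_cosOp_apply y) hc.neg, mollify, mollify, ← integral_neg]
  simp only [smul_neg]

end MollifiedWave

/-! ### Unique continuation from interior sets and from the boundary point. -/

section UniqueContinuation

variable {q : ℝ → ℝ} {hA : IsPositiveDefinite (slOp q)} {φ : L2Half}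

/-- Four derivatives on `ρ` are compensated by the two factors `L⁻¹` in `greenVec₂`, so the
classical wave represents the plain mollification of `S(s) y` (`friedrichsInv_sq_mollify`). -/
theorem isWave_mollify (hφ : IsKernelVector hA φ) (hq : ContinuousOn q (Ici 0)) {ρ : ℝ → ℝ}
    (hρ : IsRealTest ρ) (y : L2Half) {G : ℝ → L2Half}
    (hG : G = mollify (deriv (deriv (deriv (deriv ρ))))
      fun s => sinOp (friedrichsInv (slOp q) hA) s y) :
    ∃ a, IsWave (fun _ x => -((q |x| : ℝ) : ℂ)) (fun s x => ⟪G s, greenVec₂ hA hq φ x⟫_ℂ) a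
      (fun s x => ⟪G s, greenVec₂Deriv hA hq φ x⟫_ℂ) := by
  subst hG
  have hc := continuous_sinOp_apply (friedrichsInv (slOp q) hA) y
  exact ⟨_, isWave_inner hq hφ (hasDerivAt_mollify hρ.deriv.deriv.deriv.deriv hc)
    (hasDerivAt_mollify hρ.deriv.deriv.deriv.deriv.deriv hc)
    (map_mollify_sinOp (friedrichsInv_isPositive (slOp_dense hq) hA) hρ.deriv.deriv.deriv.deriv y)⟩

theorem friedrichsInv_mollify (hq : ContinuousOn q (Ici 0)) {ρ : ℝ → ℝ} (hρ : IsRealTest ρ)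
    (y : L2Half) (s : ℝ) :
    friedrichsInv (slOp q) hA (mollify (deriv (deriv ρ))
      (fun s => sinOp (friedrichsInv (slOp q) hA) s y) s) =
      -mollify ρ (fun s => sinOp (friedrichsInv (slOp q) hA) s y) s :=
  map_mollify_sinOp (friedrichsInv_isPositive (slOp_dense hq) hA) hρ y s

theorem L2Half.inner_mollify {ρ : ℝ → ℝ} {K : ℝ → L2Half} (hρ : IsRealTest ρ) (hK : Continuous K)
    (z : L2Half) (s : ℝ) : ⟪z, mollify ρ K s⟫_ℂ = mollify ρ (fun s => ⟪z, K s⟫_ℂ) s :=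
  WaveSpectrum.inner_mollify hρ hK z s

theorem friedrichsInv_sq_mollify (hq : ContinuousOn q (Ici 0)) {ρ : ℝ → ℝ} (hρ : IsRealTest ρ)
    (y : L2Half) (s : ℝ) :
    friedrichsInv (slOp q) hA (friedrichsInv (slOp q) hA (mollify (deriv (deriv (deriv (deriv ρ))))
      (fun s => sinOp (friedrichsInv (slOp q) hA) s y) s)) =
      mollify ρ (fun s => sinOp (friedrichsInv (slOp q) hA) s y) s := by
  rw [friedrichsInv_mollify hq hρ.deriv.deriv, map_neg, friedrichsInv_mollify hq hρ, neg_neg]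

/-- If the lateral data at `x₀` of all mollifications of `s ↦ S(s) y` vanish, then `y` vanishes
near `x₀`. -/
theorem mem_compl_ball_of_lateral (hφ : IsKernelVector hA φ) (hq : ContinuousOn q (Ici 0))
    {y : L2Half} {x₀ T : ℝ}
    (hlat : ∀ (ε : ℝ) (ρ : ℝ → ℝ), 0 < ε → IsRealTest ρ → (∀ r ∈ tsupport ρ, |r| ≤ ε) →
      ∀ s, |s| + ε < T → ∀ G, G = mollify (deriv (deriv (deriv (deriv ρ))))
        (fun s => sinOp (friedrichsInv (slOp q) hA) s y) s →
      ⟪G, greenVec₂ hA hq φ x₀⟫_ℂ = 0 ∧ ⟪G, greenVec₂Deriv hA hq φ x₀⟫_ℂ = 0) :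
    y ∈ L2On (Metric.ball x₀ T)ᶜ := by
  refine mem_L2On_compl_of_locally fun x hx => ?_
  obtain ⟨T', hT', hTT⟩ := exists_between (Metric.mem_ball.1 hx)
  refine ⟨Metric.ball x₀ T', Metric.isOpen_ball.mem_nhds hT', ?_⟩
  -- The room `T - T'` is shared by the mollifier radius and the time: `|x - x₀| < T'` and `|t| < δ`
  -- give `|x - x₀| + |t| < T - δ`.
  set δ := (T - T') / 2 with hδ
  have hδ0 : 0 < δ := by linarith
  set M := L2On (Metric.ball x₀ T')ᶜ with hM
  have hc := continuous_sinOp_apply (friedrichsInv (slOp q) hA) y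
  have step1 : ∀ ρ : ℝ → ℝ, IsRealTest ρ → (∀ r ∈ tsupport ρ, |r| ≤ δ) → ∀ t, |t| < δ →
      mollify ρ (fun s => sinOp (friedrichsInv (slOp q) hA) s y) t ∈ M := by
    intro ρ hρ hs t ht
    obtain ⟨a, hw⟩ := isWave_mollify hφ hq hρ y rfl
    rw [← friedrichsInv_sq_mollify hq hρ]
    filter_upwards [friedrichsInv_sq_ae_eq hq hφ (mollify (deriv (deriv (deriv (deriv ρ))))
      (fun s => sinOp (friedrichsInv (slOp q) hA) s y) t)] with x h1 h2
    rw [h1, map_eq_zero]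
    have hx : |x - x₀| < T' := not_not.1 h2
    refine hw.eq_zero_of_lateral (s₀ := 0) (x₀ := x₀) (r := T - δ)
      (fun s hs' => hlat δ ρ hδ0 hρ hs s (by rw [sub_zero] at hs'; linarith) _ rfl) ?_
    rw [sub_zero]
    linarith
  -- The mollifier is shrunk to a point mass; the subspace `M` is closed.
  have step2 : ∀ t, |t| < δ → sinOp (friedrichsInv (slOp q) hA) t y ∈ M := by
    intro t ht
    have hpos : ∀ n : ℕ, (0 : ℝ) < 1 / ((n : ℝ) + 1) := fun n => by positivity
    let b : ℕ → ContDiffBump (0 : ℝ) := fun n =>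
      ⟨1 / ((n : ℝ) + 1) / 2, 1 / ((n : ℝ) + 1), half_pos (hpos n), half_lt_self (hpos n)⟩
    have hb : Tendsto (fun n => (b n).rOut) atTop (𝓝 0) := tendsto_one_div_add_atTop_nhds_zero_nat
    refine M.isClosed.mem_of_tendsto
      (ContDiffBump.convolution_tendsto_right_of_continuous (μ := volume) hb hc t) ?_
    filter_upwards [hb.eventually (gt_mem_nhds hδ0)] with n hn
    refine step1 _ ⟨(b n).contDiff_normed, (b n).hasCompactSupport_normed⟩ (fun r hr => ?_) t ht
    rw [ContDiffBump.tsupport_normed_eq] at hr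
    have := Metric.mem_closedBall.1 hr
    rw [Real.dist_eq, sub_zero] at this
    exact this.trans hn.le
  have hd := slOp_dense hq
  -- `y` is recovered as the strong derivative of `S(t) y` at `t = 0`.
  refine M.isClosed.mem_of_tendsto (tendsto_inv_smul_sinOp (friedrichsInv_isPositive hd hA)
    (friedrichsInv_denseRange hd hA) y) ?_
  have hnear : ∀ᶠ t : ℝ in 𝓝[≠] 0, |t| < δ := by
    refine eventually_nhdsWithin_of_eventually_nhds ?_
    filter_upwards [Metric.ball_mem_nhds (0 : ℝ) hδ0] with t ht
    simpa using ht
  filter_upwards [hnear] with t ht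
  exact M.smul_mem' ((t⁻¹ : ℝ) : ℂ) (step2 t ht)

/-- Unique continuation from an open set. -/
theorem mem_compl_thickening_of_sinOp (hφ : IsKernelVector hA φ) (hq : ContinuousOn q (Ici 0))
    {E : Set ℝ} (hE : IsOpen E) (hE0 : E ⊆ Ioi 0) {y : L2Half} {T : ℝ}
    (h : ∀ s, |s| < T → sinOp (friedrichsInv (slOp q) hA) s y ∈ L2On Eᶜ) :
    y ∈ L2On (Metric.thickening T E)ᶜ := by
  refine mem_L2On_compl_of_locally fun x hx => ?_
  obtain ⟨x₀, hx₀, hxx⟩ := Metric.mem_thickening_iff.1 hx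
  refine ⟨Metric.ball x₀ T, Metric.isOpen_ball.mem_nhds hxx, ?_⟩
  refine mem_compl_ball_of_lateral hφ hq fun ε ρ hε hρ hs s hsT G hG => ?_
  have hz : ∀ x ∈ E, ⟪G, greenVec₂ hA hq φ x⟫_ℂ = 0 := fun x hx => by
    refine inner_greenVec₂_eq_zero hφ hq hE hE0 ?_ hx
    rw [hG, friedrichsInv_sq_mollify hq hρ]
    refine mollify_mem _ fun r hr => h _ ?_
    have := abs_sub s r
    linarith [hs r hr]
  refine ⟨hz x₀ hx₀, ?_⟩
  have h1 : HasDerivAt (fun x => ⟪G, greenVec₂ hA hq φ x⟫_ℂ) ⟪G, greenVec₂Deriv hA hq φ x₀⟫_ℂ x₀ := by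
    simpa using (hasDerivAt_const x₀ G).inner ℂ (hasDerivAt_greenVec₂ hq hφ x₀)
  refine h1.unique ((hasDerivAt_const x₀ (0 : ℂ)).congr_of_eventuallyEq ?_)
  filter_upwards [hE.mem_nhds hx₀] with x hx
  exact hz x hx

/-- Unique continuation from the boundary point. -/
theorem mem_compl_ball_of_inner_sinOp (hφ : IsKernelVector hA φ) (hq : ContinuousOn q (Ici 0))
    {y : L2Half} {T : ℝ} (h : ∀ s, 0 ≤ s → s ≤ T →
      ⟪φ, sinOp (friedrichsInv (slOp q) hA) s y⟫_ℂ = s * ⟪φ, y⟫_ℂ) :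
    y ∈ L2On (Metric.ball 0 T)ᶜ := by
  have hd := slOp_dense hq
  have h' : ∀ s, |s| ≤ T → ⟪φ, sinOp (friedrichsInv (slOp q) hA) s y⟫_ℂ = s * ⟪φ, y⟫_ℂ := by
    intro s hs
    rcases le_total 0 s with h0 | h0
    · exact h s h0 ((le_abs_self s).trans hs)
    · have := h (-s) (by linarith) ((neg_le_abs s).trans hs)
      rw [sinOp_neg, neg_apply, inner_neg_right] at this
      rw [← neg_inj, this]
      push_cast
      ring
  have hc := continuous_sinOp_apply (friedrichsInv (slOp q) hA) y
  refine mem_compl_ball_of_lateral hφ hq fun ε ρ hε hρ hs s hsT G hG => ?_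
  refine ⟨by rw [greenVec₂_zero, inner_zero_right], ?_⟩
  -- At `x = 0` the slope vector is `L⁻¹ φ`. Up to sign and conjugation the datum is therefore the
  -- convolution of `ρ''` with the boundary trace, which is linear on the range used, and
  -- convolution with `ρ''` annihilates linear functions.
  rw [greenVec₂Deriv, intervalIntegral.integral_same, add_zero, ← friedrichsInv_symm hd hA, hG,
    friedrichsInv_mollify hq hρ.deriv.deriv, ← inner_conj_symm,
    inner_neg_right, L2Half.inner_mollify hρ.deriv.deriv hc]
  have e : mollify (deriv (deriv ρ))
      (fun s => ⟪φ, sinOp (friedrichsInv (slOp q) hA) s y⟫_ℂ) s =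
      mollify (deriv (deriv ρ)) (fun s : ℝ => (s : ℂ) * ⟪φ, y⟫_ℂ) s := by
    refine integral_congr_ae (Eventually.of_forall fun r => ?_)
    by_cases hr : r ∈ tsupport ρ
    · have := abs_sub s r
      simp only
      rw [h' (s - r) (by linarith [hs r hr])]
    · have : r ∉ tsupport (deriv (deriv ρ)) := fun hm =>
        hr (tsupport_deriv_subset (tsupport_deriv_subset hm))
      simp only [image_eq_zero_of_notMem_tsupport this, zero_smul]
  have d1 : ∀ s : ℝ, HasDerivAt (fun s : ℝ => (s : ℂ) * ⟪φ, y⟫_ℂ) ⟪φ, y⟫_ℂ s := fun s => by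
    simpa using (hasDerivAt_id s).ofReal_comp.mul_const ⟪φ, y⟫_ℂ
  rw [e, mollify_deriv hρ.deriv d1 continuous_const,
    mollify_deriv hρ (fun s => hasDerivAt_const s _) continuous_const]
  simp [mollify]

end UniqueContinuation

/-! ### The wave isotony as a metric neighbourhood. -/

section Isotony

theorem memLp_two_of_continuous {F : Type*} [NormedAddCommGroup F] {g : ℝ → F} (hg : Continuous g) (R : ℝ) :
    MemLp g 2 (volume.restrict (Ioc 0 R)) := by
  obtain ⟨C, hC⟩ := isCompact_Icc.exists_bound_of_continuousOn (s := Icc 0 R) hg.continuousOn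
  refine MemLp.of_bound hg.aestronglyMeasurable C ?_
  filter_upwards [ae_restrict_mem measurableSet_Ioc] with s hs
  exact hC s (Ioc_subset_Icc_self hs)

variable {H : Type*} [NormedAddCommGroup H] [InnerProductSpace ℂ H] [CompleteSpace H]

variable {A : H →ₗ.[ℂ] H} {hA : IsPositiveDefinite A}

theorem eq_zero_of_intervalIntegral_norm_sq {c : ℝ → ℂ} (hc : Continuous c) {t : ℝ} (ht : 0 < t)
    (h : ∫ s in (0 : ℝ)..t, ‖c s‖ ^ 2 = 0) {s : ℝ} (hs : s ∈ Icc 0 t) : c s = 0 := by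
  by_contra hn
  have := intervalIntegral.integral_pos ht (f := fun s => ‖c s‖ ^ 2) (by fun_prop)
    (fun s _ => by positivity) ⟨s, hs, by positivity⟩
  exact this.ne' h

theorem waveIsotony_le {t : ℝ≥0} (ht : 0 < t) {G M : ClosedSubmodule ℂ H}
    (h : ∀ s ∈ Icc (0 : ℝ) t, ∀ w ∈ G, sinOp (friedrichsInv A hA) s w ∈ M) :
    waveIsotony A hA t G ≤ M := by
  rw [waveIsotony, if_neg ht.ne', Submodule.closure_le, Submodule.span_le]
  rintro y ⟨g, -, hg, rfl⟩
  rw [intervalIntegral.integral_of_le t.coe_nonneg]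
  change _ ∈ M
  refine integral_mem_closedSubmodule M ?_
  filter_upwards [ae_restrict_mem measurableSet_Ioc] with s hs
  exact h (t - s) ⟨by linarith [hs.2], by linarith [hs.1]⟩ _ (hg s)

/-- With `c r` the pairing of `z` with `S(t - r) w`, the source `g r = conj (c r) • w` produces a
state whose pairing with `z` is `∫ ‖c‖²`. This vanishes, and `c` is continuous. -/
theorem inner_sinOp_eq_zero_of_mem_orthogonal {t : ℝ≥0} (ht : 0 < t) {G : ClosedSubmodule ℂ H}
    {z w : H} (hz : z ∈ (waveIsotony A hA t G)ᗮ) (hw : w ∈ G) {s : ℝ} (hs : |s| ≤ t) :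
    ⟪w, sinOp (friedrichsInv A hA) s z⟫_ℂ = 0 := by
  set B := friedrichsInv A hA
  have ht' : (0 : ℝ) < t := ht
  have hpos : ∀ s ∈ Icc (0 : ℝ) t, ⟪w, sinOp B s z⟫_ℂ = 0 := by
    intro s hs
    set c : ℝ → ℂ := fun r => ⟪z, sinOp B (t - r) w⟫_ℂ with hcdef
    have hS : Continuous fun r : ℝ => sinOp B (t - r) w :=
      (continuous_sinOp_apply B w).comp (continuous_const.sub continuous_id)
    have hc : Continuous c := continuous_const.inner hS
    set g : ℝ → H := fun r => starRingEnd ℂ (c r) • w with hg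
    have hgc : Continuous g := (Complex.continuous_conj.comp hc).smul continuous_const
    have hmem : (∫ r in (0 : ℝ)..t, sineOp A hA (t - r) (g r)) ∈ waveIsotony A hA t G := by
      rw [waveIsotony, if_neg ht.ne', Submodule.mem_closure_iff]
      refine Submodule.le_topologicalClosure _ (Submodule.subset_span ?_)
      exact ⟨g, memLp_two_of_continuous hgc, fun r => G.smul_mem' _ hw, rfl⟩
    have h0 := (ClosedSubmodule.mem_orthogonal' _ _).1 hz _ hmem
    have hcont : Continuous fun r : ℝ => sineOp A hA (t - r) (g r) := by
      have h1 : Continuous fun r : ℝ => sineOp A hA (t - r) :=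
        (continuous_sinOp (B := B)).comp (continuous_const.sub continuous_id)
      exact h1.clm_apply hgc
    have hint := (innerSL ℂ z).intervalIntegral_comp_comm
      (hcont.intervalIntegrable (μ := volume) 0 t)
    simp only [innerSL_apply_apply] at hint
    rw [h0] at hint
    have hval : ∀ r : ℝ, ⟪z, sineOp A hA (t - r) (g r)⟫_ℂ = ((‖c r‖ ^ 2 : ℝ) : ℂ) := fun r => by
      rw [hg]
      simp only
      rw [map_smul, inner_smul_right]
      exact (Complex.conj_mul' (c r)).trans (by push_cast; rfl)
    simp only [hval] at hint
    rw [intervalIntegral.integral_ofReal, Complex.ofReal_eq_zero] at hint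
    have := eq_zero_of_intervalIntegral_norm_sq hc ht' hint (s := t - s)
      ⟨by linarith [hs.2], by linarith [hs.1]⟩
    rw [hcdef] at this
    simp only [sub_sub_cancel] at this
    rw [← inner_sinOp, ← inner_conj_symm, this, map_zero]
  rcases le_total 0 s with h | h
  · exact hpos s ⟨h, (le_abs_self s).trans hs⟩
  · have := hpos (-s) ⟨by linarith, (neg_le_abs s).trans hs⟩
    rwa [sinOp_neg, neg_apply, inner_neg_right, neg_eq_zero] at this

variable {q : ℝ → ℝ} {hA : IsPositiveDefinite (slOp q)} {φ : L2Half}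

/-- The wave isotony acts on `L₂(E)` as the metric neighbourhood. -/
theorem waveIsotony_L2On (hφ : IsKernelVector hA φ) (hq : ContDiffOn ℝ ∞ q (Ici 0)) {E : Set ℝ}
    (hE : IsOpen E) (hE0 : E ⊆ Ioi 0) {t : ℝ≥0} (ht : 0 < t) :
    waveIsotony (slOp q) hA t (L2On E) = L2On (Metric.thickening t E) := by
  refine le_antisymm ?_ fun x hx => ?_
  · refine waveIsotony_le ht fun s hs w hw => ?_
    refine L2On_mono (Metric.thickening_mono ?_ E) (sinOp_mem_thickening hφ hq hE hE0 hw s)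
    rw [abs_of_nonneg hs.1]
    exact hs.2
  · rw [mem_iff_inner_orthogonal]
    intro z hz
    refine inner_eq_zero_of_mem_compl ?_ hx
    refine mem_compl_thickening_of_sinOp hφ hq.continuousOn hE hE0 fun s hs => ?_
    rw [← orthogonal_L2On hE.measurableSet, ClosedSubmodule.mem_orthogonal]
    exact fun w hw => inner_sinOp_eq_zero_of_mem_orthogonal ht hz hw hs.le

end Isotony

/-! ### Reachable states: orthogonality. -/

section ReachableNecessary

variable {H : Type*} [NormedAddCommGroup H]

theorem ContDiffOn.hasDerivWithinAt_Ici [NormedSpace ℝ H] {u : ℝ → H}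
    (hu : ContDiffOn ℝ ∞ u (Ici 0)) {t : ℝ}
    (ht : 0 ≤ t) : HasDerivWithinAt u (derivWithin u (Ici 0) t) (Ici 0) t :=
  ((hu.differentiableOn (by simp)) t ht).hasDerivWithinAt

theorem ContDiffOn.derivWithin_Ici [NormedSpace ℝ H] {u : ℝ → H} (hu : ContDiffOn ℝ ∞ u (Ici 0)) :
    ContDiffOn ℝ ∞ (derivWithin u (Ici 0)) (Ici 0) :=
  ((contDiffOn_infty_iff_derivWithin (uniqueDiffOn_Ici 0)).1 hu).2

variable [InnerProductSpace ℂ H]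

theorem map_derivWithin_Ici (B : H →L[ℂ] H) {f g g' : ℝ → H} (hf : ContDiffOn ℝ ∞ f (Ici 0))
    (hg : ∀ t, 0 ≤ t → HasDerivWithinAt g (g' t) (Ici 0) t) (h : ∀ t, 0 ≤ t → B (f t) = g t) {t : ℝ}
    (ht : 0 ≤ t) : B (derivWithin f (Ici 0) t) = g' t := by
  have h1 : HasDerivWithinAt (fun t => B (f t)) (B (derivWithin f (Ici 0) t)) (Ici 0) t :=
    (B.restrictScalars ℝ).hasFDerivAt.comp_hasDerivWithinAt t (ContDiffOn.hasDerivWithinAt_Ici hf ht)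
  refine UniqueDiffWithinAt.eq_deriv _ (uniqueDiffOn_Ici 0 t ht) h1 ((hg t ht).congr ?_ (h t ht))
  exact fun s hs => h s hs

theorem inner_derivWithin_Ici_eq_zero {f : ℝ → H} (hf : ContDiffOn ℝ ∞ f (Ici 0)) {z : H}
    (h : ∀ t, 0 ≤ t → ⟪z, f t⟫_ℂ = 0) {t : ℝ} (ht : 0 ≤ t) :
    ⟪z, derivWithin f (Ici 0) t⟫_ℂ = 0 := by
  have h1 : HasDerivWithinAt (fun t => ⟪z, f t⟫_ℂ) ⟪z, derivWithin f (Ici 0) t⟫_ℂ (Ici 0) t :=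
    ((innerSL ℂ z).restrictScalars ℝ).hasFDerivAt.comp_hasDerivWithinAt t
      (ContDiffOn.hasDerivWithinAt_Ici hf ht)
  exact UniqueDiffWithinAt.eq_deriv _ (uniqueDiffOn_Ici 0 t ht) h1
    ((hasDerivWithinAt_const t (Ici 0) (0 : ℂ)).congr (fun s hs => h s hs) (h t ht))

variable [CompleteSpace H] {A : H →ₗ.[ℂ] H} {hA : IsPositiveDefinite A}

/-- Applying `L⁻¹` to the equation and inserting the boundary condition leaves a relation with
bounded operators only. It extends by continuity to `t = 0`, where the equation itself is not
imposed. -/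
theorem IsSmoothWave.friedrichsInv_derivWithin {h u : ℝ → H} (hh : IsControl A h)
    (hu : IsSmoothWave A hA h u) {t : ℝ} (ht : 0 ≤ t) :
    friedrichsInv A hA (derivWithin (derivWithin u (Ici 0)) (Ici 0) t) = -(u t + h t) := by
  have c2 := (ContDiffOn.derivWithin_Ici (ContDiffOn.derivWithin_Ici hu.smooth)).continuousOn
  have hE : EqOn (fun t => friedrichsInv A hA (derivWithin (derivWithin u (Ici 0)) (Ici 0) t))
      (fun t => -(u t + h t)) (Ioi 0) := by
    intro t ht
    have ht0 : 0 < t := ht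
    have h1 := hu.equation t ht0
    have h2 := hu.boundary t ht0.le
    rw [iteratedDerivWithin_succ, iteratedDerivWithin_one, add_comm, add_eq_zero_iff_eq_neg] at h1
    have h3 : friedrichsInv A hA (A.adjoint ⟨u t, hu.mem_domain t ht0.le⟩) - u t = h t := h2
    rw [h1, map_neg] at h3
    change _ = -(u t + h t)
    rw [← h3]
    abel
  exact hE.of_subset_closure ((friedrichsInv A hA).continuous.comp_continuousOn c2)
    (hu.smooth.continuousOn.add hh.smooth.continuousOn).neg Ioi_subset_Ici_self
    (by rw [closure_Ioi]) ht

theorem IsControl.derivWithin_zero {h : ℝ → H} (hh : IsControl A h) :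
    h 0 = 0 ∧ derivWithin h (Ici 0) 0 = 0 := by
  obtain ⟨ε, hε, hv⟩ := hh.vanish
  refine ⟨hv 0 le_rfl hε.le, ?_⟩
  refine UniqueDiffWithinAt.eq_deriv _ (uniqueDiffOn_Ici 0 0 self_mem_Ici)
    (ContDiffOn.hasDerivWithinAt_Ici hh.smooth le_rfl)
    ((hasDerivWithinAt_const (0 : ℝ) (Ici 0) (0 : H)).congr_of_eventuallyEq ?_
      (hv 0 le_rfl hε.le))
  filter_upwards [inter_mem_nhdsWithin (Ici (0 : ℝ)) (Iio_mem_nhds hε)] with t ht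
  exact hv t ht.1 (le_of_lt ht.2)

/-- Reachable states are orthogonal to the vectors whose free evolution has trivial boundary
trace. -/
theorem IsSmoothWave.inner_eq_zero (hd : Dense (A.domain : Set H)) {h u : ℝ → H}
    (hh : IsControl A h) (hu : IsSmoothWave A hA h u) {T : ℝ} (hT : 0 ≤ T) {y : H}
    (hy : ∀ r, 0 ≤ r → r ≤ T → ∀ w, (w, (0 : H)) ∈ A.adjoint.graph →
      ⟪sinOp (friedrichsInv A hA) r y - (r : ℂ) • y, w⟫_ℂ = 0) : ⟪y, u T⟫_ℂ = 0 := by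
  set B := friedrichsInv A hA with hBdef
  have hB : B.IsPositive := friedrichsInv_isPositive hd hA
  have hinj : ∀ x, B x = 0 → x = 0 := fun x hx =>
    friedrichsInv_injective hd hA (hx.trans (map_zero B).symm)
  have su := hu.smooth
  have sh := hh.smooth
  set u₁ := derivWithin u (Ici 0) with hu₁
  have su₁ : ContDiffOn ℝ ∞ u₁ (Ici 0) := ContDiffOn.derivWithin_Ici su
  set u₂ := derivWithin u₁ (Ici 0) with hu₂
  have su₂ : ContDiffOn ℝ ∞ u₂ (Ici 0) := ContDiffOn.derivWithin_Ici su₁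
  set u₃ := derivWithin u₂ (Ici 0) with hu₃
  have su₃ : ContDiffOn ℝ ∞ u₃ (Ici 0) := ContDiffOn.derivWithin_Ici su₂
  set u₄ := derivWithin u₃ (Ici 0) with hu₄
  set h₁ := derivWithin h (Ici 0) with hh₁
  have sh₁ : ContDiffOn ℝ ∞ h₁ (Ici 0) := ContDiffOn.derivWithin_Ici sh
  set h₂ := derivWithin h₁ (Ici 0) with hh₂
  have E0 : ∀ t, 0 ≤ t → B (u₂ t) = -(u t + h t) := fun t ht => hu.friedrichsInv_derivWithin hh ht
  have E1 : ∀ t, 0 ≤ t → B (u₃ t) = -(u₁ t + h₁ t) := fun t ht => map_derivWithin_Ici B su₂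
    (fun t ht => ((ContDiffOn.hasDerivWithinAt_Ici su ht).add
      (ContDiffOn.hasDerivWithinAt_Ici sh ht)).neg) E0 ht
  have E2 : ∀ t, 0 ≤ t → B (u₄ t) = -(u₂ t + h₂ t) := fun t ht => map_derivWithin_Ici B su₃
    (fun t ht => ((ContDiffOn.hasDerivWithinAt_Ici su₁ ht).add
      (ContDiffOn.hasDerivWithinAt_Ici sh₁ ht)).neg) E1 ht
  obtain ⟨h00, h10⟩ := hh.derivWithin_zero
  -- The control is flat at `0`, so injectivity of `L⁻¹` gives zero initial values for the higher
  -- derivatives of `u` too.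
  have u20 : u₂ 0 = 0 := hinj _ (by rw [E0 0 le_rfl, hu.initial, h00]; simp)
  have u30 : u₃ 0 = 0 := hinj _ (by rw [E1 0 le_rfl, hu₁, hu.initial_deriv, hh₁, h10]; simp)
  have hker : ∀ r, 0 ≤ r → r ≤ T → ∀ t, 0 ≤ t →
      ⟪sinOp B r y - (r : ℂ) • y, h₂ t⟫_ℂ = 0 := fun r hr hrT t ht =>
    inner_derivWithin_Ici_eq_zero sh₁ (fun t ht => inner_derivWithin_Ici_eq_zero sh
      (fun t ht => hy r hr hrT _ (hh.mem_ker t ht)) ht) ht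
  have hrefl : ∀ t : ℝ, HasDerivAt (fun t => T - t) (-1) t := fun t =>
    (hasDerivAt_id t).const_sub T
  -- A Duhamel quantity in norm differentiable operators. Its derivative reduces to the negative of
  -- the pairing in `hker`, hence vanishes; `Z 0 = 0`, while `Z T` is the negative of the desired
  -- pairing.
  set Z : ℝ → ℂ := fun t => ⟪B (sinOp B (T - t) y), u₃ t⟫_ℂ + ⟪cosOp B (T - t) y, u₂ t⟫_ℂ +
    ((T - t : ℝ) : ℂ) * ⟪y, h₁ t⟫_ℂ + ⟪y, h t⟫_ℂ with hZ
  have hZd : ∀ t ∈ Icc 0 T, HasDerivWithinAt Z 0 (Ici 0) t := by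
    intro t ht
    have d1 : HasDerivAt (fun t => B (sinOp B (T - t) y)) (-cosOp B (T - t) y) t := by
      simpa [Function.comp_def] using
        (hasDerivAt_comp_sinOp_apply hB y (T - t)).scomp t (hrefl t)
    have d2 : HasDerivAt (fun t => cosOp B (T - t) y) (sinOp B (T - t) y) t := by
      simpa [Function.comp_def] using (hasDerivAt_cosOp_apply (B := B) y (T - t)).scomp t (hrefl t)
    have d3 : HasDerivAt (fun t => ((T - t : ℝ) : ℂ)) (((-1 : ℝ)) : ℂ) t := (hrefl t).ofReal_comp
    have d4 := fun (f : ℝ → H) (hf : ContDiffOn ℝ ∞ f (Ici 0)) =>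
      (hasDerivWithinAt_const t (Ici 0) y).inner ℂ (ContDiffOn.hasDerivWithinAt_Ici hf ht.1)
    have dd := (((d1.hasDerivWithinAt (s := Ici 0)).inner ℂ
      (ContDiffOn.hasDerivWithinAt_Ici su₃ ht.1)).add
      ((d2.hasDerivWithinAt (s := Ici 0)).inner ℂ (ContDiffOn.hasDerivWithinAt_Ici su₂ ht.1))).add
      ((d3.hasDerivWithinAt (s := Ici 0)).mul (d4 h₁ sh₁)) |>.add (d4 h sh)
    refine dd.congr_deriv ?_
    have k := hker (T - t) (by linarith [ht.2]) (by linarith [ht.1]) t ht.1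
    rw [inner_sub_left, inner_smul_left, Complex.conj_ofReal] at k
    have s1 : ⟪B (sinOp B (T - t) y), u₄ t⟫_ℂ =
        -⟪sinOp B (T - t) y, u₂ t⟫_ℂ - ⟪sinOp B (T - t) y, h₂ t⟫_ℂ := by
      rw [friedrichsInv_symm hd hA, ← hBdef, E2 t ht.1, inner_neg_right, inner_add_right]
      ring
    change ⟪B (sinOp B (T - t) y), u₄ t⟫_ℂ + ⟪-cosOp B (T - t) y, u₃ t⟫_ℂ +
      (⟪cosOp B (T - t) y, u₃ t⟫_ℂ + ⟪sinOp B (T - t) y, u₂ t⟫_ℂ) +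
      (((-1 : ℝ) : ℂ) * ⟪y, h₁ t⟫_ℂ + ((T - t : ℝ) : ℂ) * (⟪y, h₂ t⟫_ℂ + ⟪(0 : H), h₁ t⟫_ℂ)) +
      (⟪y, h₁ t⟫_ℂ + ⟪(0 : H), h t⟫_ℂ) = 0
    rw [s1, inner_neg_left, inner_zero_left, inner_zero_left]
    push_cast at k ⊢
    linear_combination -k
  have hconst := constant_of_has_deriv_right_zero (f := Z) (a := 0) (b := T)
    (fun t ht => ((hZd t ht).continuousWithinAt).mono Icc_subset_Ici_self)
    (fun t ht => (hZd t (Ico_subset_Icc_self ht)).mono (Ici_subset_Ici.2 ht.1)) T ⟨hT, le_rfl⟩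
  have z0 : Z 0 = 0 := by
    simp only [hZ]
    rw [u20, u30, h00, hh₁, h10]
    simp
  have zT : Z T = -⟪y, u T⟫_ℂ := by
    simp only [hZ]
    rw [sub_self, sinOp_zero, cosOp_zero hB, friedrichsInv_symm hd hA y, ← hBdef, E0 T hT]
    simp
  rw [z0, zT, neg_eq_zero] at hconst
  exact hconst

end ReachableNecessary

/-! ### Construction of reachable states. -/

section ReachableSufficient

/-- Freezing `K` at its value `K 0` for negative times stays differentiable because `K' 0 = 0`; this
provides the causal continuation of a wave. -/
theorem hasDerivAt_comp_max {F : Type*} [NormedAddCommGroup F] [NormedSpace ℝ F] {K K' : ℝ → F}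
    (hK : ∀ s, HasDerivAt K (K' s) s) (h0 : K' 0 = 0) (s : ℝ) :
    HasDerivAt (fun s => K (max s 0)) (K' (max s 0)) s := by
  rcases lt_trichotomy s 0 with hs | rfl | hs
  · rw [max_eq_right hs.le, h0]
    refine (hasDerivAt_const s (K 0)).congr_of_eventuallyEq ?_
    filter_upwards [Iio_mem_nhds hs] with t ht
    rw [max_eq_right (le_of_lt ht)]
  · have h1 := hK 0
    rw [h0, hasDerivAt_iff_isLittleO] at h1
    rw [max_self, h0, hasDerivAt_iff_isLittleO]
    have hlim : Tendsto (fun s : ℝ => max s 0) (𝓝 0) (𝓝 0) :=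
      (by fun_prop : Continuous fun s : ℝ => max s 0).tendsto' 0 0 (max_self 0)
    refine ((h1.comp_tendsto hlim).trans_isBigO (Asymptotics.isBigO_of_le _ fun s => ?_)).congr_left
      fun s => by simp
    simp only [Function.comp_apply, sub_zero, Real.norm_eq_abs]
    rw [abs_of_nonneg (le_max_right s 0)]
    exact max_le (le_abs_self s) (abs_nonneg s)
  · rw [max_eq_left hs.le]
    refine (hK s).congr_of_eventuallyEq ?_
    filter_upwards [Ioi_mem_nhds hs] with t ht
    rw [max_eq_left (le_of_lt ht)]

theorem contDiff_mollify {F : Type*} [NormedAddCommGroup F] [NormedSpace ℝ F] {ρ : ℝ → ℝ}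
    {K : ℝ → F} (hρ : IsRealTest ρ) (hK : Continuous K) : ContDiff ℝ ∞ (mollify ρ K) := by
  rw [mollify_eq_convolution]
  exact hρ.compact.contDiff_convolution_left _ hρ.smooth hK.locallyIntegrable

theorem mollify_eq_zero_of_causal {F : Type*} [NormedAddCommGroup F] [NormedSpace ℝ F] {ρ : ℝ → ℝ}
    {K : ℝ → F} {a : ℝ} (hρ : ∀ r ∈ tsupport ρ, a ≤ r) (hK : ∀ s ≤ 0, K s = 0) {s : ℝ}
    (hs : s ≤ a) : mollify ρ K s = 0 := by
  refine integral_eq_zero_of_ae (Eventually.of_forall fun r => ?_)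
  by_cases hr : r ∈ tsupport ρ
  · simp only [hK (s - r) (by linarith [hρ r hr]), smul_zero, Pi.zero_apply]
  · simp only [image_eq_zero_of_notMem_tsupport hr, zero_smul, Pi.zero_apply]

variable {H : Type*} [NormedAddCommGroup H] [InnerProductSpace ℂ H] [CompleteSpace H]

variable {A : H →ₗ.[ℂ] H} {hA : IsPositiveDefinite A}

theorem exists_lower_bound_tsupport {ρ : ℝ → ℝ} (hρ : IsRealTest ρ) (hs : tsupport ρ ⊆ Ioi 0) :
    ∃ a, 0 < a ∧ ∀ r ∈ tsupport ρ, a ≤ r := by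
  rcases (tsupport ρ).eq_empty_or_nonempty with he | hne
  · exact ⟨1, one_pos, by simp [he]⟩
  · obtain ⟨a, ha, hmin⟩ := hρ.compact.isCompact.exists_isMinOn hne continuousOn_id
    exact ⟨a, hs ha, fun r hr => hmin hr⟩

/-- The mollified response to the control `s ↦ s φ`. -/
theorem exists_wave_mollify (hd : Dense (A.domain : Set H)) {φ : H}
    (hφ : (φ, (0 : H)) ∈ A.adjoint.graph) {ρ : ℝ → ℝ} (hρ : IsRealTest ρ)
    (hs : tsupport ρ ⊆ Ioi 0) : ∃ h, IsControl A h ∧ IsSmoothWave A hA h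
      (mollify ρ fun s => sinOp (friedrichsInv A hA) (max s 0) φ - ((max s 0 : ℝ) : ℂ) • φ) := by
  obtain ⟨a, ha, hsa⟩ := exists_lower_bound_tsupport hρ hs
  set B := friedrichsInv A hA with hBdef
  have hB : B.IsPositive := friedrichsInv_isPositive hd hA
  have hS : Continuous fun s : ℝ => sinOp B (max s 0) φ :=
    (continuous_sinOp_apply B φ).comp (by fun_prop)
  have hm : Continuous fun s : ℝ => ((max s 0 : ℝ) : ℂ) :=
    Complex.continuous_ofReal.comp (by fun_prop)
  have hL : Continuous fun s : ℝ => ((max s 0 : ℝ) : ℂ) • φ := hm.smul continuous_const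
  -- For positive times this formally solves the problem with control `s φ`. Convolution with a `ρ`
  -- supported in positive times makes it smooth and zero near `t = 0`.
  set K : ℝ → H := fun s => sinOp B (max s 0) φ - ((max s 0 : ℝ) : ℂ) • φ with hKdef
  have hK : Continuous K := hS.sub hL
  have hK0 : ∀ s ≤ 0, K s = 0 := fun s hs => by
    simp [hKdef, max_eq_right hs, sinOp_zero]
  set h : ℝ → H := fun t => mollify ρ (fun s : ℝ => ((max s 0 : ℝ) : ℂ)) t • φ with hh
  have hmem : ∀ c : ℂ, (c • φ, (0 : H)) ∈ A.adjoint.graph := fun c => by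
    simpa using A.adjoint.graph.smul_mem c hφ
  have hsum : ∀ t, mollify ρ K t + h t = mollify ρ (fun s => sinOp B (max s 0) φ) t := by
    intro t
    have h1 : h t = mollify ρ (fun s : ℝ => ((max s 0 : ℝ) : ℂ) • φ) t := by
      have h2 := integral_smul_const (μ := volume) (fun r => ρ r • ((max (t - r) 0 : ℝ) : ℂ)) φ
      simp only [smul_assoc] at h2
      exact h2.symm
    have h2 := integral_add (integrable_mollify hρ hK t) (integrable_mollify hρ hL t)
    simp only [← smul_add, hKdef, sub_add_cancel] at h2
    rw [h1]
    exact h2.symm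
  set u := mollify ρ K with hu
  set u₁ := mollify (deriv ρ) K with hu₁
  set u₂ := mollify (deriv (deriv ρ)) K with hu₂
  have d0 : ∀ t, HasDerivAt u (u₁ t) t := hasDerivAt_mollify hρ hK
  have d1 : ∀ t, HasDerivAt u₁ (u₂ t) t := hasDerivAt_mollify hρ.deriv hK
  have hBu : ∀ t, B (u₂ t) = -(u t + h t) := by
    intro t
    have c1 : ∀ s : ℝ, HasDerivAt (fun s : ℝ => B (sinOp B s φ) - (s : ℂ) • B φ)
        (cosOp B s φ - B φ) s := fun s =>
      (hasDerivAt_comp_sinOp_apply hB φ s).sub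
        (by simpa using (hasDerivAt_id s).ofReal_comp.smul_const (B φ))
    have c2 : ∀ s : ℝ, HasDerivAt (fun s : ℝ => cosOp B s φ - B φ) (-sinOp B s φ) s := fun s =>
      (hasDerivAt_cosOp_apply φ s).sub_const _
    -- No kink arises at `s = 0` for the function or for its derivative, since `cosOp B 0 = B` and
    -- `sinOp B 0 = 0`.
    have e1 := hasDerivAt_comp_max c1 (by rw [cosOp_zero hB, sub_self])
    have e2 := hasDerivAt_comp_max c2 (by rw [sinOp_zero]; simp)
    have hBK : (fun s => B (K s)) =
        fun s => B (sinOp B (max s 0) φ) - ((max s 0 : ℝ) : ℂ) • B φ := by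
      funext s
      rw [hKdef, map_sub, map_smul]
    rw [hsum, hu₂, map_mollify hρ.deriv.deriv hK, hBK, mollify_deriv hρ.deriv e1
      (continuous_iff_continuousAt.2 fun s => (e2 s).continuousAt),
      mollify_deriv hρ e2 hS.neg, mollify, mollify, ← integral_neg]
    simp only [smul_neg]
  have hgraph : ∀ t, (u t, -u₂ t) ∈ A.adjoint.graph := by
    intro t
    have h1 := A.adjoint.graph.sub_mem
      (A.adjoint.graph.neg_mem (friedrichsInv_mem_adjoint_graph hd hA (u₂ t)))
      (hmem (mollify ρ (fun s : ℝ => ((max s 0 : ℝ) : ℂ)) t))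
    rw [← hBdef, hBu t] at h1
    simpa [hh] using h1
  have happ : ∀ t (hx : u t ∈ A.adjoint.domain), A.adjoint ⟨u t, hx⟩ = -u₂ t := by
    intro t hx
    obtain ⟨z, hz1, hz2⟩ := (LinearPMap.mem_graph_iff _).1 (hgraph t)
    exact (congrArg A.adjoint (Subtype.ext hz1.symm)).trans hz2
  have w1 : ∀ t, 0 ≤ t → derivWithin u (Ici 0) t = u₁ t := fun t ht =>
    (d0 t).hasDerivWithinAt.derivWithin (uniqueDiffOn_Ici 0 t ht)
  have w2 : ∀ t, 0 ≤ t → derivWithin (derivWithin u (Ici 0)) (Ici 0) t = u₂ t := fun t ht => by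
    rw [derivWithin_congr (s := Ici (0 : ℝ)) (fun s hs => w1 s hs) (w1 t ht)]
    exact (d1 t).hasDerivWithinAt.derivWithin (uniqueDiffOn_Ici 0 t ht)
  refine ⟨h, ⟨?_, fun t _ => hmem _, a, ha, fun t _ hta => ?_⟩,
    ⟨(contDiff_mollify hρ hK).contDiffOn, fun t _ => LinearPMap.mem_domain_of_mem_graph (hgraph t),
      fun t ht => ?_, mollify_eq_zero_of_causal hsa hK0 ha.le, ?_, fun t ht => ?_⟩⟩
  · exact ((contDiff_mollify hρ hm).smul contDiff_const).contDiffOn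
  · rw [hh]
    simp only
    rw [mollify_eq_zero_of_causal hsa (fun s hs => by simp [max_eq_right hs]) hta, zero_smul]
  · rw [happ, iteratedDerivWithin_succ, iteratedDerivWithin_one, w2 t ht.le, add_neg_cancel]
  · rw [w1 0 le_rfl]
    exact mollify_eq_zero_of_causal (fun r hr => hsa r (tsupport_deriv_subset hr)) hK0 ha.le
  · change B (A.adjoint ⟨u t, _⟩) - u t = h t
    rw [happ, map_neg, hBu]
    abel

/-- Vectors orthogonal to all reachable states have trivial boundary trace. -/
theorem inner_sinOp_eq_of_orthogonal_reachable (hd : Dense (A.domain : Set H)) {T : ℝ≥0} {y : H}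
    (hy : ∀ x ∈ reachableSet A hA T, ⟪y, x⟫_ℂ = 0) {φ : H} (hφ : (φ, (0 : H)) ∈ A.adjoint.graph)
    {s : ℝ} (h0 : 0 ≤ s) (hT : s ≤ T) :
    ⟪y, sinOp (friedrichsInv A hA) s φ⟫_ℂ = s * ⟪y, φ⟫_ℂ := by
  set B := friedrichsInv A hA with hBdef
  set K : ℝ → H := fun s => sinOp B (max s 0) φ - ((max s 0 : ℝ) : ℂ) • φ with hKdef
  have hS : Continuous fun s : ℝ => sinOp B (max s 0) φ :=
    (continuous_sinOp_apply B φ).comp (by fun_prop)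
  have hm : Continuous fun s : ℝ => ((max s 0 : ℝ) : ℂ) :=
    Complex.continuous_ofReal.comp (by fun_prop)
  have hK : Continuous K := hS.sub (hm.smul continuous_const)
  have hc : Continuous fun r : ℝ => ⟪y, K (T - r)⟫_ℂ :=
    continuous_const.inner (hK.comp (continuous_const.sub continuous_id))
  -- The reachable states include `∫ ρ(r) K(T - r) dr` for every `ρ` supported in `(0, T)`, so the
  -- fundamental lemma makes the pairing with `y` vanish there; continuity then adds the endpoints.
  have hae := IsOpen.ae_eq_zero_of_integral_contDiff_smul_eq_zero (μ := volume) isOpen_Ioo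
    (hc.locallyIntegrable.locallyIntegrableOn (Ioo 0 (T : ℝ))) fun ρ h1 h2 h3 => by
      have hρ : IsRealTest ρ := ⟨h1, h2⟩
      obtain ⟨h, hh, hu⟩ := exists_wave_mollify (hA := hA) hd hφ hρ
        (h3.trans Ioo_subset_Ioi_self)
      have := hy _ ⟨h, _, hh, hu, rfl⟩
      rw [inner_mollify hρ hK] at this
      exact this
  have h1 : (fun r : ℝ => ⟪y, K (T - r)⟫_ℂ) =ᵐ[volume.restrict (Ioo 0 (T : ℝ))] 0 :=
    (ae_restrict_iff' measurableSet_Ioo).2 hae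
  have h2 := Measure.eqOn_open_of_ae_eq h1 isOpen_Ioo hc.continuousOn continuousOn_const
  have h3 : ⟪y, K s⟫_ℂ = 0 := by
    rcases h0.eq_or_lt with rfl | h0
    · simp [hKdef, sinOp_zero]
    · have hT0 : (0 : ℝ) < T := h0.trans_le hT
      have h4 := h2.of_subset_closure hc.continuousOn continuousOn_const Ioo_subset_Icc_self
        (by rw [closure_Ioo hT0.ne])
      simpa using h4 (x := T - s) ⟨by linarith, by linarith⟩
  rw [hKdef] at h3
  simp only [max_eq_left h0] at h3
  rw [inner_sub_right, inner_smul_right, sub_eq_zero] at h3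
  exact h3

end ReachableSufficient

/-! ### The reachable subspaces are `L₂(0, T)`. -/

section Reachable

variable {q : ℝ → ℝ} {hA : IsPositiveDefinite (slOp q)} {φ : L2Half}

theorem IsH2Loc.deriv_zero_of_ae_eq_zero {f f₁ f₂ : ℝ → ℂ} (hf : IsH2Loc f f₁ f₂) {δ : ℝ}
    (hδ : 0 < δ) (h : ∀ᵐ x ∂halfLine, x < δ → f x = 0) : f₁ 0 = 0 := by
  have h1 : f =ᵐ[volume.restrict (Ioo 0 δ)] 0 := by
    filter_upwards [ae_restrict_of_ae_restrict_of_subset Ioo_subset_Ioi_self h,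
      ae_restrict_mem measurableSet_Ioo] with x hx hx'
    exact hx hx'.2
  have h2 := Measure.eqOn_open_of_ae_eq h1 isOpen_Ioo
    (hf.continuousOn.mono (Ioo_subset_Ioi_self.trans Ioi_subset_Ici_self)) continuousOn_const
  have h3 : EqOn f₁ 0 (Ioo 0 δ) := fun x hx => by
    refine (hf.hasDerivAt hx.1).unique ((hasDerivAt_const x (0 : ℂ)).congr_of_eventuallyEq ?_)
    filter_upwards [isOpen_Ioo.mem_nhds hx] with t ht
    exact h2 ht
  have h4 := h3.of_subset_closure (t := Ico 0 δ) (hf.continuousOn₁.mono Ico_subset_Ici_self)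
    continuousOn_const Ioo_subset_Ico_self (by rw [closure_Ioo hδ.ne]; exact Ico_subset_Icc_self)
  exact h4 ⟨le_rfl, hδ⟩

/-- The vector is minus the double time integral of `S(r) y`. Pairing with `z` orthogonal to `M`
reduces this to scalar functions with zero derivative. -/
theorem friedrichsInv_sub_mem {H : Type*} [NormedAddCommGroup H] [InnerProductSpace ℂ H]
    [CompleteSpace H] {B : H →L[ℂ] H} (hB : B.IsPositive) (M : ClosedSubmodule ℂ H) {y : H} {s : ℝ}
    (hs : 0 ≤ s) (h : ∀ r, 0 ≤ r → r ≤ s → sinOp B r y ∈ M) :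
    B (sinOp B s y - (s : ℂ) • y) ∈ M := by
  rw [mem_iff_inner_orthogonal]
  intro z hz
  have hz0 : ∀ r, 0 ≤ r → r ≤ s → ⟪z, sinOp B r y⟫_ℂ = 0 := fun r h0 h1 =>
    (M.mem_orthogonal' z).1 hz _ (h r h0 h1)
  have d2 : ∀ r : ℝ, HasDerivAt (fun r => ⟪z, cosOp B r y - B y⟫_ℂ) (-⟪z, sinOp B r y⟫_ℂ) r :=
    fun r => by
      exact ((hasDerivAt_const r z).inner ℂ
        ((hasDerivAt_cosOp_apply y r).sub_const (B y))).congr_deriv (by simp)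
  have c2 : ∀ r ∈ Icc 0 s, ⟪z, cosOp B r y - B y⟫_ℂ = 0 := fun r hr => by
    rw [constant_of_has_deriv_right_zero (a := 0) (b := s)
      (fun t _ => (d2 t).continuousAt.continuousWithinAt)
      (fun t ht => by simpa [hz0 t ht.1 ht.2.le] using (d2 t).hasDerivWithinAt (s := Ici t)) r hr,
      cosOp_zero hB, sub_self, inner_zero_right]
  have d1 : ∀ r : ℝ, HasDerivAt (fun r : ℝ => ⟪z, B (sinOp B r y) - (r : ℂ) • B y⟫_ℂ)
      ⟪z, cosOp B r y - B y⟫_ℂ r := fun r => by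
    have h1 : HasDerivAt (fun r : ℝ => (r : ℂ) • B y) (B y) r := by
      simpa using (hasDerivAt_id r).ofReal_comp.smul_const (B y)
    exact ((hasDerivAt_const r z).inner ℂ
      ((hasDerivAt_comp_sinOp_apply hB y r).sub h1)).congr_deriv
        (by rw [inner_zero_left, add_zero])
  have := constant_of_has_deriv_right_zero (a := 0) (b := s)
      (fun t _ => (d1 t).continuousAt.continuousWithinAt)
      (fun t ht => by
        have h1 := (d1 t).hasDerivWithinAt (s := Ici t)
        rwa [c2 t ⟨ht.1, ht.2.le⟩] at h1) s ⟨hs, le_rfl⟩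
  rw [map_sub, map_smul, this]
  simp [sinOp_zero]

/-- Functions supported beyond the front have trivial boundary trace. -/
theorem inner_sinOp_eq_of_mem_Ioi (hφ : IsKernelVector hA φ) (hq : ContDiffOn ℝ ∞ q (Ici 0))
    {T : ℝ} {y : L2Half} (hy : y ∈ L2On (Ioi T)) {s : ℝ} (hs : 0 ≤ s) (hsT : s ≤ T) :
    ⟪φ, sinOp (friedrichsInv (slOp q) hA) s y⟫_ℂ = s * ⟪φ, y⟫_ℂ := by
  have hd := slOp_dense hq.continuousOn
  have hB := friedrichsInv_isPositive hd hA
  set B := friedrichsInv (slOp q) hA with hBdef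
  have hlt : ∀ s, 0 ≤ s → s < T → ⟪φ, sinOp B s y⟫_ℂ = s * ⟪φ, y⟫_ℂ := by
    intro s hs hsT
    have hmem : ∀ r, 0 ≤ r → r ≤ s → sinOp B r y ∈ L2On (Ioi (T - s)) := by
      intro r h0 h1
      refine L2On_mono ?_ (sinOp_mem_thickening hφ hq isOpen_Ioi
        (Ioi_subset_Ioi (hs.trans hsT.le)) hy r)
      intro x hx
      obtain ⟨z, hz, hxz⟩ := Metric.mem_thickening_iff.1 hx
      rw [abs_of_nonneg h0, Real.dist_eq, abs_lt] at hxz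
      have hz' : T < z := hz
      change T - s < x
      linarith [hxz.1]
    obtain ⟨f, f₁, f₂, hf, -, h1, h2, -⟩ := hφ.slope (sinOp B s y - (s : ℂ) • y)
    -- Up to time `s` the wave stays beyond `T - s`, so `L⁻¹ (S(s) y - s y)` vanishes near the
    -- origin, and its slope there is the boundary trace.
    have h3 : f₁ 0 = 0 := by
      refine hf.deriv_zero_of_ae_eq_zero (sub_pos.2 hsT) ?_
      filter_upwards [h2, mem_L2On.1 (friedrichsInv_sub_mem hB _ hs hmem)] with x hx hx' hlt
      rw [← hx]
      exact hx' (not_lt.2 (le_of_lt hlt))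
    rw [h3, inner_sub_right, inner_smul_right] at h1
    exact (sub_eq_zero.1 h1.symm)
  rcases hsT.lt_or_eq with h | rfl
  · exact hlt s hs h
  · rcases hs.eq_or_lt with rfl | hs
    · simp [sinOp_zero]
    · have h1 : EqOn (fun s => ⟪φ, sinOp B s y⟫_ℂ) (fun s => (s : ℂ) * ⟪φ, y⟫_ℂ) (Ico 0 s) :=
        fun r hr => hlt r hr.1 hr.2
      exact h1.of_subset_closure (t := Icc 0 s)
        (continuous_const.inner (continuous_sinOp_apply B y)).continuousOn
        (Complex.continuous_ofReal.mul continuous_const).continuousOn Ico_subset_Icc_self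
        (by rw [closure_Ico hs.ne]) ⟨hs.le, le_rfl⟩

/-- The reachable subspaces are the spaces `L₂(0, T)`. -/
theorem reachableSubspace_eq (hφ : IsKernelVector hA φ) (hq : ContDiffOn ℝ ∞ q (Ici 0)) (T : ℝ≥0) :
    reachableSubspace (slOp q) hA T = L2On (Ioo 0 (T : ℝ)) := by
  have hd := slOp_dense hq.continuousOn
  refine le_antisymm ?_ fun x hx => ?_
  · rw [reachableSubspace, Submodule.closure_le, Submodule.span_le]
    rintro x ⟨h, u, hh, hu, rfl⟩
    change _ ∈ L2On (Ioo 0 (T : ℝ))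
    rw [mem_iff_inner_orthogonal]
    intro y hy
    rw [orthogonal_L2On measurableSet_Ioo] at hy
    have hy' : y ∈ L2On (Ioi (T : ℝ)) := by
      refine L2On_le_of_ae ?_ hy
      have hne : ∀ᵐ s ∂halfLine, s ≠ (T : ℝ) :=
        ae_restrict_of_ae (Measure.ae_ne volume (T : ℝ))
      filter_upwards [ae_restrict_mem measurableSet_Ioi, hne] with s h1 h2 h3
      by_contra h4
      exact h3 ⟨h1, lt_of_le_of_ne (not_lt.1 h4) h2⟩
    refine hu.inner_eq_zero hd hh T.coe_nonneg fun r h0 hrT w hw => ?_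
    obtain ⟨c, rfl⟩ := hφ.span w hw
    have h1 := inner_sinOp_eq_of_mem_Ioi hφ hq hy' h0 hrT
    rw [inner_smul_right, inner_sub_left, inner_smul_left, Complex.conj_ofReal,
      ← inner_conj_symm, h1, map_mul, Complex.conj_ofReal, inner_conj_symm, sub_self, mul_zero]
  · rw [mem_iff_inner_orthogonal]
    intro y hy
    refine inner_eq_zero_of_mem_compl ?_ hx
    have h1 : ∀ x ∈ reachableSet (slOp q) hA T, ⟪y, x⟫_ℂ = 0 := fun x hx =>
      (ClosedSubmodule.mem_orthogonal' _ _).1 hy _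
        (Submodule.le_topologicalClosure _ (Submodule.subset_span hx))
    have h2 := mem_compl_ball_of_inner_sinOp hφ hq.continuousOn (y := y) (T := T) fun s h0 hs => by
      have h3 := inner_sinOp_eq_of_orthogonal_reachable hd h1 hφ.mem_ker h0 hs
      rw [← inner_sinOp, ← inner_conj_symm, h3, map_mul, Complex.conj_ofReal,
        inner_conj_symm]
    refine L2On_mono (compl_subset_compl.2 fun x hx => ?_) h2
    rw [Metric.mem_ball, Real.dist_eq, sub_zero, abs_of_pos hx.1]
    exact hx.2

end Reachable

/-! ### Sets with null frontier. -/

section NullFrontier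

/-- A frontier point has distance exactly `t` from some `z` in the closure of `E`, and the open
interval of radius `t` about `z` lies inside the neighbourhood. The point is thus isolated in the
frontier from one side, and a set on the line has only countably many such points. -/
theorem volume_frontier_thickening {E : Set ℝ} {t : ℝ} (ht : 0 < t) :
    volume (frontier (Metric.thickening t E)) = 0 := by
  set S := frontier (Metric.thickening t E) with hS
  refine Set.Countable.measure_zero (((countable_setOfPred_isolated_right_within (s := S)).union
    (countable_setOfPred_isolated_left_within (s := S))).mono fun x hx => ?_) volume
  have hne : (closure E).Nonempty := by
    rw [closure_nonempty_iff, ← Metric.thickening_nonempty_iff_of_pos ht, ← closure_nonempty_iff]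
    exact ⟨x, hx.1⟩
  obtain ⟨z, hz, hxz⟩ := isClosed_closure.exists_infDist_eq_dist hne x
  have hd : dist x z = t := by
    rw [← hxz, Metric.infDist_closure, Metric.infDist, Metric.frontier_thickening_subset E hx,
      ENNReal.toReal_ofReal ht.le]
  have hout : ∀ w, dist w z < t → w ∉ S := fun w hw hwS => by
    have h1 : w ∈ Metric.thickening t E := by
      rw [← Metric.thickening_closure]
      exact Metric.mem_thickening_iff.2 ⟨z, hz, hw⟩
    rw [hS, Metric.isOpen_thickening.frontier_eq] at hwS
    exact hwS.2 h1
  rw [Real.dist_eq] at hd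
  rcases lt_trichotomy x z with h | rfl | h
  · refine Or.inl ⟨hx, ?_⟩
    rw [← empty_mem_iff_bot, mem_nhdsWithin]
    refine ⟨Iio z, isOpen_Iio, h, fun w ⟨h1, h2, h3⟩ => hout w ?_ h2⟩
    have h1' : w < z := h1
    have h3' : x < w := h3
    rw [Real.dist_eq, abs_of_neg (by linarith)]
    rw [abs_of_neg (by linarith)] at hd
    linarith
  · simp only [sub_self, abs_zero] at hd
    exact absurd hd ht.ne
  · refine Or.inr ⟨hx, ?_⟩
    rw [← empty_mem_iff_bot, mem_nhdsWithin]
    refine ⟨Ioi z, isOpen_Ioi, h, fun w ⟨h1, h2, h3⟩ => hout w ?_ h2⟩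
    have h1' : z < w := h1
    have h3' : w < x := h3
    rw [Real.dist_eq, abs_of_pos (by linarith)]
    rw [abs_of_pos (by linarith)] at hd
    linarith

theorem volume_frontier_union {E F : Set ℝ} (hE : volume (frontier E) = 0)
    (hF : volume (frontier F) = 0) : volume (frontier (E ∪ F)) = 0 :=
  measure_mono_null ((frontier_union_subset E F).trans
    (union_subset_union inter_subset_left inter_subset_right)) (measure_union_null hE hF)

theorem volume_frontier_inter {E F : Set ℝ} (hE : volume (frontier E) = 0)
    (hF : volume (frontier F) = 0) : volume (frontier (E ∩ F)) = 0 :=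
  measure_mono_null ((frontier_inter_subset E F).trans
    (union_subset_union inter_subset_left inter_subset_right)) (measure_union_null hE hF)

theorem volume_frontier_Ioi (a : ℝ) : volume (frontier (Ioi a)) = 0 := by
  rw [frontier_Ioi]
  exact measure_singleton a

end NullFrontier

/-! ### Strong convergence of projections. -/

section Convergence

theorem tendsto_proj_L2On {E : ℕ → Set ℝ} {F : Set ℝ} (hE : ∀ n, MeasurableSet (E n))
    (hF : MeasurableSet F) (h : ∀ᵐ s ∂halfLine, ∀ᶠ n in atTop, s ∈ E n ↔ s ∈ F) (y : L2Half) :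
    Tendsto (fun n => proj (L2On (E n)) y) atTop (𝓝 (proj (L2On F) y)) := by
  rw [tendsto_iff_norm_sub_tendsto_zero]
  have hval : ∀ n, (proj (L2On (E n)) y - proj (L2On F) y : L2Half) =ᵐ[halfLine]
      fun s => (E n).indicator y s - F.indicator y s := fun n => by
    filter_upwards [Lp.coeFn_sub (proj (L2On (E n)) y) (proj (L2On F) y),
      proj_L2On_coeFn (hE n) y, proj_L2On_coeFn hF y] with s h1 h2 h3
    rw [h1, Pi.sub_apply, h2, h3]
  have hint := L2.integrable_inner (𝕜 := ℂ) y y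
  have hlim : Tendsto (fun n => ∫ s, ⟪(proj (L2On (E n)) y - proj (L2On F) y : L2Half) s,
      (proj (L2On (E n)) y - proj (L2On F) y : L2Half) s⟫_ℂ ∂halfLine) atTop (𝓝 0) := by
    rw [← integral_zero ℝ ℂ (μ := halfLine)]
    refine tendsto_integral_of_dominated_convergence (fun s => ‖⟪y s, y s⟫_ℂ‖)
      (fun n => (L2.integrable_inner _ _).aestronglyMeasurable) hint.norm (fun n => ?_) ?_
    · filter_upwards [hval n] with s hs
      rw [hs]
      by_cases h1 : s ∈ E n <;> by_cases h2 : s ∈ F <;> simp [h1, h2]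
    · filter_upwards [h, ae_all_iff.2 hval] with s hs hv
      refine tendsto_const_nhds.congr' ?_
      filter_upwards [hs] with n hn
      rw [hv n]
      by_cases h2 : s ∈ F
      · rw [indicator_of_mem (hn.2 h2), indicator_of_mem h2, sub_self, inner_zero_left]
      · rw [indicator_of_notMem (fun h => h2 (hn.1 h)), indicator_of_notMem h2, sub_self,
          inner_zero_left]
  have hsq : ∀ n, ‖proj (L2On (E n)) y - proj (L2On F) y‖ =
      √‖∫ s, ⟪(proj (L2On (E n)) y - proj (L2On F) y : L2Half) s,
      (proj (L2On (E n)) y - proj (L2On F) y : L2Half) s⟫_ℂ ∂halfLine‖ := fun n => by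
    rw [← L2.inner_def, inner_self_eq_norm_sq_to_K]
    simp
  simp only [hsq]
  have := (Real.continuous_sqrt.comp continuous_norm).tendsto (0 : ℂ)
  simp only [Function.comp_apply, norm_zero, Real.sqrt_zero] at this
  exact this.comp hlim

theorem exists_ne_zero_mem_L2On {a b : ℝ} (ha : 0 ≤ a) (hab : a < b) :
    ∃ y ∈ L2On (Ioo a b), y ≠ 0 := by
  have hfin : halfLine (Ioo a b) ≠ ⊤ :=
    ((Measure.restrict_apply_le _ _).trans_lt measure_Ioo_lt_top).ne
  refine ⟨indicatorConstLp 2 measurableSet_Ioo hfin (1 : ℂ), ?_, fun h0 => ?_⟩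
  · filter_upwards [indicatorConstLp_coeFn (p := 2) (hs := measurableSet_Ioo) (hμs := hfin)
      (c := (1 : ℂ))] with s h1 h2
    rw [h1, indicator_of_notMem h2]
  · have h1 := norm_indicatorConstLp (p := 2) (hs := measurableSet_Ioo) (hμs := hfin) (c := (1 : ℂ))
      (by norm_num) (by norm_num)
    rw [h0, norm_zero, norm_one, one_mul, Measure.real,
      Measure.restrict_apply measurableSet_Ioo,
      inter_eq_left.2 (Ioo_subset_Ioi_self.trans (Ioi_subset_Ioi ha)), Real.volume_Ioo,
      ENNReal.toReal_ofReal (by linarith)] at h1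
    exact (Real.rpow_pos_of_pos (sub_pos.2 hab) _).ne h1

theorem eq_zero_of_mem_disjoint {E F : Set ℝ} (h : Disjoint E F) {y : L2Half} (hE : y ∈ L2On E)
    (hF : y ∈ L2On F) : y = 0 := by
  have : y ∈ L2On E ⊓ L2On F := ⟨hE, hF⟩
  rwa [L2On_inf, h.inter_eq, L2On_empty, ClosedSubmodule.mem_bot] at this

theorem proj_eq_self {H : Type*} [NormedAddCommGroup H] [InnerProductSpace ℂ H] [CompleteSpace H]
    {M : ClosedSubmodule ℂ H} {y : H} : proj M y = y ↔ y ∈ M :=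
  Submodule.starProjection_eq_self_iff

/-- The relation `P_N P_M = P_M` passes to strong limits because projections are contractions. -/
theorem le_of_tendsto_proj {H : Type*} [NormedAddCommGroup H] [InnerProductSpace ℂ H]
    [CompleteSpace H] {M N : ℕ → ClosedSubmodule ℂ H} {P Q : ClosedSubmodule ℂ H}
    (hMN : ∀ n, M n ≤ N n) (hP : ∀ y, Tendsto (fun n => proj (M n) y) atTop (𝓝 (proj P y)))
    (hQ : ∀ y, Tendsto (fun n => proj (N n) y) atTop (𝓝 (proj Q y))) : P ≤ Q := by
  intro y hy
  have hy' : y ∈ P := hy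
  have h1 : Tendsto (fun n => proj (N n) (proj (M n) y)) atTop (𝓝 (proj Q y)) := by
    have h2 : Tendsto (fun n => ‖proj (M n) y - y‖) atTop (𝓝 0) := by
      have := hP y
      rwa [proj_eq_self.2 hy', tendsto_iff_norm_sub_tendsto_zero] at this
    have h3 : Tendsto (fun n => proj (N n) (proj (M n) y - y)) atTop (𝓝 0) :=
      squeeze_zero_norm (fun n => Submodule.norm_starProjection_apply_le _ _) h2
    have h4 := h3.add (hQ y)
    simpa only [map_sub, sub_add_cancel, zero_add] using h4
  have h5 : ∀ n, proj (N n) (proj (M n) y) = proj (M n) y := fun n =>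
    proj_eq_self.2 (hMN n (Submodule.starProjection_apply_mem _ _))
  simp only [h5] at h1
  have h6 := tendsto_nhds_unique h1 (hP y)
  rw [proj_eq_self.2 hy'] at h6
  exact proj_eq_self.1 h6

end Convergence

/-! ### The lattice and its atoms. -/

section Atoms

variable {q : ℝ → ℝ} {hA : IsPositiveDefinite (slOp q)} {φ : L2Half}

/-- A null frontier is the invariant that keeps the sets open: the complement may be replaced by the
complement of the closure. Neighbourhoods have null frontier automatically, while the isotony at
time `0` changes nothing. -/
theorem waveLattice_eq_L2On (hφ : IsKernelVector hA φ) (hq : ContDiffOn ℝ ∞ q (Ici 0))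
    {M : ClosedSubmodule ℂ L2Half} (hM : WaveLattice (slOp q) hA M) :
    ∃ E, IsOpen E ∧ E ⊆ Ioi 0 ∧ volume (frontier E) = 0 ∧ M = L2On E := by
  induction hM with
  | reachable T =>
    exact ⟨Ioo 0 T, isOpen_Ioo, Ioo_subset_Ioi_self, (convex_Ioo _ _).addHaar_frontier volume,
      reachableSubspace_eq hφ hq T⟩
  | bot => exact ⟨∅, isOpen_empty, empty_subset _, by simp, L2On_empty.symm⟩
  | top =>
    exact ⟨Ioi 0, isOpen_Ioi, subset_rfl, volume_frontier_Ioi 0,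
      (L2On_of_Ioi_subset subset_rfl).symm⟩
  | sup _ _ h1 h2 =>
    obtain ⟨E, hE, hE0, hEf, rfl⟩ := h1
    obtain ⟨F, hF, hF0, hFf, rfl⟩ := h2
    exact ⟨E ∪ F, hE.union hF, union_subset hE0 hF0, volume_frontier_union hEf hFf,
      L2On_sup hE.measurableSet⟩
  | inf _ _ h1 h2 =>
    obtain ⟨E, hE, hE0, hEf, rfl⟩ := h1
    obtain ⟨F, hF, hF0, hFf, rfl⟩ := h2
    exact ⟨E ∩ F, hE.inter hF, inter_subset_left.trans hE0, volume_frontier_inter hEf hFf,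
      L2On_inf⟩
  | orthogonal _ h1 =>
    obtain ⟨E, hE, hE0, hEf, rfl⟩ := h1
    refine ⟨(closure E)ᶜ ∩ Ioi 0, isClosed_closure.isOpen_compl.inter isOpen_Ioi,
      inter_subset_right, volume_frontier_inter ?_ (volume_frontier_Ioi 0), ?_⟩
    · rw [frontier_compl]
      exact measure_mono_null frontier_closure_subset hEf
    · rw [orthogonal_L2On hE.measurableSet]
      refine L2On_congr ?_
      have hf : ∀ᵐ s ∂halfLine, s ∉ frontier E :=
        ae_restrict_of_ae (measure_eq_zero_iff_ae_notMem.1 hEf)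
      filter_upwards [hf, ae_restrict_mem measurableSet_Ioi] with s h1 h2
      refine ⟨fun h3 => ⟨fun h4 => h1 ?_, h2⟩, fun h3 h4 => h3.1 (subset_closure h4)⟩
      rw [hE.frontier_eq]
      exact ⟨h4, h3⟩
  | isotony t _ h1 =>
    obtain ⟨E, hE, hE0, hEf, rfl⟩ := h1
    rcases eq_or_ne t 0 with rfl | ht
    · exact ⟨E, hE, hE0, hEf, by rw [waveIsotony, if_pos rfl]⟩
    · have ht' : 0 < t := pos_iff_ne_zero.2 ht
      refine ⟨Metric.thickening t E ∩ Ioi 0, Metric.isOpen_thickening.inter isOpen_Ioi,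
        inter_subset_right, volume_frontier_inter (volume_frontier_thickening ht')
          (volume_frontier_Ioi 0), ?_⟩
      rw [waveIsotony_L2On hφ hq hE hE0 ht', ← L2On_inf, L2On_of_Ioi_subset subset_rfl, inf_top_eq]

theorem waveLattice_Ioo (hφ : IsKernelVector hA φ) (hq : ContDiffOn ℝ ∞ q (Ici 0)) (a b : ℝ≥0) :
    WaveLattice (slOp q) hA (L2On (Ioo (a : ℝ) b)) := by
  have h := (WaveLattice.reachable (A := slOp q) (hA := hA) b).inf
    (WaveLattice.reachable (A := slOp q) (hA := hA) a).orthogonal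
  rw [reachableSubspace_eq hφ hq, reachableSubspace_eq hφ hq, orthogonal_L2On measurableSet_Ioo,
    L2On_inf] at h
  convert h using 1
  refine L2On_congr ?_
  have hne : ∀ᵐ s ∂halfLine, s ≠ (a : ℝ) := ae_restrict_of_ae (Measure.ae_ne volume (a : ℝ))
  filter_upwards [hne, ae_restrict_mem measurableSet_Ioi] with s h1 h2
  refine ⟨fun h3 => ⟨⟨h2, h3.2⟩, fun h4 => lt_asymm h3.1 h4.2⟩, fun h3 => ⟨?_, h3.1.2⟩⟩
  exact lt_of_le_of_ne (not_lt.1 fun h4 => h3.2 ⟨h2, h4⟩) h1.symm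

theorem measurableSet_abs_sub_lt (x t : ℝ) : MeasurableSet {s : ℝ | |s - x| < t} :=
  (isOpen_lt (by fun_prop) continuous_const).measurableSet

/-- Intervals shrinking to `x` from the right serve also for `x = 0`. Their neighbourhoods converge
pointwise to the ball except at `x + t`, and at `t = 0` the intervals themselves shrink to nothing.
-/
theorem atomAt_mem_completedFunctions (hφ : IsKernelVector hA φ) (hq : ContDiffOn ℝ ∞ q (Ici 0))
    (x : ℝ≥0) : atomAt x ∈ completedFunctions (slOp q) hA := by
  set E : ℕ → Set ℝ := fun n => Ioo (x : ℝ) ((x + 1 / ((n : ℝ≥0) + 1) : ℝ≥0) : ℝ) with hE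
  have hend : ∀ n : ℕ, (((x + 1 / ((n : ℝ≥0) + 1) : ℝ≥0)) : ℝ) = x + 1 / ((n : ℝ) + 1) := fun n => by
    push_cast
    rfl
  have hlim : Tendsto (fun n : ℕ => 1 / ((n : ℝ) + 1)) atTop (𝓝 0) :=
    tendsto_one_div_add_atTop_nhds_zero_nat
  have hE0 : ∀ n, E n ⊆ Ioi 0 := fun n s hs => x.coe_nonneg.trans_lt hs.1
  refine ⟨fun n => L2On (E n), fun n => waveLattice_Ioo hφ hq _ _, fun t y => ?_⟩
  rcases eq_or_ne t 0 with rfl | ht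
  · have e0 : ∀ n, waveIsotony (slOp q) hA 0 (L2On (E n)) = L2On (E n) := fun n => by
      rw [waveIsotony, if_pos rfl]
    simp only [e0]
    refine tendsto_proj_L2On (fun n => measurableSet_Ioo) (measurableSet_abs_sub_lt _ _)
      (Eventually.of_forall fun s => ?_) y
    have hno : s ∉ {s : ℝ | |s - x| < ((0 : ℝ≥0) : ℝ)} := fun h => by
      have h1 : |s - x| < ((0 : ℝ≥0) : ℝ) := h
      exact absurd h1 (not_lt.2 (abs_nonneg _))
    rcases le_or_gt s x with h | h
    · exact Eventually.of_forall fun n =>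
        ⟨fun h1 => absurd h1.1 (not_lt.2 h), fun h1 => absurd h1 hno⟩
    · filter_upwards [hlim.eventually (gt_mem_nhds (sub_pos.2 h))] with n hn
      refine ⟨fun h1 => ?_, fun h1 => absurd h1 hno⟩
      have := h1.2
      rw [hend] at this
      linarith
  · have ht' : 0 < t := pos_iff_ne_zero.2 ht
    have ht0 : (0 : ℝ) < t := ht'
    have e1 : ∀ n, waveIsotony (slOp q) hA t (L2On (E n)) = L2On (Metric.thickening t (E n)) :=
      fun n => waveIsotony_L2On hφ hq isOpen_Ioo (hE0 n) ht'
    simp only [e1]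
    refine tendsto_proj_L2On (fun n => Metric.isOpen_thickening.measurableSet)
      (measurableSet_abs_sub_lt _ _) ?_ y
    have hne : ∀ᵐ s ∂halfLine, s ≠ (x + t : ℝ) := ae_restrict_of_ae (Measure.ae_ne volume _)
    filter_upwards [hne] with s hs
    by_cases h : |s - x| < t
    · refine Eventually.of_forall fun n => ⟨fun _ => h, fun _ => ?_⟩
      have hp : (0 : ℝ) < 1 / ((n : ℝ) + 1) := by positivity
      set d := min (1 / ((n : ℝ) + 1) / 2) ((t - |s - x|) / 2) with hd
      have hd0 : 0 < d := lt_min (by linarith) (by linarith)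
      have hd1 : d ≤ 1 / ((n : ℝ) + 1) / 2 := min_le_left _ _
      have hd2 : d ≤ (t - |s - x|) / 2 := min_le_right _ _
      refine Metric.mem_thickening_iff.2 ⟨x + d, ⟨by linarith, by rw [hend]; linarith⟩, ?_⟩
      rw [Real.dist_eq]
      have := abs_sub_abs_le_abs_sub (s - x) d
      calc |s - (x + d)| = |(s - x) - d| := by ring_nf
        _ ≤ |s - x| + |d| := abs_sub _ _
        _ < t := by rw [abs_of_pos hd0]; linarith
    · have hx : ∀ᶠ n : ℕ in atTop, s ∉ Metric.thickening t (E n) := by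
        rcases le_abs.1 (not_lt.1 h) with h1 | h1
        · replace h1 : (t : ℝ) < s - x :=
            lt_of_le_of_ne h1 fun h2 => hs (by linarith)
          filter_upwards [hlim.eventually (gt_mem_nhds (show 0 < s - x - t by linarith))] with n hn
          intro hm
          obtain ⟨z, hz, hsz⟩ := Metric.mem_thickening_iff.1 hm
          have := hz.2
          rw [hend] at this
          rw [Real.dist_eq, abs_lt] at hsz
          linarith [hsz.2]
        · refine Eventually.of_forall fun n hm => ?_
          obtain ⟨z, hz, hsz⟩ := Metric.mem_thickening_iff.1 hm
          rw [Real.dist_eq, abs_lt] at hsz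
          linarith [hsz.1, hz.1]
      filter_upwards [hx] with n hn
      exact ⟨fun h1 => absurd h1 hn, fun h1 => absurd h1 h⟩

/-- At half the distance of `x` and `x'` the two balls are disjoint. -/
theorem atomAt_le_imp_eq {x x' : ℝ≥0} (h : atomAt x ≤ atomAt x') : x = x' := by
  by_contra hne
  have hpos : 0 < |(x : ℝ) - x'| := abs_pos.2 (sub_ne_zero.2 fun h => hne (NNReal.coe_injective h))
  set t : ℝ≥0 := ⟨|(x : ℝ) - x'| / 2, by positivity⟩ with ht
  have htv : (t : ℝ) = |(x : ℝ) - x'| / 2 := rfl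
  obtain ⟨y, hy, hy0⟩ := exists_ne_zero_mem_L2On (a := x) (b := x + t) x.coe_nonneg
    (by rw [htv]; linarith)
  have h1 : y ∈ atomAt x t := L2On_mono (fun s hs => by
    change |s - x| < t
    rw [abs_of_pos (by linarith [hs.1])]
    linarith [hs.2]) hy
  have h2 : y ∈ L2On {s : ℝ | |s - x'| < t} := h t h1
  refine hy0 (eq_zero_of_mem_disjoint (Set.disjoint_left.2 fun s h3 h4 => ?_) hy h2)
  have h5 : |s - x'| < t := h4
  have h6 := abs_sub_le (x : ℝ) s x'
  have h7 : |(x : ℝ) - s| < t := by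
    rw [abs_of_neg (by linarith [h3.1])]
    linarith [h3.2]
  linarith

theorem atomAt_ne_bot (x : ℝ≥0) : atomAt x ≠ fun _ => ⊥ := by
  intro h
  obtain ⟨y, hy, hy0⟩ := exists_ne_zero_mem_L2On (a := x) (b := x + 1) x.coe_nonneg (by linarith)
  have h1 : y ∈ atomAt x 1 := L2On_mono (fun s hs => by
    change |s - x| < ((1 : ℝ≥0) : ℝ)
    rw [abs_of_pos (by linarith [hs.1]), NNReal.coe_one]
    linarith [hs.2]) hy
  rw [h] at h1
  exact hy0 h1

/-- The restrictions to smaller balls exhaust the functions on a ball. -/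
theorem atomAt_le_of_forall_lt {x t : ℝ≥0} {M : ClosedSubmodule ℂ L2Half}
    (h : ∀ r : ℝ, r < t → L2On {s : ℝ | |s - x| < r} ≤ M) : atomAt x t ≤ M := by
  intro y hy
  have hlim := tendsto_proj_L2On (E := fun n : ℕ => {s : ℝ | |s - x| < t - 1 / ((n : ℝ) + 1)})
    (F := {s : ℝ | |s - x| < t}) (fun n => measurableSet_abs_sub_lt _ _)
    (measurableSet_abs_sub_lt _ _) (Eventually.of_forall fun s => ?_) y
  · rw [proj_eq_self.2 (show y ∈ L2On {s : ℝ | |s - x| < t} from hy)] at hlim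
    refine M.isClosed.mem_of_tendsto hlim (Eventually.of_forall fun n => ?_)
    have hp : (0 : ℝ) < 1 / ((n : ℝ) + 1) := by positivity
    exact h _ (by linarith) (Submodule.starProjection_apply_mem _ _)
  · by_cases hs : |s - x| < t
    · filter_upwards [tendsto_one_div_add_atTop_nhds_zero_nat.eventually
        (gt_mem_nhds (sub_pos.2 hs))] with n hn
      refine ⟨fun _ => hs, fun _ => ?_⟩
      have h1 : |s - x| < t - 1 / ((n : ℝ) + 1) := by linarith
      exact h1
    · refine Eventually.of_forall fun n => ⟨fun h1 => absurd ?_ hs, fun h1 => absurd h1 hs⟩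
      have hp : (0 : ℝ) < 1 / ((n : ℝ) + 1) := by positivity
      have : |s - x| < t - 1 / ((n : ℝ) + 1) := h1
      linarith

/-- A nonzero limit prevents the approximating sets from escaping to infinity. Any limit point `x`
of points chosen in them has its balls asymptotically covered by their neighbourhoods. -/
theorem exists_atomAt_le (hφ : IsKernelVector hA φ) (hq : ContDiffOn ℝ ∞ q (Ici 0))
    {α : ℝ≥0 → ClosedSubmodule ℂ L2Half} (hα : α ∈ completedFunctions (slOp q) hA)
    (h0 : α ≠ fun _ => ⊥) : ∃ x : ℝ≥0, atomAt x ≤ α := by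
  obtain ⟨M, hM, hlim⟩ := hα
  choose E hE hE0 hEf hME using fun n => waveLattice_eq_L2On hφ hq (hM n)
  have iso : ∀ (t : ℝ≥0), 0 < t → ∀ n,
      waveIsotony (slOp q) hA t (M n) = L2On (Metric.thickening t (E n)) := fun t ht n => by
    rw [hME, waveIsotony_L2On hφ hq (hE n) (hE0 n) ht]
  -- A value at time `0` is moved to time `1` by monotonicity, so that the neighbourhood description
  -- applies.
  obtain ⟨t₀, ht₀, y, hy, hy0⟩ : ∃ t₀ : ℝ≥0, 0 < t₀ ∧ ∃ y ∈ α t₀, y ≠ 0 := by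
    obtain ⟨t, ht⟩ : ∃ t, α t ≠ ⊥ := by
      by_contra! h
      exact h0 (funext h)
    obtain ⟨y, hy, hy0⟩ : ∃ y ∈ α t, y ≠ 0 := by
      by_contra! h
      exact ht (le_bot_iff.1 fun y hy => h y hy)
    rcases eq_or_ne t 0 with rfl | ht
    · refine ⟨1, one_pos, y, le_of_tendsto_proj (fun n => ?_) (hlim 0) (hlim 1) hy, hy0⟩
      rw [iso 1 one_pos, waveIsotony, if_pos rfl, hME]
      exact L2On_mono (Metric.self_subset_thickening (by simp) _)
    · exact ⟨t, pos_iff_ne_zero.2 ht, y, hy, hy0⟩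
  -- Otherwise, for each `R`, infinitely many `E n` avoid `[0, R + t₀]`, and their neighbourhoods
  -- then avoid `[0, R)`. In the limit `y` would vanish on every bounded interval.
  obtain ⟨R, hR⟩ : ∃ R : ℝ, ∀ᶠ n in atTop, (E n ∩ Icc 0 R).Nonempty := by
    by_contra! hcon
    refine hy0 ?_
    have hfar : ∀ R : ℕ, y ∈ L2On (Ici (R : ℝ)) := by
      intro R
      have hl := hlim t₀ y
      rw [proj_eq_self.2 hy] at hl
      refine (L2On (Ici (R : ℝ))).isClosed.mem_of_frequently_of_tendsto ?_ hl
      refine (hcon (R + t₀)).mono fun n hn => ?_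
      rw [iso t₀ ht₀]
      refine L2On_mono (fun s hs => ?_) (Submodule.starProjection_apply_mem
        (L2On (Metric.thickening t₀ (E n))).toSubmodule y)
      obtain ⟨z, hz, hsz⟩ := Metric.mem_thickening_iff.1 hs
      by_contra hs'
      have hs'' : s < R := not_le.1 hs'
      rw [Real.dist_eq, abs_lt] at hsz
      have : z ∈ E n ∩ Icc 0 (R + t₀ : ℝ) := ⟨hz, le_of_lt (hE0 n hz), by linarith [hsz.1]⟩
      exact (Set.not_nonempty_iff_eq_empty.1 (not_nonempty_iff_eq_empty.2 hn) ▸ this : z ∈ (∅ : Set ℝ))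
    have hz : y =ᵐ[halfLine] (0 : L2Half) := by
      filter_upwards [ae_all_iff.2 fun R => mem_L2On.1 (hfar R), Lp.coeFn_zero ℂ 2 halfLine]
        with s h1 h2
      obtain ⟨R, hR⟩ := exists_nat_gt s
      rw [h1 R (not_le.2 hR), h2, Pi.zero_apply]
    exact Lp.ext hz
  obtain ⟨N, hN⟩ := eventually_atTop.1 hR
  choose z hz using fun n => hN (n + N) (Nat.le_add_left N n)
  obtain ⟨x, hx, k, hk, hkx⟩ := isCompact_Icc.tendsto_subseq fun n => (hz n).2
  refine ⟨⟨x, hx.1⟩, fun t => ?_⟩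
  refine atomAt_le_of_forall_lt fun r hr y hy => ?_
  rcases eq_or_ne t 0 with rfl | ht
  · have : {s : ℝ | |s - x| < r} = ∅ := by
      refine eq_empty_of_forall_notMem fun s hs => ?_
      have h1 : |s - x| < r := hs
      rw [NNReal.coe_zero] at hr
      linarith [abs_nonneg (s - x)]
    have hy' : y ∈ L2On {s : ℝ | |s - x| < r} := hy
    rw [this, L2On_empty, ClosedSubmodule.mem_bot] at hy'
    rw [hy']
    exact zero_mem (α 0)
  · have ht' : 0 < t := pos_iff_ne_zero.2 ht
    have hsub : Tendsto (fun j => k j + N) atTop atTop :=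
      tendsto_atTop_mono (fun j => Nat.le_add_right _ _) hk.tendsto_atTop
    have hl := (hlim t y).comp hsub
    refine proj_eq_self.1 (tendsto_nhds_unique hl (tendsto_const_nhds.congr' ?_))
    -- Once the chosen point is within `t - r` of `x`, its ball of radius `t` contains the ball of
    -- radius `r` about `x`.
    have hnear := hkx.eventually (Metric.ball_mem_nhds x (sub_pos.2 hr))
    filter_upwards [hnear] with j hj
    refine (proj_eq_self.2 ?_).symm
    rw [iso t ht']
    refine L2On_mono (fun s hs => ?_) hy
    refine Metric.mem_thickening_iff.2 ⟨z (k j), (hz (k j)).1, ?_⟩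
    have h1 : |s - x| < r := hs
    have h2 : |z (k j) - x| < t - r := hj
    rw [Real.dist_eq]
    have h3 := abs_sub_le s x (z (k j))
    rw [abs_sub_comm x] at h3
    linarith

/-- The wave spectrum consists of the functions `atomAt x`. -/
theorem mem_waveSpectrum_iff (hφ : IsKernelVector hA φ) (hq : ContDiffOn ℝ ∞ q (Ici 0))
    {α : ℝ≥0 → ClosedSubmodule ℂ L2Half} :
    α ∈ waveSpectrum (slOp q) hA ↔ ∃ x, atomAt x = α := by
  constructor
  · rintro ⟨h1, h2, h3⟩
    obtain ⟨x, hx⟩ := exists_atomAt_le hφ hq h1 h2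
    exact ⟨x, h3 _ (atomAt_mem_completedFunctions hφ hq x) (atomAt_ne_bot x) hx⟩
  · rintro ⟨x, rfl⟩
    refine ⟨atomAt_mem_completedFunctions hφ hq x, atomAt_ne_bot x, fun α' h1 h2 h3 => ?_⟩
    obtain ⟨x', hx'⟩ := exists_atomAt_le hφ hq h1 h2
    obtain rfl := atomAt_le_imp_eq (hx'.trans h3)
    exact le_antisymm h3 hx'

end Atoms

/-! ### Eikonals as multiplication operators and their distance. -/

section Eikonal

/-- The values of the Riemann–Stieltjes sums of `∫ t dP` at a point with `inf {t | d < t} = d`. -/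
theorem abs_stieltjesSum_sub_le {T : ℝ≥0} (π : TaggedPartition T) {δ d : ℝ} (hd : 0 ≤ d)
    (hπ : ∀ i < π.n, (π.t (i + 1) : ℝ) - π.t i < δ) :
    |∑ i ∈ Finset.range π.n, (π.s i : ℝ) * ((if d < π.t (i + 1) then 1 else 0) -
      (if d < π.t i then 1 else 0)) - (if d < T then d else 0)| ≤ δ * (if d < T then 1 else 0) := by
  have htel : ∑ i ∈ Finset.range π.n, (((if d < π.t (i + 1) then 1 else 0) : ℝ) -
      (if d < π.t i then 1 else 0)) = if d < T then 1 else 0 := by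
    rw [Finset.sum_range_sub fun i => ((if d < π.t i then 1 else 0) : ℝ), π.left, π.right]
    rw [NNReal.coe_zero, if_neg (not_lt.2 hd), sub_zero]
  -- Writing `d` times the telescoping sum compares term by term: each tag is within `δ` of `d` on
  -- the only subinterval where the jump occurs.
  have h1 : (if d < (T : ℝ) then d else 0) = ∑ i ∈ Finset.range π.n,
      d * (((if d < π.t (i + 1) then 1 else 0) : ℝ) - (if d < π.t i then 1 else 0)) := by
    rw [← Finset.mul_sum, htel]
    split_ifs <;> simp
  rw [h1, ← htel, ← Finset.sum_sub_distrib, Finset.mul_sum]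
  refine (Finset.abs_sum_le_sum_abs _ _).trans (Finset.sum_le_sum fun i hi => ?_)
  have hi' := Finset.mem_range.1 hi
  have hm : (π.t i : ℝ) ≤ π.t (i + 1) := NNReal.coe_le_coe.2 (π.mono (Nat.le_succ i))
  obtain ⟨hs1, hs2⟩ := π.tag i hi'
  have hs1' : (π.t i : ℝ) ≤ π.s i := hs1
  have hs2' : (π.s i : ℝ) ≤ π.t (i + 1) := hs2
  have hδ := hπ i hi'
  rw [← sub_mul]
  by_cases h2 : d < π.t (i + 1)
  · by_cases h3 : d < π.t i
    · simp [h2, h3]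
    · simp only [h2, h3, if_true, if_false, sub_zero, mul_one]
      rw [abs_le]
      constructor <;> linarith
  · have h3 : ¬ d < π.t i := fun h => h2 (h.trans_le hm)
    simp [h2, h3]

theorem mem_meshFilter (T : ℝ≥0) {δ : ℝ} (hδ : 0 < δ) :
    {π : TaggedPartition T | ∀ i < π.n, (π.t (i + 1) : ℝ) - π.t i < δ} ∈ meshFilter T :=
  mem_iInf_of_mem δ (mem_iInf_of_mem hδ (mem_principal_self _))

/-- The uniform partition with `n + 1` pieces. -/
def uniformPartition (T : ℝ≥0) (n : ℕ) : TaggedPartition T where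
  n := n + 1
  t i := min (i * (T / (n + 1))) T
  s i := min (i * (T / (n + 1))) T
  mono i j h := by
    have : (i : ℝ≥0) ≤ j := by exact_mod_cast h
    exact min_le_min_right _ (mul_le_mul_left this _)
  left := by simp
  right := by
    have : ((n : ℝ≥0) + 1) ≠ 0 := by positivity
    push_cast
    rw [mul_div_cancel₀ _ this, min_self]
  tag i _ := by
    refine ⟨le_rfl, ?_⟩
    have : (i : ℝ≥0) ≤ (i + 1 : ℕ) := by exact_mod_cast Nat.le_succ i
    exact min_le_min_right _ (mul_le_mul_left this _)

/-- Needed for uniqueness of limits along the mesh filter, hence of the truncated integrals. -/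
instance meshFilter_neBot (T : ℝ≥0) : (meshFilter T).NeBot := by
  have h : Tendsto (uniformPartition T) atTop (meshFilter T) := by
    refine tendsto_iInf.2 fun δ => tendsto_iInf.2 fun hδ => tendsto_principal.2 ?_
    have hlim : Tendsto (fun n : ℕ => (T : ℝ) / ((n : ℝ) + 1)) atTop (𝓝 0) := by
      have := tendsto_one_div_add_atTop_nhds_zero_nat.const_mul (T : ℝ)
      simpa only [mul_one_div, mul_zero] using this
    filter_upwards [hlim.eventually (gt_mem_nhds (show (0 : ℝ) < δ from hδ))] with n hn i _
    simp only [uniformPartition, NNReal.coe_min, NNReal.coe_mul, NNReal.coe_natCast,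
      NNReal.coe_div, NNReal.coe_add, NNReal.coe_one]
    push_cast
    have h0 : (0 : ℝ) ≤ T / ((n : ℝ) + 1) := by positivity
    have h1 : ((i : ℝ) + 1) * (T / ((n : ℝ) + 1)) = i * (T / ((n : ℝ) + 1)) + T / ((n : ℝ) + 1) := by
      ring
    rw [h1]
    rcases le_total ((i : ℝ) * (T / ((n : ℝ) + 1))) T with h2 | h2
    · rw [min_eq_left h2]
      linarith [min_le_left ((i : ℝ) * (T / ((n : ℝ) + 1)) + T / ((n : ℝ) + 1)) (T : ℝ)]
    · rw [min_eq_right h2]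
      linarith [min_le_right ((i : ℝ) * (T / ((n : ℝ) + 1)) + T / ((n : ℝ) + 1)) (T : ℝ)]
  exact h.neBot

theorem L2Half.coeFn_sum_smul (n : ℕ) (c : ℕ → ℂ) (f : ℕ → L2Half) :
    (∑ i ∈ Finset.range n, c i • f i : L2Half) =ᵐ[halfLine]
      fun s => ∑ i ∈ Finset.range n, c i * f i s := by
  induction n with
  | zero =>
    filter_upwards [Lp.coeFn_zero ℂ 2 halfLine] with s h
    simpa using h
  | succ n ih =>
    rw [Finset.sum_range_succ]
    filter_upwards [ih, Lp.coeFn_add (∑ i ∈ Finset.range n, c i • f i) (c n • f n),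
      Lp.coeFn_smul (c n) (f n)] with s h1 h2 h3
    rw [h2, Pi.add_apply, h1, h3, Pi.smul_apply, Finset.sum_range_succ, smul_eq_mul]

theorem truncatedEikonal_memLp (x : ℝ) (T : ℝ≥0) (y : L2Half) :
    MemLp (fun s => ((if |s - x| < T then |s - x| else 0 : ℝ) : ℂ) * y s) 2 halfLine := by
  refine MemLp.of_le_mul (c := T) (Lp.memLp y) ?_ (Eventually.of_forall fun s => ?_)
  · refine AEStronglyMeasurable.mul ?_ (Lp.aestronglyMeasurable y)
    refine (Complex.measurable_ofReal.comp (Measurable.ite (measurableSet_abs_sub_lt x T) ?_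
      measurable_const)).aestronglyMeasurable
    fun_prop
  · rw [norm_mul, Complex.norm_real]
    refine mul_le_mul_of_nonneg_right ?_ (norm_nonneg _)
    split_ifs with h
    · rw [Real.norm_eq_abs, abs_abs]
      exact h.le
    · simp

/-- The truncated eikonal `∫_{[0,T]} t dP` of `atomAt x`: multiplication by `|s - x|` on the ball of
radius `T`. -/
def truncatedEikonal (x : ℝ) (T : ℝ≥0) (y : L2Half) : L2Half := (truncatedEikonal_memLp x T y).toLp _

theorem truncatedEikonal_coeFn (x : ℝ) (T : ℝ≥0) (y : L2Half) :
    truncatedEikonal x T y =ᵐ[halfLine]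
      fun s => ((if |s - x| < T then |s - x| else 0 : ℝ) : ℂ) * y s := MemLp.coeFn_toLp _

theorem norm_riemannSum_sub_le (x : ℝ≥0) {T : ℝ≥0} (π : TaggedPartition T) {δ : ℝ} (hδ : 0 ≤ δ)
    (hπ : ∀ i < π.n, (π.t (i + 1) : ℝ) - π.t i < δ) (y : L2Half) :
    ‖riemannSum (atomAt x) π y - truncatedEikonal x T y‖ ≤ δ * ‖y‖ := by
  refine Lp.norm_le_mul_norm_of_ae_le_mul ?_
  have hP : ∀ t : ℝ≥0, proj (atomAt x t) y =ᵐ[halfLine]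
      fun s => ((if |s - x| < t then 1 else 0 : ℝ) : ℂ) * y s := fun t => by
    filter_upwards [proj_L2On_coeFn (measurableSet_abs_sub_lt x t) y] with s hs
    rw [atomAt, hs]
    by_cases h : |s - x| < t
    · rw [indicator_of_mem (s := {s : ℝ | |s - x| < t}) h, if_pos h, Complex.ofReal_one, one_mul]
    · rw [indicator_of_notMem (s := {s : ℝ | |s - x| < t}) h, if_neg h, Complex.ofReal_zero,
        zero_mul]
  filter_upwards [Lp.coeFn_sub (riemannSum (atomAt x) π y) (truncatedEikonal x T y),
    truncatedEikonal_coeFn x T y, L2Half.coeFn_sum_smul π.n (fun i => ((π.s i : ℝ) : ℂ))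
      (fun i => proj (atomAt x (π.t (i + 1))) y - proj (atomAt x (π.t i)) y),
    ae_all_iff.2 fun i => hP (π.t i),
    ae_all_iff.2 fun i => Lp.coeFn_sub (proj (atomAt x (π.t (i + 1))) y)
      (proj (atomAt x (π.t i)) y)] with s h1 h2 h3 h4 h5
  have h6 : riemannSum (atomAt x) π y s = ((∑ i ∈ Finset.range π.n, (π.s i : ℝ) *
      ((if |s - x| < π.t (i + 1) then 1 else 0) - (if |s - x| < π.t i then 1 else 0)) : ℝ) : ℂ) *
      y s := by
    rw [riemannSum, h3, Complex.ofReal_sum, Finset.sum_mul]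
    refine Finset.sum_congr rfl fun i _ => ?_
    rw [h5, Pi.sub_apply, h4, h4, ← sub_mul, Complex.ofReal_mul, Complex.ofReal_sub, mul_assoc]
  rw [h1, Pi.sub_apply, h2, h6, ← sub_mul, norm_mul, ← Complex.ofReal_sub, Complex.norm_real,
    Real.norm_eq_abs]
  refine mul_le_mul_of_nonneg_right ?_ (norm_nonneg _)
  refine (abs_stieltjesSum_sub_le π (abs_nonneg _) hπ).trans ?_
  split_ifs <;> simp [hδ]

theorem tendsto_riemannSum (x T : ℝ≥0) (y : L2Half) :
    Tendsto (fun π : TaggedPartition T => riemannSum (atomAt x) π y) (meshFilter T)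
      (𝓝 (truncatedEikonal x T y)) := by
  rw [Metric.tendsto_nhds]
  intro ε hε
  have hδ : 0 < ε / (‖y‖ + 1) := by positivity
  filter_upwards [mem_meshFilter T hδ] with π hπ
  rw [dist_eq_norm]
  refine (norm_riemannSum_sub_le x π hδ.le hπ y).trans_lt ?_
  rw [div_mul_eq_mul_div, div_lt_iff₀ (by positivity)]
  have := norm_nonneg y
  nlinarith

theorem mem_eikonalGraph_iff {x : ℝ≥0} {y w : L2Half} : (y, w) ∈ eikonalGraph (atomAt x) ↔
    Tendsto (fun T => truncatedEikonal x T y) atTop (𝓝 w) := by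
  constructor
  · rintro ⟨J, hJ, hw⟩
    have : J = fun T => truncatedEikonal x T y := funext fun T =>
      tendsto_nhds_unique (hJ T) (tendsto_riemannSum x T y)
    rwa [this] at hw
  · exact fun h => ⟨_, fun T => tendsto_riemannSum x T y, h⟩

/-- On each ball about `x` the truncated eikonals are eventually constant, which fixes the limit
there. -/
theorem ae_eq_of_mem_eikonalGraph {x : ℝ≥0} {y w : L2Half}
    (h : (y, w) ∈ eikonalGraph (atomAt x)) : w =ᵐ[halfLine] fun s => ((|s - x| : ℝ) : ℂ) * y s := by
  rw [mem_eikonalGraph_iff] at h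
  have hT : ∀ n : ℕ, w - truncatedEikonal x n y ∈ L2On {s : ℝ | |s - x| < ((n : ℝ≥0) : ℝ)}ᶜ := by
    intro n
    refine (L2On _).isClosed.mem_of_tendsto (h.sub_const _) ?_
    filter_upwards [eventually_ge_atTop (n : ℝ≥0)] with T hT
    filter_upwards [Lp.coeFn_sub (truncatedEikonal x T y) (truncatedEikonal x n y),
      truncatedEikonal_coeFn x T y, truncatedEikonal_coeFn x n y] with s h1 h2 h3 h4
    have h5 : |s - x| < ((n : ℝ≥0) : ℝ) := not_not.1 h4
    rw [h1, Pi.sub_apply, h2, h3, if_pos h5, if_pos (h5.trans_le (NNReal.coe_le_coe.2 hT)), sub_self]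
  filter_upwards [ae_all_iff.2 fun n => mem_L2On.1 (hT n),
    ae_all_iff.2 fun n : ℕ => Lp.coeFn_sub w (truncatedEikonal x n y),
    ae_all_iff.2 fun n : ℕ => truncatedEikonal_coeFn x n y] with s h1 h2 h3
  obtain ⟨n, hn⟩ := exists_nat_gt |s - x|
  have hn' : |s - x| < ((n : ℝ≥0) : ℝ) := by simpa using hn
  have h4 := h1 n (not_not.2 hn')
  rwa [h2, Pi.sub_apply, h3, if_pos hn', sub_eq_zero] at h4

/-- The pointwise formula makes the relation single-valued, so that `toLinearPMap` has it as its
graph. -/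
theorem eikonal_graph (x : ℝ≥0) : (eikonal (atomAt x)).graph = eikonalGraph (atomAt x) := by
  refine Submodule.toLinearPMap_graph_eq _ ?_
  rintro ⟨y, w⟩ hp (rfl : y = 0)
  refine Lp.ext ?_
  filter_upwards [ae_eq_of_mem_eikonalGraph hp, Lp.coeFn_zero ℂ 2 halfLine] with s h1 h2
  rw [h1, h2, Pi.zero_apply, mul_zero]

theorem eikonal_apply_ae_eq {x : ℝ≥0} (y : (eikonal (atomAt x)).domain) :
    eikonal (atomAt x) y =ᵐ[halfLine] fun s => ((|s - x| : ℝ) : ℂ) * (y : L2Half) s := by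
  refine ae_eq_of_mem_eikonalGraph ?_
  rw [← eikonal_graph]
  exact LinearPMap.mem_graph _ y

theorem mem_eikonal_domain {x : ℝ≥0} {y : L2Half} {R : ℝ} (hy : y ∈ L2On (Iio R)) :
    y ∈ (eikonal (atomAt x)).domain := by
  set T₀ : ℝ≥0 := R.toNNReal + x with hT₀
  refine LinearPMap.mem_domain_of_mem_graph (y := truncatedEikonal x T₀ y) ?_
  rw [eikonal_graph, mem_eikonalGraph_iff]
  refine tendsto_const_nhds.congr' ?_
  filter_upwards [eventually_ge_atTop T₀] with T hT
  refine Lp.ext ?_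
  filter_upwards [truncatedEikonal_coeFn x T y, truncatedEikonal_coeFn x T₀ y, mem_L2On.1 hy,
    ae_restrict_mem measurableSet_Ioi] with s h1 h2 h3 h4
  rw [h1, h2]
  by_cases hs : s < R
  · have h4' : (0 : ℝ) < s := h4
    have h5 : |s - x| < (T₀ : ℝ) := by
      rw [hT₀, NNReal.coe_add, Real.coe_toNNReal R (by linarith), abs_lt]
      have := x.coe_nonneg
      constructor <;> linarith
    rw [if_pos h5, if_pos (h5.trans_le (NNReal.coe_le_coe.2 hT))]
  · rw [h3 hs, mul_zero, mul_zero]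

theorem mem_eikonal_sub_domain {x x' : ℝ≥0} {y : L2Half} {R : ℝ} (hy : y ∈ L2On (Iio R)) :
    y ∈ (eikonal (atomAt x) - eikonal (atomAt x')).domain := by
  rw [LinearPMap.sub_domain]
  exact ⟨mem_eikonal_domain hy, mem_eikonal_domain hy⟩

/-- Functions vanishing beyond some point lie in both domains, and truncations converge. -/
theorem eikonal_sub_domain_dense (x x' : ℝ≥0) :
    Dense ((eikonal (atomAt x) - eikonal (atomAt x')).domain : Set L2Half) := by
  intro y
  have h := tendsto_proj_L2On (E := fun n : ℕ => Iio (n : ℝ)) (F := univ)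
    (fun n => measurableSet_Iio) MeasurableSet.univ (Eventually.of_forall fun s => by
      filter_upwards [tendsto_natCast_atTop_atTop.eventually (eventually_gt_atTop s)] with n hn
      exact ⟨fun _ => mem_univ s, fun _ => hn⟩) y
  rw [L2On_of_Ioi_subset (subset_univ _), proj_eq_self.2 ClosedSubmodule.mem_top] at h
  exact mem_closure_of_tendsto h (Eventually.of_forall fun n =>
    mem_eikonal_sub_domain (Submodule.starProjection_apply_mem _ _))

theorem eikonal_sub_apply_ae_eq {x x' : ℝ≥0}
    (y : (eikonal (atomAt x) - eikonal (atomAt x')).domain) :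
    (eikonal (atomAt x) - eikonal (atomAt x')) y =ᵐ[halfLine]
      fun s => ((|s - x| - |s - x'| : ℝ) : ℂ) * (y : L2Half) s := by
  rw [LinearPMap.sub_apply]
  filter_upwards [Lp.coeFn_sub (eikonal (atomAt x) ⟨y, y.2.1⟩) (eikonal (atomAt x') ⟨y, y.2.2⟩),
    eikonal_apply_ae_eq (x := x) ⟨y, y.2.1⟩, eikonal_apply_ae_eq (x := x') ⟨y, y.2.2⟩]
    with s h1 h2 h3
  rw [h1, Pi.sub_apply, h2, h3, ← sub_mul, Complex.ofReal_sub]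

theorem eikonalDist_atomAt (x x' : ℝ≥0) :
    eikonalDist (atomAt x) (atomAt x') = ENNReal.ofReal |(x : ℝ) - x'| := by
  refine le_antisymm (iSup_le fun y => iSup_le fun hy => ?_) ?_
  · rw [← ofReal_norm]
    refine ENNReal.ofReal_le_ofReal ?_
    refine (Lp.norm_le_mul_norm_of_ae_le_mul (c := |(x : ℝ) - x'|) (g := (y : L2Half)) ?_).trans
      (mul_le_of_le_one_right (abs_nonneg _) hy)
    filter_upwards [eikonal_sub_apply_ae_eq y] with s hs
    rw [hs, norm_mul, Complex.norm_real, Real.norm_eq_abs]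
    refine mul_le_mul_of_nonneg_right ((abs_abs_sub_abs_le _ _).trans_eq ?_) (norm_nonneg _)
    rw [sub_sub_sub_cancel_left, abs_sub_comm]
  -- To the right of both points the multiplier `|s - x| - |s - x'|` is the constant `x' - x`, so
  -- any normalised function supported there attains the bound.
  · obtain ⟨y₀, hy₀, hne⟩ := exists_ne_zero_mem_L2On (a := max (x : ℝ) x')
      (b := max (x : ℝ) x' + 1)
      (le_max_of_le_left x.coe_nonneg) (by linarith)
    set y : L2Half := ((‖y₀‖⁻¹ : ℝ) : ℂ) • y₀ with hy
    have hnorm : ‖y‖ = 1 := by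
      rw [hy, norm_smul, Complex.norm_real, norm_inv, norm_norm,
        inv_mul_cancel₀ (norm_ne_zero_iff.2 hne)]
    have hmem : y ∈ L2On (Ioo (max (x : ℝ) x') (max (x : ℝ) x' + 1)) :=
      (L2On _).smul_mem' _ hy₀
    have hdom : y ∈ (eikonal (atomAt x) - eikonal (atomAt x')).domain :=
      mem_eikonal_sub_domain (L2On_mono (fun s hs => hs.2) hmem)
    have hval : (eikonal (atomAt x) - eikonal (atomAt x')) ⟨y, hdom⟩ =
        (((x' : ℝ) - x : ℝ) : ℂ) • y := by
      refine Lp.ext ?_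
      filter_upwards [eikonal_sub_apply_ae_eq ⟨y, hdom⟩, mem_L2On.1 hmem,
        Lp.coeFn_smul (((x' : ℝ) - x : ℝ) : ℂ) y] with s h1 h2 h3
      rw [h1, h3, Pi.smul_apply, smul_eq_mul]
      by_cases hs : s ∈ Ioo (max (x : ℝ) x') (max (x : ℝ) x' + 1)
      · have h4 := (le_max_left (x : ℝ) x').trans_lt hs.1
        have h5 := (le_max_right (x : ℝ) x').trans_lt hs.1
        rw [abs_of_pos (by linarith), abs_of_pos (by linarith), sub_sub_sub_cancel_left]
      · simp only [h2 hs, mul_zero]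
    refine le_trans ?_ (le_iSup₂ (f := fun (y : (eikonal (atomAt x) - eikonal (atomAt x')).domain)
      (_ : ‖(y : L2Half)‖ ≤ 1) => ‖(eikonal (atomAt x) - eikonal (atomAt x')) y‖ₑ)
      ⟨y, hdom⟩ hnorm.le)
    rw [hval, ← ofReal_norm, norm_smul, hnorm, mul_one, Complex.norm_real, Real.norm_eq_abs,
      abs_sub_comm]

end Eikonal

/-! ### The half-line as parameter space of the spectrum. -/

section Parametrization

variable {q : ℝ → ℝ} {hA : IsPositiveDefinite (slOp q)} {φ : L2Half}

/-- The parametrization `x ↦ atomAt x` of the wave spectrum. -/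
def atomEquiv (hφ : IsKernelVector hA φ) (hq : ContDiffOn ℝ ∞ q (Ici 0)) :
    ℝ≥0 ≃ waveSpectrum (slOp q) hA :=
  Equiv.ofBijective (fun x => ⟨atomAt x, (mem_waveSpectrum_iff hφ hq).2 ⟨x, rfl⟩⟩)
    ⟨fun _ _ h => atomAt_le_imp_eq (Subtype.ext_iff.1 h).le, fun α => by
      obtain ⟨x, hx⟩ := (mem_waveSpectrum_iff hφ hq).1 α.2
      exact ⟨x, Subtype.ext hx⟩⟩

theorem atomEquiv_apply (hφ : IsKernelVector hA φ) (hq : ContDiffOn ℝ ∞ q (Ici 0)) (x : ℝ≥0) :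
    (atomEquiv hφ hq x).1 = atomAt x := rfl

theorem atomAt_atomEquiv_symm (hφ : IsKernelVector hA φ) (hq : ContDiffOn ℝ ∞ q (Ici 0))
    (α : waveSpectrum (slOp q) hA) : atomAt ((atomEquiv hφ hq).symm α) = α.1 := by
  rw [← atomEquiv_apply hφ hq, Equiv.apply_symm_apply]

theorem eikonalDist_eq (hφ : IsKernelVector hA φ) (hq : ContDiffOn ℝ ∞ q (Ici 0))
    (α α' : waveSpectrum (slOp q) hA) : eikonalDist α.1 α'.1 = ENNReal.ofReal
      |((atomEquiv hφ hq).symm α : ℝ) - ((atomEquiv hφ hq).symm α' : ℝ)| := by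
  rw [← atomAt_atomEquiv_symm hφ hq α, ← atomAt_atomEquiv_symm hφ hq α', eikonalDist_atomAt]

end Parametrization

end WaveSpectrum

end

theorem corollary1 (q : ℝ → ℝ) (hq : ContDiffOn ℝ ∞ q (Ici 0))
    (hlp : WaveSpectrum.IsLimitPoint q)
    (hpos : WaveSpectrum.IsPositiveDefinite (WaveSpectrum.slOp q)) :
    (∀ α α' : WaveSpectrum.waveSpectrum (WaveSpectrum.slOp q) hpos,
      Dense ((WaveSpectrum.eikonal α.1 - WaveSpectrum.eikonal α'.1).domain :
        Set WaveSpectrum.L2Half)) ∧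
    (∃ m : MetricSpace (WaveSpectrum.waveSpectrum (WaveSpectrum.slOp q) hpos),
      ∀ α α', WaveSpectrum.eikonalDist α.1 α'.1 = ENNReal.ofReal (m.dist α α')) ∧
    ∃ β : ℝ≥0 ≃ WaveSpectrum.waveSpectrum (WaveSpectrum.slOp q) hpos,
      (∀ x, (β x).1 = WaveSpectrum.atomAt x) ∧
      (∀ α α', WaveSpectrum.eikonalDist α.1 α'.1 =
        ENNReal.ofReal |(β.symm α : ℝ) - (β.symm α' : ℝ)|) := by
  obtain ⟨φ, hφ⟩ := WaveSpectrum.exists_isKernelVector (hA := hpos) hq.continuousOn hlp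
  refine ⟨fun α α' => ?_, ⟨MetricSpace.induced (WaveSpectrum.atomEquiv hφ hq).symm
    (WaveSpectrum.atomEquiv hφ hq).symm.injective inferInstance, fun α α' => ?_⟩,
    WaveSpectrum.atomEquiv hφ hq, WaveSpectrum.atomEquiv_apply hφ hq,
    WaveSpectrum.eikonalDist_eq hφ hq⟩
  · rw [← WaveSpectrum.atomAt_atomEquiv_symm hφ hq α, ← WaveSpectrum.atomAt_atomEquiv_symm hφ hq α']
    exact WaveSpectrum.eikonal_sub_domain_dense _ _
  · exact WaveSpectrum.eikonalDist_eq hφ hq α α'
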